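/- Let $f:\mathbb R^n\to\mathbb R$ be convex and continuous, let $x_0\in\mathbb R^n$, and assume $0\notin\partial f(x_0)$, where $\partial f(x_0)=\{s\in\mathbb R^n: f(x)\ge f(x_0)+\langle s,x-x_0\rangle\ \forall x\in\mathbb R^n\}$ is the subdifferential. Put $$D=\mathbf D_f(x_0,\mathbb R^+):=\mathbb E\big[\operatorname{dist}^2\big(h,\operatorname{cone}(\partial f(x_0))\big)\big],\qquad h\sim\mathcal N(0,I_n),$$ where $\operatorname{cone}$ denotes the conic hull and $\operatorname{dist}$ the Euclidean distance. For $\sigma>0$ let $A\in\mathbb R^{m\times n}$ have independent standard normal entries, let $z\sim\mathcal N(0,\sigma^2 I_m)$ be independent of $A$, and let $y=Ax_0+z$. The constrained LASSO (C-LASSO) is the problem $$\min_{x\in\mathbb R^n}\ \|y-Ax\|_2\quad\text{subject to}\quad f(x)\le f(x_0).$$ **Theorem (NSE of C-LASSO).** For all constants $\epsilon_L>0$ and $\epsilon>0$ there are a constant $C=C(\epsilon,\epsilon_L)>0$ and a number $m_0=m_0(\epsilon,\epsilon_L)$ such that the following holds for all $m\ge m_0$ and all $n$, $f$, $x_0$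 as above with $$(1-\epsilon_L)\,m\ \ge\ D\ \ge\ \epsilon_L\, m .$$ 1. For every $\sigma>0$, with probability at least $1-\exp(-Cm)$ over $(A,z)$, the C-LASSO has a minimizer and every minimizer $x_c^*$ satisfies $$\frac{\|x_c^*-x_0\|_2^2}{\sigma^2}\ \le\ (1+\epsilon)\,\frac{D}{m-D}.$$ 2. There is a deterministic $\sigma_0>0$ (not depending on $A$ or $z$; it may depend on $m,n,f,x_0,\epsilon,\epsilon_L$) such that for every $0<\sigma\le\sigma_0$, with probability at least $1-\exp(-Cm)$ over $(A,z)$, the C-LASSO has a minimizer and every minimizer $x_c^*$ satisfies $$\left|\frac{\|x_c^*-x_0\|_2^2}{\sigma^2}\cdot\frac{m-D}{D}-1\right|<\epsilon .$$ -/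

import Mathlib

open MeasureTheory ProbabilityTheory

/-- The subdifferential `∂f(x₀)` of a function `f : ℝⁿ → ℝ`. -/
def subdifferential {n : ℕ} (f : EuclideanSpace ℝ (Fin n) → ℝ) (x₀ : EuclideanSpace ℝ (Fin n)) :
    Set (EuclideanSpace ℝ (Fin n)) :=
  {s | ∀ x, f x₀ + inner ℝ s (x - x₀) ≤ f x}

/-- `D_f(x₀, ℝ⁺) = E[dist²(h, cone(∂f(x₀)))]` for `h ~ N(0, Iₙ)`, where `cone` is the conic hull. -/
noncomputable def gaussianSqDist {n : ℕ} (f : EuclideanSpace ℝ (Fin n) → ℝ)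
    (x₀ : EuclideanSpace ℝ (Fin n)) : ℝ :=
  ∫ h, Metric.infDist h
    (PointedCone.hull ℝ (subdifferential f x₀) : Set (EuclideanSpace ℝ (Fin n))) ^ 2
    ∂(stdGaussian (EuclideanSpace ℝ (Fin n)))

/-- The set of solutions of the constrained LASSO with data `y = A x₀ + z`, that is, of all
minimizers of `‖y - A x‖` over the vectors `x` with `f x ≤ f x₀`. -/
def constrainedLasso {m n : ℕ} (f : EuclideanSpace ℝ (Fin n) → ℝ) (x₀ : EuclideanSpace ℝ (Fin n))
    (A : Matrix (Fin m) (Fin n) ℝ) (z : EuclideanSpace ℝ (Fin m)) :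
    Set (EuclideanSpace ℝ (Fin n)) :=
  {x | f x ≤ f x₀ ∧
    IsMinOn (fun x' => ‖(Matrix.toEuclideanLin A x₀ + z) - Matrix.toEuclideanLin A x'‖)
      {x' | f x' ≤ f x₀} x}

/-- The random matrix `A` has independent standard normal entries, the noise `z` is
`N(0, σ² I_m)`, and `A` and `z` are independent: all the entries of `A` and of `z` together are
independent, those of `A` with law `N(0, 1)` and those of `z` with law `N(0, σ²)`. -/
structure IsGaussianModel {Ω : Type*} [MeasurableSpace Ω] (P : Measure Ω) {m n : ℕ} (σ : ℝ)
    (A : Ω → Matrix (Fin m) (Fin n) ℝ) (z : Ω → EuclideanSpace ℝ (Fin m)) : Prop where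
  matrix_law : ∀ i j, HasLaw (fun ω => A ω i j) (gaussianReal 0 1) P
  noise_law : ∀ i, HasLaw (fun ω => z ω i) (gaussianReal 0 (σ ^ 2).toNNReal) P
  indep : iIndepFun (fun (k : (Fin m × Fin n) ⊕ Fin m) (ω : Ω) =>
    Sum.elim (fun p : Fin m × Fin n => A ω p.1 p.2) (fun i : Fin m => z ω i) k) P

/-!
The substitution `x = x₀ + σ w` turns the LASSO into the minimization of `‖A w - z‖`, with all entries
of `A` and `z` independent standard normal, over the convex set `K` of increments `w` with
`f (x₀ + σ w) ≤ f x₀`; the quantity to be located is the norm of the minimizers.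

By Gordon's inequality (`measure_forall_exists_lt_inner_le`), the minimum of `‖A w - z‖` over a set is
controlled by that of the auxiliary objective `√(1 + ‖w‖²) ‖g‖ - ⟪h, w⟫ + h'` with independent
Gaussian `g`, `h`, `h'`. One tail bound holds for every set
(`stdGaussian_exists_norm_residual_lt_le`); the other one holds for convex compact sets, where the
maximum over directions and the minimum over points may be exchanged
(`stdGaussian_forall_le_norm_residual_le`). Gordon's inequality is obtained by Gaussian interpolation
(`integral_comp_inner_le_of_mul_nonpos`) applied to a smooth approximation of an indicator.

Every feasible increment is in the polar of the subdifferential, so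
`⟪h, w⟫ ≤ ‖w‖ dist(h, cone ∂f(x₀))`. By concentration of Lipschitz functions of Gaussian vectors
(`LipschitzWith.hasSubgaussianMGF_stdGaussian`), `‖g‖` is close to `√m` and the distance is at most
`√D` up to a small multiple of `√m`. With `ρ² = D / m` and `s² = 1 - ρ²`, the auxiliary objective is
therefore at least about `√m (√(1 + r²) - ρ r)` at a feasible point of norm `r`. This profile has its
minimum `s √m` at `r = ρ / s`, that is, at `r² = D / (m - D)`, and exceeds it by a definite amount away
from there (`add_le_sqrt_one_add_sq_sub`).

For the upper bound on `‖w‖`, a feasible point on a sphere of radius `r > ρ / s` is compared with the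
point of norm `ρ / s` on the same ray, which is feasible by convexity and has a definitely smaller
auxiliary objective, whatever the minimum over the ball may be
(`IsTypical.lt_auxObjective_of_norm_eq`). Hence `‖A w - z‖` is larger on the sphere than somewhere in
the ball, and by convexity all minimizers lie in the ball (`ConvexOn.exists_isMinOn_and_norm_lt`). For
the lower bound, `K` increases to the cone of feasible directions as `σ` decreases to `0`. Since
`0 ∉ ∂f(x₀)`, the closure of that cone is the polar of `∂f(x₀)` (`exists_feasible_direction`), so for
small `σ` the mean of the minimum of the auxiliary objective is close to `s √m`
(`exists_integral_auxValue_le`), whereas the objective is definitely larger at all points of smaller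
norm (`exists_forall_isTypical_lt_auxObjective`).
-/

/-! ### Gaussian concentration for Lipschitz functions -/

lemma absolutelyContinuous_pi_fin {n : ℕ} {μ ν : Measure ℝ} [IsProbabilityMeasure μ] [SigmaFinite ν]
    (h : μ ≪ ν) :
    (Measure.pi fun _ : Fin n => μ) ≪ Measure.pi fun _ : Fin n => ν := by
  induction n with
  | zero => rw [Measure.pi_of_empty, Measure.pi_of_empty]
  | succ n ih =>
    have h1 := (measurePreserving_piFinSuccAbove (fun _ : Fin (n + 1) => μ) 0).symm
    have h2 := (measurePreserving_piFinSuccAbove (fun _ : Fin (n + 1) => ν) 0).symm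
    rw [← h1.map_eq, ← h2.map_eq]
    exact (h.prod ih).map (MeasurableEquiv.measurable _)

lemma LipschitzWith.abs_le_norm {E : Type*} [SeminormedAddCommGroup E] {f : E → ℝ} {L : NNReal}
    (hf : LipschitzWith L f) (x : E) :
    |f x| ≤ |f 0| + L * ‖x‖ := by
  have h1 := hf.dist_le_mul x 0
  rw [Real.dist_eq, dist_zero_right] at h1
  have := abs_sub_abs_le_abs_sub (f x) (f 0)
  linarith

section Concentration

variable {E : Type*} [NormedAddCommGroup E] [InnerProductSpace ℝ E] [FiniteDimensional ℝ E]
  [MeasurableSpace E] [BorelSpace E]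

lemma stdGaussian_absolutelyContinuous : stdGaussian E ≪ (volume : Measure E) := by
  have h0 : (Measure.pi fun _ : Fin (Module.finrank ℝ E) => gaussianReal 0 1) ≪
      (volume : Measure (Fin (Module.finrank ℝ E) → ℝ)) :=
    absolutelyContinuous_pi_fin (gaussianReal_absolutelyContinuous 0 one_ne_zero)
  have h1 := (PiLp.volume_preserving_toLp (Fin (Module.finrank ℝ E)))
  have h2 := (stdOrthonormalBasis ℝ E).measurePreserving_repr_symm
  rw [stdGaussian, ← h2.map_eq, ← h1.map_eq, Measure.map_map (by fun_prop) (by fun_prop)]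
  have h3 : (fun x : Fin (Module.finrank ℝ E) → ℝ => ∑ i, x i • stdOrthonormalBasis ℝ E i) =
      (stdOrthonormalBasis ℝ E).repr.symm ∘ WithLp.toLp 2 := by
    ext x
    exact (OrthonormalBasis.sum_repr_symm _ _)
  rw [h3]
  exact h0.map (by fun_prop)

lemma integrable_exp_mul_norm_stdGaussian (c : ℝ) :
    Integrable (fun x : E => Real.exp (c * ‖x‖)) (stdGaussian E) := by
  obtain ⟨C, hC, hint⟩ := IsGaussian.exists_integrable_exp_sq (stdGaussian E)
  refine (hint.const_mul (Real.exp (c ^ 2 / (4 * C)))).mono' (by fun_prop) (ae_of_all _ fun x => ?_)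
  rw [Real.norm_eq_abs, Real.abs_exp, ← Real.exp_add]
  gcongr
  have : 0 ≤ (2 * C * ‖x‖ - c) ^ 2 / (4 * C) := by positivity
  have e : (2 * C * ‖x‖ - c) ^ 2 / (4 * C) = c ^ 2 / (4 * C) + C * ‖x‖ ^ 2 - c * ‖x‖ := by
    field_simp; ring
  linarith

lemma integral_exp_dual_stdGaussian (L : StrongDual ℝ E) :
    ∫ x, Real.exp (L x) ∂(stdGaussian E) = Real.exp (‖L‖ ^ 2 / 2) := by
  have h := IsGaussian.map_eq_gaussianReal (μ := stdGaussian E) L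
  rw [integral_strongDual_stdGaussian, variance_dual_stdGaussian] at h
  have := mgf_gaussianReal h 1
  simpa [mgf] using this

lemma LipschitzWith.integrable_exp_stdGaussian {f : E → ℝ} {L : NNReal} (hf : LipschitzWith L f)
    (t : ℝ) : Integrable (fun x => Real.exp (t * f x)) (stdGaussian E) := by
  refine ((integrable_exp_mul_norm_stdGaussian (|t| * L)).const_mul
    (Real.exp (|t| * |f 0|))).mono' ?_ (ae_of_all _ fun x => ?_)
  · exact (Real.continuous_exp.comp (hf.continuous.const_mul t)).aestronglyMeasurable
  · rw [Real.norm_eq_abs, Real.abs_exp, ← Real.exp_add]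
    gcongr
    calc t * f x ≤ |t| * |f x| := by rw [← abs_mul]; exact le_abs_self _
      _ ≤ |t| * (|f 0| + L * ‖x‖) := by gcongr; exact hf.abs_le_norm x
      _ = _ := by ring

lemma LipschitzWith.integrable_stdGaussian {f : E → ℝ} {L : NNReal} (hf : LipschitzWith L f) :
    Integrable f (stdGaussian E) := by
  have h : Integrable (fun x : E => ‖x‖) (stdGaussian E) := IsGaussian.integrable_id.norm
  refine ((integrable_const (|f 0|)).add (h.const_mul L)).mono'
    hf.continuous.aestronglyMeasurable (ae_of_all _ fun x => hf.abs_le_norm x)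

open Real in
lemma LipschitzWith.abs_rotation_sub_le {E : Type*} [NormedAddCommGroup E] [NormedSpace ℝ E]
    {f : E → ℝ} {L : NNReal} (hf : LipschitzWith L f)
    (K : ℕ) (hK : 0 < K) (x y : E) :
    |K * (f (cos (π / 2 / K) • x + sin (π / 2 / K) • y) - f x)| ≤ L * (π / 2) * (‖x‖ + ‖y‖) := by
  have hK' : (0 : ℝ) < K := by positivity
  have hKθ : (K : ℝ) * (π / 2 / K) = π / 2 := by field_simp
  set θ : ℝ := π / 2 / K with hθ
  have hθ0 : 0 ≤ θ := by positivity
  have h1 : |sin θ| ≤ θ := by simpa [abs_of_nonneg hθ0] using abs_sin_sub_sin_le θ 0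
  have h2 : |cos θ - 1| ≤ θ := by simpa [abs_of_nonneg hθ0] using abs_cos_sub_cos_le θ 0
  have h3 := hf.dist_le_mul (cos θ • x + sin θ • y) x
  rw [Real.dist_eq, dist_eq_norm] at h3
  have h4 : ‖cos θ • x + sin θ • y - x‖ ≤ θ * (‖x‖ + ‖y‖) := by
    have : cos θ • x + sin θ • y - x = (cos θ - 1) • x + sin θ • y := by
      rw [sub_smul, one_smul]; abel
    rw [this]
    refine (norm_add_le _ _).trans ?_
    rw [norm_smul, norm_smul, Real.norm_eq_abs, Real.norm_eq_abs, mul_add]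
    gcongr
  rw [abs_mul, abs_of_pos hK']
  calc (K : ℝ) * |f (cos θ • x + sin θ • y) - f x| ≤ K * (L * (θ * (‖x‖ + ‖y‖))) := by
        gcongr; exact h3.trans (by gcongr)
    _ = L * (K * θ) * (‖x‖ + ‖y‖) := by ring
    _ = _ := by rw [hKθ]

lemma integrable_exp_mul_norm_add_norm (c : ℝ) :
    Integrable (fun p : E × E => Real.exp (c * (‖p.1‖ + ‖p.2‖)))
      ((stdGaussian E).prod (stdGaussian E)) := by
  have := (integrable_exp_mul_norm_stdGaussian (E := E) c).mul_prod
    (integrable_exp_mul_norm_stdGaussian (E := E) c)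
  simpa only [mul_add, Real.exp_add] using this

open Real in
/-- Rotating `(x, y)` by `π / 2` in `K` equal steps reduces the difference `f y - f x` to `K`
identically distributed small differences, which convexity of `exp` averages. -/
lemma LipschitzWith.integral_exp_sub_le_rotation {f : E → ℝ} {L : NNReal} (hf : LipschitzWith L f)
    (t : ℝ) (K : ℕ) (hK : 0 < K) :
    ∫ p, exp (t * (f p.2 - f p.1)) ∂((stdGaussian E).prod (stdGaussian E)) ≤
      ∫ p, exp (t * (K * (f (cos (π / 2 / K) • p.1 + sin (π / 2 / K) • p.2) - f p.1)))
        ∂((stdGaussian E).prod (stdGaussian E)) := by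
  have hK' : (K : ℝ) ≠ 0 := by positivity
  have hKθ : (K : ℝ) * (π / 2 / K) = π / 2 := by field_simp
  have hbound := hf.abs_rotation_sub_le K hK
  set μ := (stdGaussian E).prod (stdGaussian E)
  set θ : ℝ := π / 2 / K with hθ
  set g : E × E → ℝ := fun p => exp (t * (K * (f (cos θ • p.1 + sin θ • p.2) - f p.1))) with hg
  let R : ℕ → E × E →L[ℝ] E × E := fun k => ContinuousLinearMap.rotation ((k : ℝ) * θ)
  have hR (k : ℕ) : μ.map (R k) = μ := IsGaussian.map_rotation_eq_self (by simp) _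
  have hRm (k : ℕ) : AEMeasurable (R k) μ := (R k).continuous.aemeasurable
  have hfc := hf.continuous
  have hgc : Continuous g := by fun_prop
  have hgint : Integrable g μ := by
    refine (integrable_exp_mul_norm_add_norm (E := E) (|t| * (L * (π / 2)))).mono'
      hgc.aestronglyMeasurable (ae_of_all _ fun p => ?_)
    rw [Real.norm_eq_abs, Real.abs_exp]
    refine exp_le_exp.2 ((le_abs_self _).trans ?_)
    rw [abs_mul, mul_assoc |t|]
    exact mul_le_mul_of_nonneg_left (hbound p.1 p.2) (abs_nonneg t)
  have hgRint (k : ℕ) : Integrable (fun p => g (R k p)) μ := by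
    have h := hgint
    rw [← hR k] at h
    exact h.comp_aemeasurable (hRm k)
  have hint (k : ℕ) : ∫ p, g (R k p) ∂μ = ∫ p, g p ∂μ := by
    conv_rhs => rw [← hR k]
    rw [integral_map (hRm k) hgc.aestronglyMeasurable]
  have hstep (k : ℕ) (p : E × E) :
      g (R k p) = exp (K * t * (f (R (k + 1) p).1 - f (R k p).1)) := by
    have : cos θ • (R k p).1 + sin θ • (R k p).2 = (R (k + 1) p).1 := by
      simp only [R, ContinuousLinearMap.rotation_apply, Nat.cast_add, Nat.cast_one, add_mul,
        one_mul, cos_add, sin_add]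
      module
    simp only [hg, this]
    ring_nf
  have hjensen (p : E × E) :
      exp (t * (f p.2 - f p.1)) ≤ ∑ k ∈ Finset.range K, (1 / K : ℝ) * g (R k p) := by
    have h := convexOn_exp.map_sum_le (t := Finset.range K) (w := fun _ => (1 / K : ℝ))
      (p := fun k => K * t * (f (R (k + 1) p).1 - f (R k p).1)) (fun _ _ => by positivity)
      (by simp [hK']) (fun _ _ => Set.mem_univ _)
    simp only [smul_eq_mul, ← hstep] at h
    refine le_of_eq_of_le ?_ h
    rw [← Finset.mul_sum, ← Finset.mul_sum, Finset.sum_range_sub (fun k => f (R k p).1)]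
    simp only [R, ContinuousLinearMap.rotation_apply, hKθ]
    simp
    field_simp
  calc ∫ p, exp (t * (f p.2 - f p.1)) ∂μ
      ≤ ∫ p, ∑ k ∈ Finset.range K, (1 / K : ℝ) * g (R k p) ∂μ :=
        integral_mono_of_nonneg (ae_of_all _ fun _ => (exp_pos _).le)
          (integrable_finsetSum _ fun k _ => (hgRint k).const_mul _) (ae_of_all _ hjensen)
    _ = ∫ p, g p ∂μ := by
        rw [integral_finsetSum _ fun k _ => (hgRint k).const_mul _]
        simp_rw [integral_const_mul, hint]
        simp [hK']

open Real Filter Topology in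
lemma tendsto_rotation_slope {E : Type*} [NormedAddCommGroup E] [NormedSpace ℝ E]
    {f : E → ℝ} {x : E} (hf : DifferentiableAt ℝ f x) (y : E) :
    Tendsto (fun K : ℕ => K * (f (cos (π / 2 / K) • x + sin (π / 2 / K) • y) - f x)) atTop
      (𝓝 (π / 2 * fderiv ℝ f x y)) := by
  have hc : HasDerivAt (fun θ : ℝ => cos θ • x + sin θ • y) y 0 := by
    have h1 := ((hasDerivAt_cos 0).smul_const x).add ((hasDerivAt_sin 0).smul_const y)
    simp only [sin_zero, neg_zero, zero_smul, cos_zero, one_smul, zero_add] at h1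
    exact h1
  have hx : cos 0 • x + sin 0 • y = x := by simp
  have hd : HasDerivAt (fun θ : ℝ => f (cos θ • x + sin θ • y)) (fderiv ℝ f x y) 0 := by
    have h2 : HasFDerivAt f (fderiv ℝ f x) (cos 0 • x + sin 0 • y) := by
      rw [hx]; exact hf.hasFDerivAt
    exact h2.comp_hasDerivAt (0 : ℝ) hc
  have hs := hasDerivAt_iff_tendsto_slope_zero.1 hd
  have hθ : Tendsto (fun K : ℕ => π / 2 / (K : ℝ)) atTop (𝓝[≠] 0) := by
    refine tendsto_nhdsWithin_iff.2 ⟨tendsto_const_div_atTop_nhds_zero_nat _, ?_⟩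
    filter_upwards [eventually_gt_atTop 0] with K hK
    have : (0 : ℝ) < π / 2 / K := by positivity
    exact this.ne'
  have := (hs.comp hθ).const_mul (π / 2)
  refine this.congr' ?_
  filter_upwards [eventually_gt_atTop 0] with K hK
  have : (K : ℝ) ≠ 0 := by positivity
  have := pi_ne_zero
  simp only [Function.comp, zero_add, smul_eq_mul, cos_zero, sin_zero, one_smul, zero_smul,
    add_zero, inv_div]
  field_simp

open Real Filter Topology in
/-- The Maurey–Pisier inequality for Lipschitz functions. -/
lemma LipschitzWith.integral_exp_sub_le {f : E → ℝ} {L : NNReal} (hf : LipschitzWith L f) (t : ℝ) :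
    ∫ p, exp (t * (f p.2 - f p.1)) ∂((stdGaussian E).prod (stdGaussian E)) ≤
      exp (t ^ 2 * (π ^ 2 / 4 * L ^ 2) / 2) := by
  set μ := (stdGaussian E).prod (stdGaussian E) with hμ
  have hfc := hf.continuous
  have hbound := fun K hK => hf.abs_rotation_sub_le K hK
  have hdiff : ∀ᵐ p ∂μ, DifferentiableAt ℝ f p.1 := by
    have h1 : ∀ᵐ x ∂(stdGaussian E), DifferentiableAt ℝ f x :=
      stdGaussian_absolutelyContinuous.ae_le hf.ae_differentiableAt
    exact Measure.quasiMeasurePreserving_fst.ae h1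
  have hlim : ∀ᵐ p ∂μ, Tendsto (fun K : ℕ =>
      exp (t * (((K + 1 : ℕ) : ℝ) * (f (cos (π / 2 / (K + 1 : ℕ)) • p.1 +
        sin (π / 2 / (K + 1 : ℕ)) • p.2) - f p.1))))
      atTop (𝓝 (exp (t * (π / 2 * fderiv ℝ f p.1 p.2)))) := by
    filter_upwards [hdiff] with p hp
    exact (continuous_exp.tendsto _).comp
      (((tendsto_rotation_slope hp p.2).comp (tendsto_add_atTop_nat 1)).const_mul t)
  have hb (K : ℕ) (p : E × E) : ‖exp (t * (((K + 1 : ℕ) : ℝ) * (f (cos (π / 2 / (K + 1 : ℕ)) • p.1 +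
        sin (π / 2 / (K + 1 : ℕ)) • p.2) - f p.1)))‖ ≤
        exp (|t| * (L * (π / 2)) * (‖p.1‖ + ‖p.2‖)) := by
    rw [Real.norm_eq_abs, Real.abs_exp]
    refine exp_le_exp.2 ((le_abs_self _).trans ?_)
    rw [abs_mul, mul_assoc |t|]
    exact mul_le_mul_of_nonneg_left (hbound (K + 1) K.succ_pos p.1 p.2) (abs_nonneg t)
  have hmeas (K : ℕ) : AEStronglyMeasurable (fun p : E × E => exp (t * (((K + 1 : ℕ) : ℝ) *
      (f (cos (π / 2 / (K + 1 : ℕ)) • p.1 + sin (π / 2 / (K + 1 : ℕ)) • p.2) - f p.1)))) μ :=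
    Continuous.aestronglyMeasurable (by fun_prop)
  have hconv := tendsto_integral_of_dominated_convergence _ hmeas
    (integrable_exp_mul_norm_add_norm (E := E) (|t| * (L * (π / 2))))
    (fun K => ae_of_all _ (hb K)) hlim
  have hle := ge_of_tendsto' hconv
    (fun K => hf.integral_exp_sub_le_rotation t (K + 1) K.succ_pos)
  refine hle.trans ?_
  have hint : Integrable (fun p : E × E => exp (t * (π / 2 * fderiv ℝ f p.1 p.2))) μ := by
    refine (integrable_exp_mul_norm_add_norm (E := E) (|t| * (L * (π / 2)))).mono'
      (aestronglyMeasurable_of_tendsto_ae _ hmeas hlim) ?_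
    filter_upwards [hlim] with p hp
    exact le_of_tendsto' hp.norm fun K => hb K p
  rw [integral_prod _ hint]
  have hinner (x : E) : ∫ y, exp (t * (π / 2 * fderiv ℝ f x y)) ∂(stdGaussian E) ≤
      exp (t ^ 2 * (π ^ 2 / 4 * L ^ 2) / 2) := by
    have h := integral_exp_dual_stdGaussian ((t * (π / 2)) • fderiv ℝ f x)
    simp only [_root_.smul_apply, smul_eq_mul, mul_assoc] at h
    rw [h]
    gcongr
    rw [← mul_assoc, norm_smul, Real.norm_eq_abs, mul_pow, sq_abs]
    have : ‖fderiv ℝ f x‖ ≤ L := norm_fderiv_le_of_lipschitz ℝ hf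
    calc (t * (π / 2)) ^ 2 * ‖fderiv ℝ f x‖ ^ 2 ≤ (t * (π / 2)) ^ 2 * L ^ 2 := by gcongr
      _ = _ := by ring
  calc _ ≤ ∫ _ : E, exp (t ^ 2 * (π ^ 2 / 4 * L ^ 2) / 2) ∂(stdGaussian E) :=
        integral_mono hint.integral_prod_left (integrable_const _) hinner
    _ = _ := by simp

/-- **Gaussian concentration**: a Lipschitz function of a standard Gaussian vector is sub-Gaussian,
with a variance proxy that does not depend on the dimension. -/
theorem LipschitzWith.hasSubgaussianMGF_stdGaussian {f : E → ℝ} {L : NNReal}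
    (hf : LipschitzWith L f) :
    HasSubgaussianMGF (fun x => f x - ∫ y, f y ∂(stdGaussian E))
      (NNReal.pi ^ 2 / 4 * L ^ 2) (stdGaussian E) := by
  set μ := stdGaussian E
  set e := ∫ y, f y ∂μ with he
  have hi (t : ℝ) : Integrable (fun x => Real.exp (t * (f x - e))) μ := by
    have := (hf.integrable_exp_stdGaussian t).const_mul (Real.exp (-(t * e)))
    refine this.congr (ae_of_all _ fun x => ?_)
    simp only
    rw [← Real.exp_add]; ring_nf
  refine ⟨hi, fun t => ?_⟩
  -- By Jensen's inequality, integrating over an independent copy of the vector can only increase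
  -- the exponential moment.
  have h1 : 1 ≤ ∫ x, Real.exp (-t * (f x - e)) ∂μ := by
    have hfi : Integrable (fun x => -t * (f x - e)) μ :=
      ((hf.integrable_stdGaussian).sub (integrable_const _)).const_mul _
    calc (1 : ℝ) = ∫ x, (-t * (f x - e) + 1) ∂μ := by
          rw [integral_add hfi (integrable_const _), integral_const_mul,
            integral_sub hf.integrable_stdGaussian (integrable_const _)]
          simp [he, μ]
      _ ≤ _ := integral_mono (hfi.add (integrable_const _)) (hi (-t))
          fun x => Real.add_one_le_exp _
  have h2 := hf.integral_exp_sub_le t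
  have h3 : ∫ p, Real.exp (t * (f p.2 - f p.1)) ∂(μ.prod μ) =
      (∫ x, Real.exp (-t * (f x - e)) ∂μ) * ∫ x, Real.exp (t * (f x - e)) ∂μ := by
    rw [← integral_prod_mul]
    congr 1 with p
    rw [← Real.exp_add]; ring_nf
  rw [h3] at h2
  have h4 : 0 ≤ ∫ x, Real.exp (t * (f x - e)) ∂μ := integral_nonneg fun _ => (Real.exp_pos _).le
  rw [mgf]
  calc _ ≤ (∫ x, Real.exp (-t * (f x - e)) ∂μ) * ∫ x, Real.exp (t * (f x - e)) ∂μ :=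
        le_mul_of_one_le_left h4 h1
    _ ≤ _ := h2
    _ = _ := by
      push_cast
      simp only [NNReal.coe_real_pi]
      ring_nf

end Concentration

/-! ### Gaussian integration by parts -/

section Stein

variable {E : Type*} [NormedAddCommGroup E] [InnerProductSpace ℝ E] [FiniteDimensional ℝ E]
  [MeasurableSpace E] [BorelSpace E]

lemma integral_dual_mul_inner_stdGaussian (L : StrongDual ℝ E) (a : E) :
    ∫ y, L y * inner ℝ a y ∂(stdGaussian E) = L a := by
  have h := covarianceBilin_apply (μ := stdGaussian E) IsGaussian.memLp_two_id
    ((InnerProductSpace.toDual ℝ E).symm L) a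
  rw [covarianceBilin_stdGaussian, innerSL_apply_apply] at h
  simp only [integral_id_stdGaussian, id_eq, sub_zero] at h
  simpa using h.symm

open Real in
/-- **Stein's lemma** for the standard Gaussian measure. The law of a pair of independent standard
Gaussian vectors `(x, y)` is invariant under rotations, so
`∫ ψ (cos θ • x + sin θ • y) * ⟪a, cos θ • y - sin θ • x⟫` does not depend on `θ`; the identity is
the vanishing of its derivative at `θ = 0`. -/
theorem integral_inner_mul_stdGaussian {ψ : E → ℝ} {ψ' : E → StrongDual ℝ E}
    (hψ : ∀ x, HasFDerivAt ψ (ψ' x) x) (hc : Continuous ψ') {C : ℝ} (hb : ∀ x, |ψ x| ≤ C)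
    (hb' : ∀ x, ‖ψ' x‖ ≤ C) (a : E) :
    ∫ x, inner ℝ a x * ψ x ∂(stdGaussian E) = ∫ x, ψ' x a ∂(stdGaussian E) := by
  have hψc : Continuous ψ := continuous_iff_continuousAt.2 fun x => (hψ x).continuousAt
  have hC : 0 ≤ C := (abs_nonneg _).trans (hb 0)
  set μ := stdGaussian E with hμ
  let A : ℝ → E × E → E := fun θ p => cos θ • p.1 + sin θ • p.2
  let B : ℝ → E × E → E := fun θ p => -sin θ • p.1 + cos θ • p.2
  have hA (θ : ℝ) (p : E × E) : ‖A θ p‖ ≤ ‖p.1‖ + ‖p.2‖ := by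
    refine (norm_add_le _ _).trans ?_
    rw [norm_smul, norm_smul]
    gcongr
    · exact mul_le_of_le_one_left (norm_nonneg _) (abs_cos_le_one θ)
    · exact mul_le_of_le_one_left (norm_nonneg _) (abs_sin_le_one θ)
  have hB (θ : ℝ) (p : E × E) : ‖B θ p‖ ≤ ‖p.1‖ + ‖p.2‖ := by
    refine (norm_add_le _ _).trans ?_
    rw [norm_smul, norm_smul, norm_neg]
    gcongr
    · exact mul_le_of_le_one_left (norm_nonneg _) (abs_sin_le_one θ)
    · exact mul_le_of_le_one_left (norm_nonneg _) (abs_cos_le_one θ)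
  let G : ℝ → E × E → ℝ := fun θ p => ψ (A θ p) * inner ℝ a (B θ p)
  let G' : ℝ → E × E → ℝ := fun θ p =>
    ψ' (A θ p) (B θ p) * inner ℝ a (B θ p) + ψ (A θ p) * inner ℝ a (-A θ p)
  have hder (θ : ℝ) (p : E × E) : HasDerivAt (fun θ => G θ p) (G' θ p) θ := by
    have h1 : HasDerivAt (fun θ => A θ p) (B θ p) θ :=
      ((hasDerivAt_cos θ).smul_const p.1).add ((hasDerivAt_sin θ).smul_const p.2)
    have h2 : HasDerivAt (fun θ => B θ p) (-A θ p) θ := by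
      have := ((hasDerivAt_sin θ).neg.smul_const p.1).add ((hasDerivAt_cos θ).smul_const p.2)
      refine this.congr_deriv ?_
      simp only [A]; module
    have h3 := (hψ (A θ p)).comp_hasDerivAt θ h1
    have h4 := ((innerSL ℝ a).hasFDerivAt (x := B θ p)).comp_hasDerivAt θ h2
    exact h3.mul h4
  have hbound (θ : ℝ) (p : E × E) :
      ‖G' θ p‖ ≤ 3 * C * ‖a‖ * exp (1 * (‖p.1‖ + ‖p.2‖)) := by
    set s := ‖p.1‖ + ‖p.2‖ with hs
    have hs0 : 0 ≤ s := by positivity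
    have e1 : |ψ' (A θ p) (B θ p)| ≤ C * s :=
      ((ψ' (A θ p)).le_opNorm _).trans (mul_le_mul (hb' _) (hB θ p) (norm_nonneg _) hC)
    have e2 : |inner ℝ a (B θ p)| ≤ ‖a‖ * s :=
      (abs_real_inner_le_norm _ _).trans (by gcongr; exact hB θ p)
    have e3 : |inner ℝ a (-A θ p)| ≤ ‖a‖ * s :=
      (abs_real_inner_le_norm _ _).trans (by gcongr; rw [norm_neg]; exact hA θ p)
    have e4 : s ^ 2 ≤ 2 * exp s := by have := quadratic_le_exp_of_nonneg hs0; linarith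
    have e5 : s ≤ exp s := by have := add_one_le_exp s; linarith
    calc ‖G' θ p‖ ≤ |ψ' (A θ p) (B θ p)| * |inner ℝ a (B θ p)| +
          |ψ (A θ p)| * |inner ℝ a (-A θ p)| := by
            rw [← abs_mul, ← abs_mul]; exact abs_add_le _ _
      _ ≤ (C * s) * (‖a‖ * s) + C * (‖a‖ * s) := by gcongr; exact hb _
      _ = C * ‖a‖ * (s ^ 2 + s) := by ring
      _ ≤ C * ‖a‖ * (2 * exp s + exp s) := by gcongr
      _ = _ := by rw [one_mul]; ring
  have hGb (θ : ℝ) (p : E × E) : ‖G θ p‖ ≤ C * ‖a‖ * exp (1 * (‖p.1‖ + ‖p.2‖)) := by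
    have e5 : ‖p.1‖ + ‖p.2‖ ≤ exp (1 * (‖p.1‖ + ‖p.2‖)) := by
      have := add_one_le_exp (1 * (‖p.1‖ + ‖p.2‖)); linarith
    calc ‖G θ p‖ = |ψ (A θ p)| * |inner ℝ a (B θ p)| := by rw [← abs_mul]; rfl
      _ ≤ C * (‖a‖ * (‖p.1‖ + ‖p.2‖)) := by
        gcongr
        · exact hb _
        · exact (abs_real_inner_le_norm _ _).trans (by gcongr; exact hB θ p)
      _ ≤ _ := by rw [mul_assoc]; gcongr
  have hexp := integrable_exp_mul_norm_add_norm (E := E) 1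
  have hGc (θ : ℝ) : Continuous (G θ) := by fun_prop
  have hG'c (θ : ℝ) : Continuous (G' θ) := by
    have : Continuous fun p => ψ' (A θ p) (B θ p) := by
      exact (hc.comp (by fun_prop)).clm_apply (by fun_prop)
    fun_prop
  have hGi (θ : ℝ) : Integrable (G θ) (μ.prod μ) :=
    (hexp.const_mul _).mono' (hGc θ).aestronglyMeasurable (ae_of_all _ (hGb θ))
  have hG'i (θ : ℝ) : Integrable (G' θ) (μ.prod μ) :=
    (hexp.const_mul _).mono' (hG'c θ).aestronglyMeasurable (ae_of_all _ (hbound θ))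
  have hd := (hasDerivAt_integral_of_dominated_loc_of_deriv_le (μ := μ.prod μ) (F := G) (F' := G')
    (x₀ := 0) (s := Set.univ) Filter.univ_mem
    (Filter.Eventually.of_forall fun θ => (hGc θ).aestronglyMeasurable) (hGi 0)
    (hG'c 0).aestronglyMeasurable (ae_of_all _ fun p θ _ => hbound θ p) (hexp.const_mul _)
    (ae_of_all _ fun p θ _ => hder θ p)).2
  have hconst (θ : ℝ) : ∫ p, G θ p ∂(μ.prod μ) = ∫ p, G 0 p ∂(μ.prod μ) := by
    have hR : (μ.prod μ).map (ContinuousLinearMap.rotation θ) = μ.prod μ :=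
      IsGaussian.map_rotation_eq_self (by simp [hμ]) _
    conv_rhs => rw [← hR]
    rw [integral_map (ContinuousLinearMap.continuous _).aemeasurable (hGc 0).aestronglyMeasurable]
    congr 1 with p
    simp [G, A, B, ContinuousLinearMap.rotation_apply]
  have h0 : ∫ p, G' 0 p ∂(μ.prod μ) = 0 := by
    simp_rw [hconst] at hd
    exact hd.unique (hasDerivAt_const _ _)
  rw [integral_prod _ (hG'i 0)] at h0
  have hinner (x : E) : ∫ y, G' 0 (x, y) ∂μ = ψ' x a - inner ℝ a x * ψ x := by
    have hLi : Integrable (fun y => ψ' x y * inner ℝ a y) μ :=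
      IsGaussian.memLp_dual μ (ψ' x) 2 (by simp) |>.integrable_mul
        (IsGaussian.memLp_dual μ (innerSL ℝ a) 2 (by simp))
    simp only [G', A, B, cos_zero, sin_zero, one_smul, zero_smul, add_zero, neg_zero, zero_add,
      inner_neg_right]
    rw [integral_add hLi (integrable_const _), integral_dual_mul_inner_stdGaussian]
    simp
    ring
  have hi1 : Integrable (fun x => ψ' x a) μ :=
    Integrable.of_bound (hc.clm_apply continuous_const).aestronglyMeasurable (C * ‖a‖)
      (ae_of_all _ fun x => ((ψ' x).le_opNorm a).trans (by gcongr; exact hb' x))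
  have hi2 : Integrable (fun x => inner ℝ a x * ψ x) μ :=
    (IsGaussian.integrable_dual μ (innerSL ℝ a)).mul_bdd hψc.aestronglyMeasurable (ae_of_all _ hb)
  simp_rw [hinner] at h0
  rw [integral_sub hi1 hi2] at h0
  linarith

end Stein

/-! ### Comparison of Gaussian processes -/

section Comparison

variable {E₁ E₂ : Type*} [NormedAddCommGroup E₁] [InnerProductSpace ℝ E₁] [FiniteDimensional ℝ E₁]
  [MeasurableSpace E₁] [BorelSpace E₁] [NormedAddCommGroup E₂] [InnerProductSpace ℝ E₂]
  [FiniteDimensional ℝ E₂] [MeasurableSpace E₂] [BorelSpace E₂] {ι : Type*} [Fintype ι]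

/-- Stein's lemma for a function of finitely many linear functionals and shifts. -/
lemma integral_inner_mul_comp_stdGaussian {ψ : (ι → ℝ) → ℝ} {ψ' : ι → (ι → ℝ) → ℝ} {C : ℝ}
    (hψ : ∀ x, HasFDerivAt ψ (∑ j, ψ' j x • ContinuousLinearMap.proj (R := ℝ) j) x)
    (hc : ∀ j, Continuous (ψ' j)) (hb : ∀ x, |ψ x| ≤ C) (hb' : ∀ j x, |ψ' j x| ≤ C)
    (a : ι → E₁) (i : ι) (c : ℝ) (y : ι → ℝ) {T : E₁ → ι → ℝ}
    (hTdef : ∀ ξ k, T ξ k = c * inner ℝ (a k) ξ + y k) :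
    ∫ ξ, inner ℝ (a i) ξ * ψ (T ξ) ∂(stdGaussian E₁) =
      ∑ j, c * inner ℝ (a i) (a j) * ∫ ξ, ψ' j (T ξ) ∂(stdGaussian E₁) := by
  have hC : 0 ≤ C := (abs_nonneg _).trans (hb 0)
  obtain rfl : T = fun ξ k => c * inner ℝ (a k) ξ + y k := funext fun ξ => funext (hTdef ξ)
  set T : E₁ → ι → ℝ := fun ξ k => c * inner ℝ (a k) ξ + y k
  have hTc : Continuous T := by fun_prop
  let D : E₁ → StrongDual ℝ E₁ := fun ξ => ∑ j, (ψ' j (T ξ) * c) • innerSL ℝ (a j)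
  have hD (ξ : E₁) : HasFDerivAt (fun ξ => ψ (T ξ)) (D ξ) ξ := by
    have hT : HasFDerivAt T (ContinuousLinearMap.pi fun k => c • innerSL ℝ (a k)) ξ := by
      rw [hasFDerivAt_pi]
      intro k
      exact (((innerSL ℝ (a k)).hasFDerivAt).const_mul c).add_const (y k)
    refine ((hψ (T ξ)).comp ξ hT).congr_fderiv ?_
    ext v
    simp [D, mul_assoc]
  have hDc : Continuous D := by
    refine continuous_finsetSum _ fun j _ => ?_
    exact (((hc j).comp hTc).mul continuous_const).smul continuous_const
  set C' : ℝ := C + ∑ j, C * |c| * ‖a j‖ with hC'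
  have hsum : 0 ≤ ∑ j, C * |c| * ‖a j‖ := Finset.sum_nonneg fun j _ => by positivity
  have hDb (ξ : E₁) : ‖D ξ‖ ≤ C' := by
    refine (norm_sum_le _ _).trans ?_
    refine (Finset.sum_le_sum fun j _ => ?_).trans (le_add_of_nonneg_left hC)
    rw [norm_smul, norm_mul, innerSL_apply_norm, Real.norm_eq_abs, Real.norm_eq_abs]
    gcongr
    exact hb' j _
  have := integral_inner_mul_stdGaussian hD hDc (C := C')
    (fun ξ => (hb _).trans (le_add_of_nonneg_right hsum)) hDb (a i)
  refine this.trans ?_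
  have hi (j : ι) : Integrable (fun ξ => ψ' j (T ξ)) (stdGaussian E₁) :=
    Integrable.of_bound ((hc j).comp hTc).aestronglyMeasurable C (ae_of_all _ fun ξ => hb' j _)
  have he (ξ : E₁) : D ξ (a i) = ∑ j, c * inner ℝ (a i) (a j) * ψ' j (T ξ) := by
    simp only [D, _root_.sum_apply, _root_.smul_apply, innerSL_apply_apply, smul_eq_mul]
    refine Finset.sum_congr rfl fun j _ => ?_
    rw [real_inner_comm]; ring
  simp_rw [he]
  rw [integral_finsetSum _ fun j _ => (hi j).const_mul _]
  simp_rw [integral_const_mul]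

open Real in
/-- **Gaussian interpolation.** If the covariances of two centred Gaussian vectors differ, entry by
entry, by the opposite sign of the second partial derivatives of `F`, then the expectations of `F`
are ordered. -/
theorem integral_comp_inner_le_of_mul_nonpos {F : (ι → ℝ) → ℝ} {F' : ι → (ι → ℝ) → ℝ}
    {F'' : ι → ι → (ι → ℝ) → ℝ} {C : ℝ}
    (hF : ∀ x, HasFDerivAt F (∑ j, F' j x • ContinuousLinearMap.proj (R := ℝ) j) x)
    (hF' : ∀ i x, HasFDerivAt (F' i) (∑ j, F'' i j x • ContinuousLinearMap.proj (R := ℝ) j) x)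
    (hc : ∀ i j, Continuous (F'' i j)) (hb : ∀ x, |F x| ≤ C) (hb' : ∀ i x, |F' i x| ≤ C)
    (hb'' : ∀ i j x, |F'' i j x| ≤ C) (a : ι → E₁) (b : ι → E₂)
    (hab : ∀ i j x, (inner ℝ (b i) (b j) - inner ℝ (a i) (a j)) * F'' i j x ≤ 0) :
    ∫ η, F (fun k => inner ℝ (b k) η) ∂(stdGaussian E₂) ≤
      ∫ ξ, F (fun k => inner ℝ (a k) ξ) ∂(stdGaussian E₁) := by
  have hC : 0 ≤ C := (abs_nonneg _).trans (hb 0)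
  have hFc : Continuous F := continuous_iff_continuousAt.2 fun x => (hF x).continuousAt
  have hF'c (i) : Continuous (F' i) := continuous_iff_continuousAt.2 fun x => (hF' i x).continuousAt
  set μ := stdGaussian E₁
  set ν := stdGaussian E₂
  let Z : ℝ → E₁ × E₂ → ι → ℝ := fun θ p k =>
    cos θ * inner ℝ (a k) p.1 + sin θ * inner ℝ (b k) p.2
  let Z' : ℝ → E₁ × E₂ → ι → ℝ := fun θ p k =>
    -sin θ * inner ℝ (a k) p.1 + cos θ * inner ℝ (b k) p.2
  have hZc (θ : ℝ) : Continuous (Z θ) := by fun_prop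
  let G : ℝ → E₁ × E₂ → ℝ := fun θ p => F (Z θ p)
  let G' : ℝ → E₁ × E₂ → ℝ := fun θ p => ∑ i, F' i (Z θ p) * Z' θ p i
  let B : E₁ × E₂ → ℝ := fun p => ∑ i, C * (|inner ℝ (a i) p.1| + |inner ℝ (b i) p.2|)
  have hA1 (i : ι) : Integrable (fun p : E₁ × E₂ => inner ℝ (a i) p.1) (μ.prod ν) :=
    (IsGaussian.integrable_dual μ (innerSL ℝ (a i))).comp_fst ν
  have hB1 (i : ι) : Integrable (fun p : E₁ × E₂ => inner ℝ (b i) p.2) (μ.prod ν) :=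
    (IsGaussian.integrable_dual ν (innerSL ℝ (b i))).comp_snd μ
  have hBi : Integrable B (μ.prod ν) :=
    integrable_finsetSum _ fun i _ => ((hA1 i).abs.add (hB1 i).abs).const_mul C
  have hder (θ : ℝ) (p : E₁ × E₂) : HasDerivAt (fun θ => G θ p) (G' θ p) θ := by
    have hZ : HasDerivAt (fun θ => Z θ p) (Z' θ p) θ := by
      rw [hasDerivAt_pi]
      intro k
      exact ((hasDerivAt_cos θ).mul_const _).add ((hasDerivAt_sin θ).mul_const _)
    refine ((hF (Z θ p)).comp_hasDerivAt θ hZ).congr_deriv ?_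
    simp [G']
  have hG'b (θ : ℝ) (p : E₁ × E₂) : ‖G' θ p‖ ≤ B p := by
    refine (norm_sum_le _ _).trans (Finset.sum_le_sum fun i _ => ?_)
    rw [norm_mul, Real.norm_eq_abs, Real.norm_eq_abs]
    refine mul_le_mul (hb' i _) ((abs_add_le _ _).trans ?_) (abs_nonneg _) hC
    rw [abs_mul, abs_mul, abs_neg]
    gcongr
    · exact mul_le_of_le_one_left (abs_nonneg _) (abs_sin_le_one θ)
    · exact mul_le_of_le_one_left (abs_nonneg _) (abs_cos_le_one θ)
  have hGc (θ : ℝ) : Continuous (G θ) := hFc.comp (hZc θ)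
  have hG'c (θ : ℝ) : Continuous (G' θ) := by
    refine continuous_finsetSum _ fun i _ => ((hF'c i).comp (hZc θ)).mul ?_
    fun_prop
  have hGi (θ : ℝ) : Integrable (G θ) (μ.prod ν) :=
    Integrable.of_bound (hGc θ).aestronglyMeasurable C (ae_of_all _ fun p => hb _)
  have hd (θ : ℝ) := (hasDerivAt_integral_of_dominated_loc_of_deriv_le (μ := μ.prod ν) (F := G)
    (F' := G') (x₀ := θ) (s := Set.univ) Filter.univ_mem
    (Filter.Eventually.of_forall fun θ => (hGc θ).aestronglyMeasurable) (hGi θ)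
    (hG'c θ).aestronglyMeasurable (ae_of_all _ fun p θ _ => hG'b θ p) hBi
    (ae_of_all _ fun p θ _ => hder θ p)).2
  have hF'i (θ : ℝ) (i : ι) : Integrable (fun p => F' i (Z θ p)) (μ.prod ν) :=
    Integrable.of_bound ((hF'c i).comp (hZc θ)).aestronglyMeasurable C (ae_of_all _ fun p => hb' i _)
  have hF''i (θ : ℝ) (i j : ι) : Integrable (fun p => F'' i j (Z θ p)) (μ.prod ν) :=
    Integrable.of_bound ((hc i j).comp (hZc θ)).aestronglyMeasurable C
      (ae_of_all _ fun p => hb'' i j _)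
  have hAF (θ : ℝ) (i : ι) : Integrable (fun p => inner ℝ (a i) p.1 * F' i (Z θ p)) (μ.prod ν) :=
    (hA1 i).mul_bdd (hF'i θ i).aestronglyMeasurable (ae_of_all _ fun p => hb' i _)
  have hBF (θ : ℝ) (i : ι) : Integrable (fun p => inner ℝ (b i) p.2 * F' i (Z θ p)) (μ.prod ν) :=
    (hB1 i).mul_bdd (hF'i θ i).aestronglyMeasurable (ae_of_all _ fun p => hb' i _)
  have hAS (θ : ℝ) (i : ι) : ∫ p, inner ℝ (a i) p.1 * F' i (Z θ p) ∂(μ.prod ν) =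
      ∑ j, cos θ * inner ℝ (a i) (a j) * ∫ p, F'' i j (Z θ p) ∂(μ.prod ν) := by
    rw [integral_prod_symm _ (hAF θ i)]
    have h (η : E₂) := integral_inner_mul_comp_stdGaussian (hF' i) (hc i) (hb' i) (hb'' i) a i
      (cos θ) (fun k => sin θ * inner ℝ (b k) η) (T := fun ξ => Z θ (ξ, η)) fun _ _ => rfl
    refine (integral_congr_ae (ae_of_all _ h)).trans ?_
    refine (integral_finsetSum _ fun j _ => ((hF''i θ i j).integral_prod_right).const_mul _).trans ?_
    refine Finset.sum_congr rfl fun j _ => ?_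
    rw [integral_const_mul, integral_prod_symm _ (hF''i θ i j)]
  have hBS (θ : ℝ) (i : ι) : ∫ p, inner ℝ (b i) p.2 * F' i (Z θ p) ∂(μ.prod ν) =
      ∑ j, sin θ * inner ℝ (b i) (b j) * ∫ p, F'' i j (Z θ p) ∂(μ.prod ν) := by
    rw [integral_prod _ (hBF θ i)]
    have h (ξ : E₁) := integral_inner_mul_comp_stdGaussian (hF' i) (hc i) (hb' i) (hb'' i) b i
      (sin θ) (fun k => cos θ * inner ℝ (a k) ξ) (T := fun η => Z θ (ξ, η)) fun _ _ => add_comm _ _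
    refine (integral_congr_ae (ae_of_all _ h)).trans ?_
    refine (integral_finsetSum _ fun j _ => ((hF''i θ i j).integral_prod_left).const_mul _).trans ?_
    refine Finset.sum_congr rfl fun j _ => ?_
    rw [integral_const_mul, integral_prod _ (hF''i θ i j)]
  have hG'int (θ : ℝ) : ∫ p, G' θ p ∂(μ.prod ν) = ∑ i, ∑ j,
      sin θ * cos θ * ∫ p, (inner ℝ (b i) (b j) - inner ℝ (a i) (a j)) * F'' i j (Z θ p)
        ∂(μ.prod ν) := by
    have e (p : E₁ × E₂) : G' θ p = ∑ i, (-sin θ * (inner ℝ (a i) p.1 * F' i (Z θ p)) +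
        cos θ * (inner ℝ (b i) p.2 * F' i (Z θ p))) :=
      Finset.sum_congr rfl fun i _ => by simp only [Z']; ring
    simp_rw [e]
    refine (integral_finsetSum _ fun i _ =>
      ((hAF θ i).const_mul _).add ((hBF θ i).const_mul _)).trans ?_
    refine Finset.sum_congr rfl fun i _ => ?_
    refine (integral_add ((hAF θ i).const_mul _) ((hBF θ i).const_mul _)).trans ?_
    rw [integral_const_mul, integral_const_mul, hAS, hBS, Finset.mul_sum, Finset.mul_sum,
      ← Finset.sum_add_distrib]
    refine Finset.sum_congr rfl fun j _ => ?_
    rw [integral_const_mul]; ring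
  have hanti : AntitoneOn (fun θ => ∫ p, G θ p ∂(μ.prod ν)) (Set.Icc 0 (π / 2)) := by
    refine antitoneOn_of_deriv_nonpos (convex_Icc _ _)
      (fun θ _ => (hd θ).continuousAt.continuousWithinAt)
      (fun θ _ => (hd θ).differentiableAt.differentiableWithinAt) fun θ hθ => ?_
    rw [interior_Icc] at hθ
    rw [(hd θ).deriv, hG'int]
    have hs : 0 ≤ sin θ := sin_nonneg_of_nonneg_of_le_pi hθ.1.le (by linarith [hθ.2, pi_pos])
    have hcs : 0 ≤ cos θ := cos_nonneg_of_mem_Icc ⟨by linarith [hθ.1, pi_pos], hθ.2.le⟩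
    exact Finset.sum_nonpos fun i _ => Finset.sum_nonpos fun j _ =>
      mul_nonpos_of_nonneg_of_nonpos (mul_nonneg hs hcs)
        (integral_nonpos fun p => hab i j _)
  have hle := hanti (Set.left_mem_Icc.2 (by positivity)) (Set.right_mem_Icc.2 (by positivity))
    (by positivity)
  have e0 : ∫ p, G 0 p ∂(μ.prod ν) = ∫ ξ, F (fun k => inner ℝ (a k) ξ) ∂μ := by
    have h := integral_fun_fst (μ := μ) (ν := ν) fun ξ => F (fun k => inner ℝ (a k) ξ)
    simpa [G, Z] using h
  have e1 : ∫ p, G (π / 2) p ∂(μ.prod ν) = ∫ η, F (fun k => inner ℝ (b k) η) ∂ν := by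
    have h := integral_fun_snd (μ := μ) (ν := ν) fun η => F (fun k => inner ℝ (b k) η)
    simpa [G, Z] using h
  simp only at hle
  rwa [e0, e1] at hle

end Comparison

/-! ### Gordon's inequality -/

lemma measurableSet_forall_exists_lt_inner {E : Type*} [NormedAddCommGroup E]
    [InnerProductSpace ℝ E] [MeasurableSpace E] [BorelSpace E] {U V : Type*} [Countable U]
    [Countable V] (a : U → V → E) (c : ℝ) :
    MeasurableSet {ξ : E | ∀ u, ∃ v, c < inner ℝ (a u v) ξ} := by
  simp only [Set.ofPred_forall, Set.ofPred_exists]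
  exact MeasurableSet.iInter fun u => MeasurableSet.iUnion fun v =>
    (isOpen_lt continuous_const (continuous_const.inner continuous_id)).measurableSet

section Gordon

variable {E₁ E₂ : Type*} [NormedAddCommGroup E₁] [InnerProductSpace ℝ E₁] [FiniteDimensional ℝ E₁]
  [MeasurableSpace E₁] [BorelSpace E₁] [NormedAddCommGroup E₂] [InnerProductSpace ℝ E₂]
  [FiniteDimensional ℝ E₂] [MeasurableSpace E₂] [BorelSpace E₂] {U V : Type*} [Fintype U]
  [Fintype V]

/-- A smooth substitute for the indicator of `∀ u, ∃ v, c < x (u, v)`, when `p` is close to the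
indicator of `(c, ∞)` and `β` is large. -/
noncomputable def softForallExists (β : ℝ) (p : ℝ → ℝ) (x : U × V → ℝ) : ℝ :=
  Real.exp (-β * ∑ u, Real.exp (-β * ∑ v, p (x (u, v))))

lemma softForallExists_nonneg (β : ℝ) (p : ℝ → ℝ) (x : U × V → ℝ) :
    0 ≤ softForallExists β p x := (Real.exp_pos _).le

lemma softForallExists_le_one {β : ℝ} (hβ : 0 ≤ β) (p : ℝ → ℝ) (x : U × V → ℝ) :
    softForallExists β p x ≤ 1 := by
  rw [softForallExists, Real.exp_le_one_iff, neg_mul, neg_nonpos]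
  exact mul_nonneg hβ (Finset.sum_nonneg fun u _ => (Real.exp_pos _).le)

open Classical in
/-- The mixed second partial derivatives of `softForallExists` in two coordinates `(u, v)` and
`(u', v')` with `u ≠ u'` are nonnegative, so Gaussian interpolation applies. -/
theorem integral_softForallExists_le {p p' p'' : ℝ → ℝ} {β C : ℝ} (hβ : 0 ≤ β)
    (hp : ∀ t, HasDerivAt p (p' t) t) (hp' : ∀ t, HasDerivAt p' (p'' t) t) (hpc : Continuous p'')
    (hp0 : ∀ t, 0 ≤ p t) (hp'0 : ∀ t, 0 ≤ p' t) (hp'C : ∀ t, p' t ≤ C) (hp''C : ∀ t, |p'' t| ≤ C)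
    (a : U × V → E₁) (b : U × V → E₂)
    (hsame : ∀ i j, i.1 = j.1 → inner ℝ (a i) (a j) = inner ℝ (b i) (b j))
    (hle : ∀ i j, inner ℝ (b i) (b j) ≤ inner ℝ (a i) (a j)) :
    ∫ η, softForallExists β p (fun k => inner ℝ (b k) η) ∂(stdGaussian E₂) ≤
      ∫ ξ, softForallExists β p (fun k => inner ℝ (a k) ξ) ∂(stdGaussian E₁) := by
  have hC : 0 ≤ C := (hp'0 0).trans (hp'C 0)
  let F : (U × V → ℝ) → ℝ := softForallExists β p
  let e : U → (U × V → ℝ) → ℝ := fun u x => Real.exp (-β * ∑ v, p (x (u, v)))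
  let F' : U × V → (U × V → ℝ) → ℝ := fun i x => β ^ 2 * (F x * e i.1 x * p' (x i))
  let F'' : U × V → U × V → (U × V → ℝ) → ℝ := fun i j x =>
    β ^ 2 * (F' j x * e i.1 x * p' (x i) +
      F x * (if j.1 = i.1 then -β * e i.1 x * p' (x j) else 0) * p' (x i) +
      F x * e i.1 x * (if j = i then p'' (x i) else 0))
  have he0 (u x) : 0 ≤ e u x := (Real.exp_pos _).le
  have he1 (u x) : e u x ≤ 1 := by
    simp only [e, Real.exp_le_one_iff, neg_mul, neg_nonpos]
    exact mul_nonneg hβ (Finset.sum_nonneg fun v _ => hp0 _)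
  have hF0 (x) : 0 ≤ F x := softForallExists_nonneg β p x
  have hF1 (x) : F x ≤ 1 := softForallExists_le_one hβ p x
  have hproj {q q' : ℝ → ℝ} (hq : ∀ t, HasDerivAt q (q' t) t) (i : U × V) (x : U × V → ℝ) :
      HasFDerivAt (fun x : U × V → ℝ => q (x i))
        (q' (x i) • ContinuousLinearMap.proj (R := ℝ) (φ := fun _ : U × V => ℝ) i) x :=
    (hq (x i)).comp_hasFDerivAt x (hasFDerivAt_apply i x)
  have hed (u x) : HasFDerivAt (e u) (∑ j : U × V, (if j.1 = u then -β * e u x * p' (x j) else 0) •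
      ContinuousLinearMap.proj (R := ℝ) (φ := fun _ : U × V => ℝ) j) x := by
    have h : HasFDerivAt (e u) (e u x • -β • ∑ v, p' (x (u, v)) •
        ContinuousLinearMap.proj (R := ℝ) (φ := fun _ : U × V => ℝ) (u, v)) x :=
      ((HasFDerivAt.fun_sum (u := Finset.univ)
        fun v _ => hproj hp (u, v) x).const_mul (-β)).exp
    refine h.congr_fderiv ?_
    ext w
    simp only [_root_.smul_apply, _root_.sum_apply, smul_eq_mul, ContinuousLinearMap.proj_apply,
      Fintype.sum_prod_type, ite_mul, zero_mul]
    rw [Finset.sum_comm]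
    simp only [Finset.sum_ite_eq', Finset.mem_univ, if_true, Finset.mul_sum]
    refine Finset.sum_congr rfl fun v _ => ?_
    ring
  have hFd (x) : HasFDerivAt F (∑ j : U × V, F' j x •
      ContinuousLinearMap.proj (R := ℝ) (φ := fun _ : U × V => ℝ) j) x := by
    have h : HasFDerivAt F (F x • -β • ∑ u, ∑ j : U × V,
        (if j.1 = u then -β * e u x * p' (x j) else 0) •
          ContinuousLinearMap.proj (R := ℝ) (φ := fun _ : U × V => ℝ) j) x :=
      ((HasFDerivAt.fun_sum (u := Finset.univ) fun u _ => hed u x).const_mul (-β)).exp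
    refine h.congr_fderiv ?_
    ext w
    simp only [_root_.smul_apply, _root_.sum_apply, smul_eq_mul, ContinuousLinearMap.proj_apply,
      ite_mul, zero_mul]
    rw [Finset.sum_comm]
    simp only [Finset.sum_ite_eq, Finset.mem_univ, if_true, Finset.mul_sum]
    refine Finset.sum_congr rfl fun v _ => ?_
    simp only [F']; ring
  have hF'd (i x) : HasFDerivAt (F' i) (∑ j : U × V, F'' i j x •
      ContinuousLinearMap.proj (R := ℝ) (φ := fun _ : U × V => ℝ) j) x := by
    have h := (((hFd x).mul (hed i.1 x)).mul (hproj hp' i x)).const_mul (β ^ 2)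
    refine h.congr_fderiv ?_
    ext w
    have h1 : p'' (x i) * w i = ∑ j, (if j = i then p'' (x i) else 0) * w j := by
      simp [ite_mul]
    simp only [_root_.smul_apply, _root_.add_apply, _root_.sum_apply, smul_eq_mul,
      ContinuousLinearMap.proj_apply, Pi.mul_apply, h1]
    simp only [Finset.mul_sum, ← Finset.sum_add_distrib]
    refine Finset.sum_congr rfl fun j _ => ?_
    simp only [F'']; ring
  have hFc : Continuous F := continuous_iff_continuousAt.2 fun x => (hFd x).continuousAt
  have hec (u) : Continuous (e u) := continuous_iff_continuousAt.2 fun x => (hed u x).continuousAt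
  have hp'c : Continuous p' := continuous_iff_continuousAt.2 fun x => (hp' x).continuousAt
  have hF'c (i) : Continuous (F' i) := continuous_iff_continuousAt.2 fun x => (hF'd i x).continuousAt
  have hF'0 (i x) : 0 ≤ F' i x :=
    mul_nonneg (sq_nonneg _) (mul_nonneg (mul_nonneg (hF0 _) (he0 _ _)) (hp'0 _))
  have hF'C (i x) : F' i x ≤ β ^ 2 * C := by
    refine mul_le_mul_of_nonneg_left ?_ (sq_nonneg _)
    calc F x * e i.1 x * p' (x i) ≤ 1 * 1 * C := by
          gcongr <;> first | exact hF1 _ | exact he1 _ _ | exact he0 _ _ | exact hp'C _ | exact hp'0 _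
      _ = C := by ring
  have hF''C (i j x) : |F'' i j x| ≤ β ^ 2 * (β ^ 2 * C * C + β * C * C + C) := by
    have k1 : |F' j x * e i.1 x * p' (x i)| ≤ β ^ 2 * C * C := by
      rw [abs_of_nonneg (mul_nonneg (mul_nonneg (hF'0 _ _) (he0 _ _)) (hp'0 _))]
      calc F' j x * e i.1 x * p' (x i) ≤ β ^ 2 * C * 1 * C := by
            gcongr <;> first | exact hF'C _ _ | exact he1 _ _ | exact he0 _ _ | exact hp'C _ | exact hp'0 _
        _ = _ := by ring
    have k2 : |F x * (if j.1 = i.1 then -β * e i.1 x * p' (x j) else 0) * p' (x i)| ≤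
        β * C * C := by
      have : |(if j.1 = i.1 then -β * e i.1 x * p' (x j) else 0)| ≤ β * C := by
        split_ifs
        · rw [abs_mul, abs_mul, abs_neg, abs_of_nonneg hβ, abs_of_nonneg (he0 _ _),
            abs_of_nonneg (hp'0 _)]
          calc β * e i.1 x * p' (x j) ≤ β * 1 * C := by
                gcongr <;> first | exact he1 _ _ | exact hp'C _ | exact hp'0 _
            _ = _ := by ring
        · rw [abs_zero]; positivity
      rw [abs_mul, abs_mul, abs_of_nonneg (hF0 _), abs_of_nonneg (hp'0 _)]
      calc _ ≤ 1 * (β * C) * C := by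
            gcongr <;> first | exact hF1 _ | exact hp'C _ | exact hp'0 _
        _ = _ := by ring
    have k3 : |F x * e i.1 x * (if j = i then p'' (x i) else 0)| ≤ C := by
      have : |(if j = i then p'' (x i) else 0)| ≤ C := by
        split_ifs
        · exact hp''C _
        · rwa [abs_zero]
      rw [abs_mul, abs_mul, abs_of_nonneg (hF0 _), abs_of_nonneg (he0 _ _)]
      calc _ ≤ 1 * 1 * C := by
            gcongr <;> first | exact hF1 _ | exact he1 _ _
        _ = _ := by ring
    rw [abs_mul, abs_of_nonneg (sq_nonneg β)]
    refine mul_le_mul_of_nonneg_left ?_ (sq_nonneg _)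
    exact (abs_add_le _ _).trans (add_le_add ((abs_add_le _ _).trans (add_le_add k1 k2)) k3)
  refine integral_comp_inner_le_of_mul_nonpos (F := F) (F' := F') (F'' := F'')
    (C := 1 + β ^ 2 * C + β ^ 2 * (β ^ 2 * C * C + β * C * C + C)) hFd hF'd
    (fun i j => ?_) (fun x => ?_) (fun i x => ?_) (fun i j x => ?_) a b fun i j x => ?_
  · have h1 : Continuous fun x : U × V → ℝ =>
        if j.1 = i.1 then -β * e i.1 x * p' (x j) else 0 := by
      split_ifs
      · exact ((continuous_const.mul (hec _)).mul (hp'c.comp (continuous_apply j)))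
      · exact continuous_const
    have h2 : Continuous fun x : U × V → ℝ => if j = i then p'' (x i) else 0 := by
      split_ifs
      · exact hpc.comp (continuous_apply i)
      · exact continuous_const
    have h3 : Continuous fun x : U × V → ℝ => p' (x i) := hp'c.comp (continuous_apply i)
    exact continuous_const.mul (((((hF'c j).mul (hec _)).mul h3).add ((hFc.mul h1).mul h3)).add
      ((hFc.mul (hec _)).mul h2))
  · rw [abs_of_nonneg (hF0 x)]
    have : 0 ≤ β ^ 2 * C + β ^ 2 * (β ^ 2 * C * C + β * C * C + C) := by positivity
    linarith [hF1 x]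
  · rw [abs_of_nonneg (hF'0 i x)]
    have : 0 ≤ β ^ 2 * (β ^ 2 * C * C + β * C * C + C) := by positivity
    linarith [hF'C i x]
  · have : 0 ≤ β ^ 2 * C := by positivity
    linarith [hF''C i j x]
  · by_cases hij : i.1 = j.1
    · rw [hsame i j hij, sub_self, zero_mul]
    · refine mul_nonpos_of_nonpos_of_nonneg (sub_nonpos.2 (hle i j)) ?_
      have hne : j ≠ i := fun h => hij (by rw [h])
      simp only [F'', if_neg hne, if_neg (Ne.symm hij), mul_zero, zero_mul, add_zero]
      exact mul_nonneg (sq_nonneg _)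
        (mul_nonneg (mul_nonneg (hF'0 _ _) (he0 _ _)) (hp'0 _))

open Filter Topology in
/-- With the steep sigmoids below, `softForallExists` converges to the indicator it replaces. The
shift by `-k` settles the boundary case `x (u, v) = c`. -/
lemma tendsto_softForallExists (c : ℝ) (x : U × V → ℝ) :
    Tendsto (fun k : ℕ => softForallExists (k : ℝ)
      (fun t => Real.sigmoid ((k : ℝ) ^ 2 * (t - c) - k)) x) atTop
      (𝓝 (Set.indicator {x : U × V → ℝ | ∀ u, ∃ v, c < x (u, v)} (fun _ => (1 : ℝ)) x)) := by
  set p : ℕ → ℝ → ℝ := fun k t => Real.sigmoid ((k : ℝ) ^ 2 * (t - c) - k)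
  have hpos (k t) : 0 ≤ p k t := Real.sigmoid_nonneg _
  set q : U → ℕ → ℝ := fun u k => (k : ℝ) * Real.exp (-k * ∑ v, p k (x (u, v))) with hq
  have hF (k : ℕ) : softForallExists (k : ℝ) (p k) x = Real.exp (-∑ u, q u k) := by
    rw [softForallExists, hq, neg_mul, Finset.mul_sum]
  have hq0 (u k) : 0 ≤ q u k := by positivity
  have hkexp : Tendsto (fun k : ℕ => (k : ℝ) * Real.exp (-k)) atTop (𝓝 0) := by
    simpa only [Function.comp_def, pow_one] using
      (Real.tendsto_pow_mul_exp_neg_atTop_nhds_zero 1).comp tendsto_natCast_atTop_atTop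
  have hkexp2 : Tendsto (fun k : ℕ => (k : ℝ) * Real.exp (-(k / 2))) atTop (𝓝 0) := by
    have h := (Real.tendsto_pow_mul_exp_neg_atTop_nhds_zero 1).comp
      ((tendsto_natCast_atTop_atTop (R := ℝ)).atTop_div_const (zero_lt_two))
    have h2 := h.const_mul 2
    simp only [mul_zero] at h2
    refine h2.congr fun k => ?_
    simp only [Function.comp, pow_one]; ring
  have hyes (u : U) (hu : ∃ v, c < x (u, v)) : Tendsto (q u) atTop (𝓝 0) := by
    obtain ⟨v, hv⟩ := hu
    refine tendsto_of_tendsto_of_tendsto_of_le_of_le' tendsto_const_nhds hkexp2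
      (Eventually.of_forall (hq0 u)) ?_
    obtain ⟨K, hK⟩ := exists_nat_ge (1 / (x (u, v) - c))
    filter_upwards [eventually_ge_atTop K] with k hk
    have hd : 0 < x (u, v) - c := sub_pos.2 hv
    have h1 : 1 ≤ k * (x (u, v) - c) := by
      have : 1 / (x (u, v) - c) ≤ k := hK.trans (by exact_mod_cast hk)
      rwa [div_le_iff₀ hd] at this
    have h2 : (1 : ℝ) / 2 ≤ p k (x (u, v)) := by
      have : Real.sigmoid 0 ≤ p k (x (u, v)) := by
        refine Real.sigmoid_le ?_
        have hk0 : (0 : ℝ) ≤ k := k.cast_nonneg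
        nlinarith
      rw [Real.sigmoid_zero] at this
      linarith
    have h3 : (1 : ℝ) / 2 ≤ ∑ v, p k (x (u, v)) :=
      h2.trans (Finset.single_le_sum (f := fun v => p k (x (u, v))) (fun v _ => hpos k _)
        (Finset.mem_univ v))
    have hk0 : (0 : ℝ) ≤ k := k.cast_nonneg
    refine mul_le_mul_of_nonneg_left (Real.exp_le_exp.2 ?_) hk0
    nlinarith
  have hno (u : U) (hu : ∀ v, x (u, v) ≤ c) : Tendsto (q u) atTop atTop := by
    have h1 : Tendsto (fun k : ℕ => Real.exp (-(Fintype.card V * ((k : ℝ) * Real.exp (-k))))) atTop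
        (𝓝 1) := by
      have := (Real.continuous_exp.tendsto _).comp (hkexp.const_mul (Fintype.card V : ℝ)).neg
      simpa only [Function.comp_def, mul_zero, neg_zero, Real.exp_zero] using this
    have h2 := (tendsto_natCast_atTop_atTop (R := ℝ)).atTop_mul_pos one_pos h1
    refine tendsto_atTop_mono (fun k => ?_) h2
    have hk0 : (0 : ℝ) ≤ k := k.cast_nonneg
    refine mul_le_mul_of_nonneg_left (Real.exp_le_exp.2 ?_) hk0
    have h3 (v : V) : p k (x (u, v)) ≤ Real.exp (-k) := by
      have e1 : p k (x (u, v)) ≤ Real.sigmoid (-k) := by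
        refine Real.sigmoid_le ?_
        have := mul_nonneg (sq_nonneg (k : ℝ)) (sub_nonneg.2 (hu v))
        linarith
      refine e1.trans ?_
      rw [Real.sigmoid_def, neg_neg, Real.exp_neg]
      exact inv_anti₀ (Real.exp_pos _) (by linarith)
    have h4 : ∑ v, p k (x (u, v)) ≤ Fintype.card V * Real.exp (-k) := by
      refine (Finset.sum_le_sum fun v _ => h3 v).trans_eq ?_
      simp
    have := mul_le_mul_of_nonneg_left h4 hk0
    linarith
  refine Tendsto.congr (fun k => (hF k).symm) ?_
  by_cases hx : ∀ u, ∃ v, c < x (u, v)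
  · rw [Set.indicator_of_mem (show x ∈ {x : U × V → ℝ | ∀ u, ∃ v, c < x (u, v)} from hx)]
    have h := tendsto_finsetSum (Finset.univ : Finset U) fun u _ => hyes u (hx u)
    have := (Real.continuous_exp.tendsto _).comp h.neg
    simpa only [Function.comp_def, Finset.sum_const_zero, neg_zero, Real.exp_zero] using this
  · rw [Set.indicator_of_notMem (show x ∉ {x : U × V → ℝ | ∀ u, ∃ v, c < x (u, v)} from hx)]
    push Not at hx
    obtain ⟨u, hu⟩ := hx
    refine Real.tendsto_exp_atBot.comp (tendsto_neg_atTop_atBot.comp ?_)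
    exact tendsto_atTop_mono (fun k => Finset.single_le_sum (f := fun u => q u k)
      (fun u _ => hq0 u k) (Finset.mem_univ u)) (hno u hu)

lemma tendsto_integral_softForallExists {E : Type*} [NormedAddCommGroup E] [InnerProductSpace ℝ E]
    [FiniteDimensional ℝ E] [MeasurableSpace E] [BorelSpace E] (a : U × V → E) (c : ℝ) :
    Filter.Tendsto (fun k : ℕ => ∫ ξ, softForallExists (k : ℝ)
      (fun t => Real.sigmoid ((k : ℝ) ^ 2 * (t - c) - k)) (fun i => inner ℝ (a i) ξ)
        ∂(stdGaussian E)) Filter.atTop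
      (nhds ((stdGaussian E).real {ξ | ∀ u, ∃ v, c < inner ℝ (a (u, v)) ξ})) := by
  have hm : MeasurableSet {ξ : E | ∀ u, ∃ v, c < inner ℝ (a (u, v)) ξ} := by
    exact measurableSet_forall_exists_lt_inner (fun u v => a (u, v)) c
  rw [← integral_indicator_one hm]
  refine tendsto_integral_of_dominated_convergence (fun _ => (1 : ℝ)) (fun k => ?_)
    (integrable_const _) (fun k => ae_of_all _ fun ξ => ?_) (ae_of_all _ fun ξ => ?_)
  · have := continuous_sigmoid
    exact Continuous.aestronglyMeasurable (by unfold softForallExists; fun_prop)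
  · rw [Real.norm_eq_abs, abs_of_nonneg (softForallExists_nonneg _ _ _)]
    exact softForallExists_le_one k.cast_nonneg _ _
  · exact tendsto_softForallExists c fun i => inner ℝ (a i) ξ

/-- **Gordon's comparison inequality** for finite families. -/
theorem measureReal_forall_exists_lt_inner_le (a : U × V → E₁) (b : U × V → E₂)
    (hsame : ∀ i j, i.1 = j.1 → inner ℝ (a i) (a j) = inner ℝ (b i) (b j))
    (hle : ∀ i j, inner ℝ (b i) (b j) ≤ inner ℝ (a i) (a j)) (c : ℝ) :
    (stdGaussian E₂).real {η | ∀ u, ∃ v, c < inner ℝ (b (u, v)) η} ≤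
      (stdGaussian E₁).real {ξ | ∀ u, ∃ v, c < inner ℝ (a (u, v)) ξ} := by
  refine le_of_tendsto_of_tendsto' (tendsto_integral_softForallExists b c)
    (tendsto_integral_softForallExists a c) fun k => ?_
  set s : ℝ → ℝ := fun t => Real.sigmoid ((k : ℝ) ^ 2 * (t - c) - k)
  have hlin (t : ℝ) : HasDerivAt (fun t : ℝ => (k : ℝ) ^ 2 * (t - c) - k) ((k : ℝ) ^ 2) t := by
    simpa using (((hasDerivAt_id t).sub_const c).const_mul ((k : ℝ) ^ 2)).sub_const (k : ℝ)
  have hs (t : ℝ) : HasDerivAt s (s t * (1 - s t) * (k : ℝ) ^ 2) t :=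
    (Real.hasDerivAt_sigmoid _).comp t (hlin t)
  have hs' (t : ℝ) : HasDerivAt (fun t => s t * (1 - s t) * (k : ℝ) ^ 2)
      (s t * (1 - s t) * (1 - 2 * s t) * (k : ℝ) ^ 4) t := by
    refine (((hs t).mul ((hs t).const_sub 1)).mul_const ((k : ℝ) ^ 2)).congr_deriv ?_
    ring
  have hs0 (t) : 0 ≤ s t := Real.sigmoid_nonneg _
  have hs1 (t) : s t ≤ 1 := Real.sigmoid_le_one _
  have hsc : Continuous s := continuous_iff_continuousAt.2 fun t => (hs t).continuousAt
  have hv0 (t) : 0 ≤ s t * (1 - s t) := mul_nonneg (hs0 t) (sub_nonneg.2 (hs1 t))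
  have hv1 (t) : s t * (1 - s t) ≤ 1 := by nlinarith [hs0 t, hs1 t]
  refine integral_softForallExists_le (C := (k : ℝ) ^ 2 + (k : ℝ) ^ 4) k.cast_nonneg hs hs'
    (by fun_prop) hs0 (fun t => mul_nonneg (hv0 t) (sq_nonneg _)) (fun t => ?_) (fun t => ?_) a b
    hsame hle
  · have : s t * (1 - s t) * (k : ℝ) ^ 2 ≤ 1 * (k : ℝ) ^ 2 := by gcongr; exact hv1 t
    have : (0 : ℝ) ≤ (k : ℝ) ^ 4 := by positivity
    linarith
  · have h1 : |1 - 2 * s t| ≤ 1 := abs_le.2 ⟨by linarith [hs1 t], by linarith [hs0 t]⟩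
    rw [abs_mul, abs_mul, abs_of_nonneg (hv0 t),
      abs_of_nonneg (by positivity : (0 : ℝ) ≤ (k : ℝ) ^ 4)]
    have : s t * (1 - s t) * |1 - 2 * s t| * (k : ℝ) ^ 4 ≤ 1 * 1 * (k : ℝ) ^ 4 := by
      gcongr
      exact hv1 t
    have : (0 : ℝ) ≤ (k : ℝ) ^ 2 := by positivity
    linarith

end Gordon

section GordonCountable

variable {E₁ E₂ : Type*} [NormedAddCommGroup E₁] [InnerProductSpace ℝ E₁] [FiniteDimensional ℝ E₁]
  [MeasurableSpace E₁] [BorelSpace E₁] [NormedAddCommGroup E₂] [InnerProductSpace ℝ E₂]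
  [FiniteDimensional ℝ E₂] [MeasurableSpace E₂] [BorelSpace E₂]

open Filter in
lemma tendsto_measure_forall_fin_exists_fin {E : Type*} [NormedAddCommGroup E]
    [InnerProductSpace ℝ E] [FiniteDimensional ℝ E] [MeasurableSpace E] [BorelSpace E] (a : ℕ → ℕ → E) (c : ℝ) (K : ℕ) :
    Tendsto (fun L => stdGaussian E {ξ | ∀ u : Fin K, ∃ v : Fin L, c < inner ℝ (a u v) ξ}) atTop
      (nhds (stdGaussian E {ξ | ∀ u : Fin K, ∃ v, c < inner ℝ (a u v) ξ})) := by
  have hU : {ξ | ∀ u : Fin K, ∃ v, c < inner ℝ (a u v) ξ} =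
      ⋃ L : ℕ, {ξ : E | ∀ u : Fin K, ∃ v : Fin L, c < inner ℝ (a u v) ξ} := by
    ext ξ
    simp only [Set.mem_ofPred_eq, Set.mem_iUnion]
    refine ⟨fun h => ?_, fun ⟨L, h⟩ u => (h u).imp' _ fun _ hv => hv⟩
    choose f hf using h
    refine ⟨(Finset.univ.sup f) + 1, fun u => ⟨⟨f u, ?_⟩, hf u⟩⟩
    exact Nat.lt_succ_of_le (Finset.le_sup (Finset.mem_univ u))
  rw [hU]
  refine tendsto_measure_iUnion_atTop fun L L' hL ξ h u => ?_
  obtain ⟨v, hv⟩ := h u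
  exact ⟨Fin.castLE hL v, hv⟩

open Filter in
lemma tendsto_measure_forall_fin_exists {E : Type*} [NormedAddCommGroup E] [InnerProductSpace ℝ E]
    [FiniteDimensional ℝ E] [MeasurableSpace E] [BorelSpace E] (a : ℕ → ℕ → E) (c : ℝ) :
    Tendsto (fun K => stdGaussian E {ξ | ∀ u : Fin K, ∃ v, c < inner ℝ (a u v) ξ}) atTop
      (nhds (stdGaussian E {ξ | ∀ u, ∃ v, c < inner ℝ (a u v) ξ})) := by
  have hI : {ξ | ∀ u, ∃ v, c < inner ℝ (a u v) ξ} =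
      ⋂ K : ℕ, {ξ : E | ∀ u : Fin K, ∃ v, c < inner ℝ (a u v) ξ} := by
    ext ξ
    simp only [Set.mem_ofPred_eq, Set.mem_iInter]
    exact ⟨fun h K u => h u, fun h u => h (u + 1) ⟨u, u.lt_succ_self⟩⟩
  rw [hI]
  refine tendsto_measure_iInter_atTop (fun K => MeasurableSet.nullMeasurableSet ?_)
    (fun K K' hK ξ h u => h (Fin.castLE hK u)) ⟨0, measure_ne_top _ _⟩
  exact measurableSet_forall_exists_lt_inner (fun (u : Fin K) v => a u v) c

/-- **Gordon's comparison inequality** for countable families. -/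
theorem measure_forall_exists_lt_inner_le (a : ℕ → ℕ → E₁) (b : ℕ → ℕ → E₂)
    (hsame : ∀ u v v', inner ℝ (a u v) (a u v') = inner ℝ (b u v) (b u v'))
    (hle : ∀ u v u' v', inner ℝ (b u v) (b u' v') ≤ inner ℝ (a u v) (a u' v')) (c : ℝ) :
    stdGaussian E₂ {η | ∀ u, ∃ v, c < inner ℝ (b u v) η} ≤
      stdGaussian E₁ {ξ | ∀ u, ∃ v, c < inner ℝ (a u v) ξ} := by
  refine le_of_tendsto_of_tendsto' (tendsto_measure_forall_fin_exists b c)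
    (tendsto_measure_forall_fin_exists a c) fun K =>
    le_of_tendsto_of_tendsto' (tendsto_measure_forall_fin_exists_fin b c K)
      (tendsto_measure_forall_fin_exists_fin a c K) fun L => ?_
  have h := measureReal_forall_exists_lt_inner_le
    (fun i : Fin K × Fin L => a i.1 i.2) (fun i : Fin K × Fin L => b i.1 i.2)
    (fun i j hij => by rw [hij]; exact hsame _ _ _) (fun i j => hle _ _ _ _) c
  exact (ENNReal.toReal_le_toReal (measure_ne_top _ _) (measure_ne_top _ _)).1 h

end GordonCountable

/-! ### Comparison for the residual of a Gaussian linear system -/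

section Marginal

variable {ι κ : Type*} [Fintype ι] [Fintype κ]

/-- The restriction of the coordinates along `f`. -/
def EuclideanSpace.comap (f : κ → ι) (x : EuclideanSpace ℝ ι) : EuclideanSpace ℝ κ :=
  WithLp.toLp 2 fun k => x (f k)

lemma EuclideanSpace.continuous_comap {ι κ : Type*} (f : κ → ι) :
    Continuous (EuclideanSpace.comap f) := by
  unfold EuclideanSpace.comap; fun_prop

open Classical in
lemma map_comap_stdGaussian {f : κ → ι} (hf : f.Injective) :
    (stdGaussian (EuclideanSpace ℝ ι)).map (EuclideanSpace.comap f) =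
      stdGaussian (EuclideanSpace ℝ κ) := by
  have hc := EuclideanSpace.continuous_comap (ι := ι) f
  have := Measure.isProbabilityMeasure_map (μ := stdGaussian (EuclideanSpace ℝ ι)) hc.aemeasurable
  apply Measure.ext_of_charFun
  ext t
  let t' : EuclideanSpace ℝ ι := WithLp.toLp 2 fun i => ∑ k, if f k = i then t k else 0
  have ht' (k : κ) : t' (f k) = t k := by
    simp only [t']
    rw [Finset.sum_eq_single k] <;> simp +contextual [hf.eq_iff]
  have h1 (x : EuclideanSpace ℝ ι) : inner ℝ (EuclideanSpace.comap f x) t = inner ℝ x t' := by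
    simp only [PiLp.inner_apply, EuclideanSpace.comap, t', RCLike.inner_apply, conj_trivial,
      Finset.sum_mul]
    rw [Finset.sum_comm]
    simp
  have h2 : ‖t'‖ ^ 2 = ‖t‖ ^ 2 := by
    rw [← real_inner_self_eq_norm_sq, ← real_inner_self_eq_norm_sq, ← h1]
    congr 1
    ext k
    exact ht' k
  rw [charFun_stdGaussian, charFun_apply,
    integral_map hc.aemeasurable (Continuous.aestronglyMeasurable (by fun_prop))]
  simp_rw [h1]
  rw [← charFun_apply, charFun_stdGaussian]
  norm_cast
  rw [h2]

/-- The additional Gaussian coordinate is nonpositive with probability at least one half,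
independently of the others. -/
lemma stdGaussian_le_two_mul {S : Set (EuclideanSpace ℝ ι)} (hS : MeasurableSet S) :
    stdGaussian (EuclideanSpace ℝ ι) S ≤ 2 * stdGaussian (EuclideanSpace ℝ (ι ⊕ Unit))
      {ξ | ξ (Sum.inr ()) ≤ 0 ∧ EuclideanSpace.comap Sum.inl ξ ∈ S} := by
  have hc := EuclideanSpace.continuous_comap (ι := ι ⊕ Unit) (κ := ι) Sum.inl
  rw [← map_comap_stdGaussian (ι := ι ⊕ Unit) (κ := ι) Sum.inl_injective,
    Measure.map_apply hc.measurable hS]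
  set ν := stdGaussian (EuclideanSpace ℝ (ι ⊕ Unit))
  set T : Set (EuclideanSpace ℝ (ι ⊕ Unit)) :=
    {ξ | ξ (Sum.inr ()) ≤ 0 ∧ EuclideanSpace.comap Sum.inl ξ ∈ S} with hT
  have hTm : MeasurableSet T :=
    (measurableSet_le (f := fun ξ : EuclideanSpace ℝ (ι ⊕ Unit) => ξ (Sum.inr ())) (by fun_prop)
      measurable_const).inter (hc.measurable hS)
  let φ : EuclideanSpace ℝ (ι ⊕ Unit) ≃ₗᵢ[ℝ] EuclideanSpace ℝ (ι ⊕ Unit) :=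
    LinearIsometryEquiv.piLpCongrRight 2
      (Sum.elim (fun _ => LinearIsometryEquiv.refl ℝ ℝ) (fun _ => LinearIsometryEquiv.neg ℝ))
  have hφ : ν (φ ⁻¹' T) = ν T := by
    rw [← Measure.map_apply φ.continuous.measurable hTm, stdGaussian_map φ]
  have hsub : EuclideanSpace.comap Sum.inl ⁻¹' S ⊆ T ∪ φ ⁻¹' T := by
    intro ξ hξ
    by_cases h : ξ (Sum.inr ()) ≤ 0
    · exact Or.inl ⟨h, hξ⟩
    · refine Or.inr ⟨?_, ?_⟩
      · have : φ ξ (Sum.inr ()) = - ξ (Sum.inr ()) := rfl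
        rw [this]; linarith
      · exact hξ
  calc ν _ ≤ ν T + ν (φ ⁻¹' T) := (measure_mono hsub).trans (measure_union_le _ _)
    _ = 2 * ν T := by rw [hφ, two_mul]

end Marginal

section Residual

variable {m n : ℕ}

/-- The residual `A w - z` of the linear system whose matrix `A` and right-hand side `z` are read
off the coordinates of `ζ`. -/
noncomputable def linearResidual (ζ : EuclideanSpace ℝ ((Fin m × Fin n) ⊕ Fin m))
    (w : EuclideanSpace ℝ (Fin n)) : EuclideanSpace ℝ (Fin m) :=
  WithLp.toLp 2 fun i => (∑ j, ζ (Sum.inl (i, j)) * w j) - ζ (Sum.inr i)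

/-- The objective of the auxiliary problem, driven by two independent Gaussian vectors `g ∈ ℝᵐ`,
`h ∈ ℝⁿ` and a Gaussian variable, all read off the coordinates of `η`. -/
noncomputable def auxObjective (η : EuclideanSpace ℝ ((Fin m ⊕ Fin n) ⊕ Unit))
    (w : EuclideanSpace ℝ (Fin n)) : ℝ :=
  √(1 + ‖w‖ ^ 2) * ‖EuclideanSpace.comap (Sum.inl ∘ Sum.inl) η‖ -
    inner ℝ (EuclideanSpace.comap (Sum.inl ∘ Sum.inr) η) w + η (Sum.inr ())

lemma continuous_linearResidual :
    Continuous fun p : EuclideanSpace ℝ ((Fin m × Fin n) ⊕ Fin m) × EuclideanSpace ℝ (Fin n) =>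
      linearResidual p.1 p.2 := by
  unfold linearResidual; fun_prop

/-- The coefficients of the process `ξ ↦ t * ⟪u, A w - z⟫ + √(1 + ‖w‖²) γ`. The sign `t = ±1` selects
the direction of the comparison, and the additional Gaussian variable `γ` gives the process the same
variances as the auxiliary one, which has coefficients `auxCoeff`. -/
noncomputable def primalCoeff (t : ℝ) (u : EuclideanSpace ℝ (Fin m)) (w : EuclideanSpace ℝ (Fin n)) :
    EuclideanSpace ℝ (((Fin m × Fin n) ⊕ Fin m) ⊕ Unit) :=
  WithLp.toLp 2 (Sum.elim (Sum.elim (fun p => t * (u p.1 * w p.2)) (fun i => -(t * u i)))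
    fun _ => √(1 + ‖w‖ ^ 2))

/-- The coefficients of the process `η ↦ t * (√(1 + ‖w‖²) ⟪g, u⟫ - ⟪h, w⟫ + h')`. -/
noncomputable def auxCoeff (t : ℝ) (u : EuclideanSpace ℝ (Fin m)) (w : EuclideanSpace ℝ (Fin n)) :
    EuclideanSpace ℝ ((Fin m ⊕ Fin n) ⊕ Unit) :=
  WithLp.toLp 2 (Sum.elim (Sum.elim (fun i => t * (√(1 + ‖w‖ ^ 2) * u i)) (fun j => -(t * w j)))
    fun _ => t)

lemma inner_primalCoeff (t : ℝ) (u : EuclideanSpace ℝ (Fin m)) (w : EuclideanSpace ℝ (Fin n))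
    (ξ : EuclideanSpace ℝ (((Fin m × Fin n) ⊕ Fin m) ⊕ Unit)) :
    inner ℝ (primalCoeff t u w) ξ =
      t * inner ℝ u (linearResidual (EuclideanSpace.comap Sum.inl ξ) w) +
        √(1 + ‖w‖ ^ 2) * ξ (Sum.inr ()) := by
  simp only [PiLp.inner_apply, primalCoeff, linearResidual, EuclideanSpace.comap, RCLike.inner_apply,
    conj_trivial, Fintype.sum_sum_type, Sum.elim_inl, Sum.elim_inr, Fintype.sum_prod_type,
    Finset.univ_unique, Finset.sum_singleton, Finset.mul_sum, sub_mul, mul_sub, Finset.sum_mul,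
    Finset.sum_sub_distrib]
  rw [mul_comm (ξ _), sub_eq_add_neg, ← Finset.sum_neg_distrib]
  congr 2
  · exact Finset.sum_congr rfl fun i _ => Finset.sum_congr rfl fun j _ => by ring
  · exact Finset.sum_congr rfl fun i _ => by ring

lemma inner_auxCoeff (t : ℝ) (u : EuclideanSpace ℝ (Fin m)) (w : EuclideanSpace ℝ (Fin n))
    (η : EuclideanSpace ℝ ((Fin m ⊕ Fin n) ⊕ Unit)) :
    inner ℝ (auxCoeff t u w) η =
      t * (√(1 + ‖w‖ ^ 2) * inner ℝ u (EuclideanSpace.comap (Sum.inl ∘ Sum.inl) η) -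
        inner ℝ (EuclideanSpace.comap (Sum.inl ∘ Sum.inr) η) w + η (Sum.inr ())) := by
  simp only [PiLp.inner_apply, auxCoeff, EuclideanSpace.comap, RCLike.inner_apply,
    conj_trivial, Fintype.sum_sum_type, Sum.elim_inl, Sum.elim_inr, Function.comp,
    Finset.univ_unique, Finset.sum_singleton, Finset.mul_sum, mul_sub, mul_add]
  rw [mul_comm (η _), sub_eq_add_neg, ← Finset.sum_neg_distrib]
  congr 2
  · exact Finset.sum_congr rfl fun i _ => by ring
  · exact Finset.sum_congr rfl fun i _ => by ring

lemma inner_primalCoeff_primalCoeff {t : ℝ} (ht : t ^ 2 = 1) (u u' : EuclideanSpace ℝ (Fin m))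
    (w w' : EuclideanSpace ℝ (Fin n)) :
    inner ℝ (primalCoeff t u w) (primalCoeff t u' w') =
      inner ℝ u u' * (inner ℝ w w' + 1) + √(1 + ‖w‖ ^ 2) * √(1 + ‖w'‖ ^ 2) := by
  have : linearResidual (EuclideanSpace.comap Sum.inl (primalCoeff t u' w')) w =
      (t * (inner ℝ w w' + 1)) • u' := by
    ext i
    simp only [linearResidual, EuclideanSpace.comap, primalCoeff, Sum.elim_inl, Sum.elim_inr,
      PiLp.smul_apply, smul_eq_mul, PiLp.inner_apply, RCLike.inner_apply, conj_trivial, mul_add,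
      add_mul, Finset.mul_sum, Finset.sum_mul]
    rw [sub_eq_add_neg]
    congr 1
    · exact Finset.sum_congr rfl fun i _ => by ring
    · ring
  rw [inner_primalCoeff, this, inner_smul_right]
  simp only [primalCoeff, Sum.elim_inr]
  linear_combination (inner ℝ u u' * (inner ℝ w w' + 1)) * ht

lemma inner_auxCoeff_auxCoeff {t : ℝ} (ht : t ^ 2 = 1) (u u' : EuclideanSpace ℝ (Fin m))
    (w w' : EuclideanSpace ℝ (Fin n)) :
    inner ℝ (auxCoeff t u w) (auxCoeff t u' w') =
      inner ℝ u u' * (√(1 + ‖w‖ ^ 2) * √(1 + ‖w'‖ ^ 2)) + (inner ℝ w w' + 1) := by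
  have h1 : EuclideanSpace.comap (Sum.inl ∘ Sum.inl) (auxCoeff t u' w') =
      (t * √(1 + ‖w'‖ ^ 2)) • u' := by
    ext i
    simp [EuclideanSpace.comap, auxCoeff, mul_assoc]
  have h2 : EuclideanSpace.comap (Sum.inl ∘ Sum.inr) (auxCoeff t u' w') = (-t) • w' := by
    ext i
    simp [EuclideanSpace.comap, auxCoeff]
  rw [inner_auxCoeff, h1, h2, inner_smul_right, real_inner_smul_left, real_inner_comm w w']
  simp only [auxCoeff, Sum.elim_inr]
  linear_combination (inner ℝ u u' * (√(1 + ‖w‖ ^ 2) * √(1 + ‖w'‖ ^ 2)) + (inner ℝ w w' + 1)) * ht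

lemma inner_add_one_le (w w' : EuclideanSpace ℝ (Fin n)) :
    inner ℝ w w' + 1 ≤ √(1 + ‖w‖ ^ 2) * √(1 + ‖w'‖ ^ 2) := by
  rw [← Real.sqrt_mul (by positivity)]
  have h1 := real_inner_le_norm w w'
  have h2 : ‖w‖ * ‖w'‖ + 1 ≤ √((1 + ‖w‖ ^ 2) * (1 + ‖w'‖ ^ 2)) := by
    refine Real.le_sqrt_of_sq_le ?_
    nlinarith [sq_nonneg (‖w‖ - ‖w'‖)]
  linarith

lemma auxCoeff_le_primalCoeff {t : ℝ} (ht : t ^ 2 = 1) {u u' : EuclideanSpace ℝ (Fin m)}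
    (hu : ‖u‖ = 1) (hu' : ‖u'‖ = 1) (w w' : EuclideanSpace ℝ (Fin n)) :
    inner ℝ (auxCoeff t u w) (auxCoeff t u' w') ≤
      inner ℝ (primalCoeff t u w) (primalCoeff t u' w') := by
  rw [inner_auxCoeff_auxCoeff ht, inner_primalCoeff_primalCoeff ht]
  have h1 : inner ℝ u u' ≤ 1 := by
    have := real_inner_le_norm u u'
    rwa [hu, hu', one_mul] at this
  nlinarith [inner_add_one_le w w']

lemma inner_coeff_eq_of_same_direction {t : ℝ} (ht : t ^ 2 = 1) {u : EuclideanSpace ℝ (Fin m)}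
    (hu : ‖u‖ = 1) (w w' : EuclideanSpace ℝ (Fin n)) :
    inner ℝ (primalCoeff t u w) (primalCoeff t u w') =
      inner ℝ (auxCoeff t u w) (auxCoeff t u w') := by
  rw [inner_auxCoeff_auxCoeff ht, inner_primalCoeff_primalCoeff ht, real_inner_self_eq_norm_sq, hu]
  ring

lemma inner_coeff_eq_of_same_point {t : ℝ} (ht : t ^ 2 = 1) (u u' : EuclideanSpace ℝ (Fin m))
    (w : EuclideanSpace ℝ (Fin n)) :
    inner ℝ (primalCoeff t u w) (primalCoeff t u' w) =
      inner ℝ (auxCoeff t u w) (auxCoeff t u' w) := by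
  rw [inner_auxCoeff_auxCoeff ht, inner_primalCoeff_primalCoeff ht, real_inner_self_eq_norm_sq,
    Real.mul_self_sqrt (by positivity)]
  ring

lemma exists_seq_dense_subset {X : Type*} [TopologicalSpace X] [SecondCountableTopology X]
    {S : Set X} (hS : S.Nonempty) : ∃ s : ℕ → X, (∀ k, s k ∈ S) ∧ S ⊆ closure (Set.range s) := by
  have : Nonempty S := hS.to_subtype
  refine ⟨fun k => TopologicalSpace.denseSeq S k, fun k => Subtype.coe_prop _, fun x hx => ?_⟩
  have h := map_mem_closure (f := ((↑) : S → X)) (t := Set.range fun k =>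
    (TopologicalSpace.denseSeq S k : X)) continuous_subtype_val
    (TopologicalSpace.denseRange_denseSeq S ⟨x, hx⟩) (by rintro _ ⟨k, rfl⟩; exact ⟨k, rfl⟩)
  exact h

lemma norm_le_of_forall_dense_inner_le {E : Type*} [NormedAddCommGroup E] [InnerProductSpace ℝ E]
    {u : ℕ → E} (hu : Metric.sphere (0 : E) 1 ⊆ closure (Set.range u))
    (hne : (Metric.sphere (0 : E) 1).Nonempty) {x : E} {t : ℝ} (h : ∀ j, inner ℝ (u j) x ≤ t) :
    ‖x‖ ≤ t := by
  have hcl : ∀ v ∈ Metric.sphere (0 : E) 1, inner ℝ v x ≤ t := by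
    intro v hv
    have : closure (Set.range u) ⊆ {v | inner ℝ v x ≤ t} :=
      closure_minimal (by rintro _ ⟨j, rfl⟩; exact h j)
        (isClosed_le (by fun_prop) continuous_const)
    exact this (hu hv)
  by_cases hx : x = 0
  · obtain ⟨v, hv⟩ := hne
    have := hcl v hv
    rw [hx, inner_zero_right] at this
    rwa [hx, norm_zero]
  · have hx' : ‖x‖ ≠ 0 := norm_ne_zero_iff.2 hx
    have := hcl (‖x‖⁻¹ • x) (by
      rw [mem_sphere_zero_iff_norm, norm_smul, norm_inv, norm_norm, inv_mul_cancel₀ hx'])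
    rw [real_inner_smul_left, real_inner_self_eq_norm_sq, pow_two, inv_mul_cancel_left₀ hx'] at this
    exact this

/-- **Gaussian min-max theorem, lower tail**: the residual is small somewhere on `W` with at most
twice the probability that the auxiliary objective is. -/
theorem stdGaussian_exists_norm_residual_lt_le (hm : 0 < m) (W : Set (EuclideanSpace ℝ (Fin n)))
    (c : ℝ) :
    stdGaussian (EuclideanSpace ℝ ((Fin m × Fin n) ⊕ Fin m))
        {ζ | ∃ w ∈ W, ‖linearResidual ζ w‖ < c} ≤
      2 * stdGaussian (EuclideanSpace ℝ ((Fin m ⊕ Fin n) ⊕ Unit))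
        {η | ∃ w ∈ W, auxObjective η w ≤ c} := by
  rcases W.eq_empty_or_nonempty with rfl | hW
  · simp
  have : Nonempty (Fin m) := ⟨⟨0, hm⟩⟩
  have hsph : (Metric.sphere (0 : EuclideanSpace ℝ (Fin m)) 1).Nonempty :=
    NormedSpace.sphere_nonempty.2 zero_le_one
  obtain ⟨w, hwW, hwd⟩ := exists_seq_dense_subset hW
  obtain ⟨u, huS, hud⟩ := exists_seq_dense_subset hsph
  have hu1 (j) : ‖u j‖ = 1 := mem_sphere_zero_iff_norm.1 (huS j)
  have ht : (1 : ℝ) ^ 2 = 1 := one_pow 2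
  have hopen : IsOpen {ζ : EuclideanSpace ℝ ((Fin m × Fin n) ⊕ Fin m) |
      ∃ w ∈ W, ‖linearResidual ζ w‖ < c} := by
    have : {ζ : EuclideanSpace ℝ ((Fin m × Fin n) ⊕ Fin m) | ∃ w ∈ W, ‖linearResidual ζ w‖ < c} =
        ⋃ w ∈ W, {ζ | ‖linearResidual ζ w‖ < c} := by ext; simp
    rw [this]
    refine isOpen_biUnion fun w _ => isOpen_lt ?_ continuous_const
    exact (continuous_linearResidual.comp (Continuous.prodMk_left w)).norm
  have hG := measure_forall_exists_lt_inner_le (fun i j => primalCoeff 1 (u j) (w i))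
    (fun i j => auxCoeff 1 (u j) (w i))
    (fun i j j' => inner_coeff_eq_of_same_point ht _ _ _)
    (fun i j i' j' => auxCoeff_le_primalCoeff ht (hu1 j) (hu1 j') _ _) c
  refine (stdGaussian_le_two_mul hopen.measurableSet).trans ?_
  gcongr 2 * ?_
  calc _ ≤ stdGaussian (EuclideanSpace ℝ (((Fin m × Fin n) ⊕ Fin m) ⊕ Unit))
        {ξ | ∀ i, ∃ j, c < inner ℝ (primalCoeff 1 (u j) (w i)) ξ}ᶜ := by
        refine measure_mono ?_
        rintro ξ ⟨hγ, w₀, hw₀, hlt⟩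
        set ζ := EuclideanSpace.comap Sum.inl ξ
        simp only [Set.mem_compl_iff, Set.mem_ofPred_eq, not_forall, not_exists, not_lt]
        have hop : IsOpen {w | ‖linearResidual ζ w‖ < c} :=
          isOpen_lt (continuous_linearResidual.comp (Continuous.prodMk_right ζ)).norm continuous_const
        obtain ⟨_, hlt', i, rfl⟩ := mem_closure_iff.1 (hwd hw₀) _ hop hlt
        refine ⟨i, fun j => ?_⟩
        rw [inner_primalCoeff, one_mul]
        have h1 := real_inner_le_norm (u j) (linearResidual ζ (w i))
        rw [hu1, one_mul] at h1
        have h2 : √(1 + ‖w i‖ ^ 2) * ξ (Sum.inr ()) ≤ 0 :=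
          mul_nonpos_of_nonneg_of_nonpos (Real.sqrt_nonneg _) hγ
        have h3 : ‖linearResidual ζ (w i)‖ < c := hlt'
        linarith
    _ ≤ stdGaussian (EuclideanSpace ℝ ((Fin m ⊕ Fin n) ⊕ Unit))
        {η | ∀ i, ∃ j, c < inner ℝ (auxCoeff 1 (u j) (w i)) η}ᶜ := by
        rw [prob_compl_eq_one_sub (measurableSet_forall_exists_lt_inner _ _),
          prob_compl_eq_one_sub (measurableSet_forall_exists_lt_inner _ _)]
        exact tsub_le_tsub_left hG 1
    _ ≤ _ := by
        refine measure_mono fun η hη => ?_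
        simp only [Set.mem_compl_iff, Set.mem_ofPred_eq, not_forall, not_exists, not_lt] at hη
        obtain ⟨i, hi⟩ := hη
        refine ⟨w i, hwW i, ?_⟩
        set g := EuclideanSpace.comap (Sum.inl ∘ Sum.inl) η with hg
        have hs : 0 ≤ √(1 + ‖w i‖ ^ 2) := Real.sqrt_nonneg _
        have h1 := norm_le_of_forall_dense_inner_le hud hsph (x := √(1 + ‖w i‖ ^ 2) • g)
          (t := c + inner ℝ (EuclideanSpace.comap (Sum.inl ∘ Sum.inr) η) (w i) - η (Sum.inr ()))
          fun j => by
            have := hi j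
            rw [inner_auxCoeff, one_mul] at this
            rw [inner_smul_right]
            linarith
        rw [norm_smul, Real.norm_eq_abs, abs_of_nonneg hs] at h1
        simp only [auxObjective, ← hg]
        linarith

/-- The minimax argument: if the residual is at least `c > 0` on a convex compact set, then its
component along a single direction is. -/
lemma exists_forall_le_inner_residual {W : Set (EuclideanSpace ℝ (Fin n))} (hWc : Convex ℝ W)
    (hWk : IsCompact W) (hW : W.Nonempty) (ζ : EuclideanSpace ℝ ((Fin m × Fin n) ⊕ Fin m)) {c : ℝ}
    (hc : 0 < c) (h : ∀ w ∈ W, c ≤ ‖linearResidual ζ w‖) :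
    ∃ u : EuclideanSpace ℝ (Fin m), ‖u‖ = 1 ∧ ∀ w ∈ W, c ≤ inner ℝ u (linearResidual ζ w) := by
  have hcont : Continuous (linearResidual ζ) :=
    continuous_linearResidual.comp (Continuous.prodMk_right ζ)
  obtain ⟨w₀, hw₀, hmin⟩ := hWk.exists_isMinOn hW hcont.norm.continuousOn
  set r := linearResidual ζ w₀ with hr
  have hr0 : 0 < ‖r‖ := hc.trans_le (h w₀ hw₀)
  refine ⟨‖r‖⁻¹ • r, by rw [norm_smul, norm_inv, norm_norm, inv_mul_cancel₀ hr0.ne'], fun w hw => ?_⟩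
  have hproj : ‖r‖ ^ 2 ≤ inner ℝ r (linearResidual ζ w) := by
    by_contra hlt
    push Not at hlt
    set d := linearResidual ζ w - r with hd
    have hneg : inner ℝ r d < 0 := by
      rw [hd, inner_sub_right, real_inner_self_eq_norm_sq]; linarith
    -- moving a little from `w₀` towards `w` would decrease the norm
    have hlin (t : ℝ) : linearResidual ζ (w₀ + t • (w - w₀)) = r + t • d := by
      ext i
      simp only [hd, hr, linearResidual, PiLp.add_apply, PiLp.smul_apply, PiLp.sub_apply, smul_eq_mul,
        mul_add, mul_sub, Finset.sum_add_distrib, Finset.sum_sub_distrib, ← Finset.mul_sum,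
        mul_left_comm _ t]
      ring
    set t := min 1 (-inner ℝ r d / (‖d‖ ^ 2 + 1)) with ht
    have hd1 : 0 < ‖d‖ ^ 2 + 1 := by positivity
    have ht0 : 0 < t := lt_min one_pos (div_pos (by linarith) hd1)
    have ht1 : t ≤ 1 := min_le_left _ _
    have ht2 : t * (‖d‖ ^ 2 + 1) ≤ -inner ℝ r d := (le_div_iff₀ hd1).1 (min_le_right _ _)
    have hmem : w₀ + t • (w - w₀) ∈ W := hWc.add_smul_sub_mem hw₀ hw ⟨ht0.le, ht1⟩
    have h1 : ‖r‖ ≤ ‖r + t • d‖ := by rw [← hlin]; exact hmin hmem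
    have h2 : ‖r + t • d‖ ^ 2 = ‖r‖ ^ 2 + 2 * (t * inner ℝ r d) + (t * ‖d‖) ^ 2 := by
      rw [norm_add_sq_real, inner_smul_right, norm_smul, Real.norm_eq_abs, abs_of_pos ht0]
    have h3 : ‖r‖ ^ 2 ≤ ‖r + t • d‖ ^ 2 := by gcongr
    nlinarith
  rw [real_inner_smul_left]
  calc c ≤ ‖r‖ := h w₀ hw₀
    _ = ‖r‖⁻¹ * ‖r‖ ^ 2 := by field_simp
    _ ≤ _ := by gcongr

/-- **Gaussian min-max theorem, upper tail**: on a convex compact set, the residual is large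
everywhere with at most twice the probability that the auxiliary objective is. -/
theorem stdGaussian_forall_le_norm_residual_le (hm : 0 < m) {W : Set (EuclideanSpace ℝ (Fin n))}
    (hWc : Convex ℝ W) (hWk : IsCompact W) (hW : W.Nonempty) {c c' : ℝ} (hcc : c < c')
    (hc : 0 < c') :
    stdGaussian (EuclideanSpace ℝ ((Fin m × Fin n) ⊕ Fin m))
        {ζ | ∀ w ∈ W, c' ≤ ‖linearResidual ζ w‖} ≤
      2 * stdGaussian (EuclideanSpace ℝ ((Fin m ⊕ Fin n) ⊕ Unit))
        {η | ∀ w ∈ W, c ≤ auxObjective η w} := by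
  have : Nonempty (Fin m) := ⟨⟨0, hm⟩⟩
  have hsph : (Metric.sphere (0 : EuclideanSpace ℝ (Fin m)) 1).Nonempty :=
    NormedSpace.sphere_nonempty.2 zero_le_one
  obtain ⟨w, hwW, hwd⟩ := exists_seq_dense_subset hW
  obtain ⟨u, huS, hud⟩ := exists_seq_dense_subset hsph
  have hu1 (j) : ‖u j‖ = 1 := mem_sphere_zero_iff_norm.1 (huS j)
  have ht : (-1 : ℝ) ^ 2 = 1 := by norm_num
  have hclosed : IsClosed {ζ : EuclideanSpace ℝ ((Fin m × Fin n) ⊕ Fin m) |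
      ∀ w ∈ W, c' ≤ ‖linearResidual ζ w‖} := by
    have : {ζ : EuclideanSpace ℝ ((Fin m × Fin n) ⊕ Fin m) | ∀ w ∈ W, c' ≤ ‖linearResidual ζ w‖} =
        ⋂ w ∈ W, {ζ | c' ≤ ‖linearResidual ζ w‖} := by ext; simp
    rw [this]
    refine isClosed_biInter fun w _ => isClosed_le continuous_const ?_
    exact (continuous_linearResidual.comp (Continuous.prodMk_left w)).norm
  have hG := measure_forall_exists_lt_inner_le (fun i j => primalCoeff (-1) (u i) (w j))
    (fun i j => auxCoeff (-1) (u i) (w j))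
    (fun i j j' => inner_coeff_eq_of_same_direction ht (hu1 i) _ _)
    (fun i j i' j' => auxCoeff_le_primalCoeff ht (hu1 i) (hu1 i') _ _) (-c)
  refine (stdGaussian_le_two_mul hclosed.measurableSet).trans ?_
  gcongr 2 * ?_
  calc _ ≤ stdGaussian (EuclideanSpace ℝ (((Fin m × Fin n) ⊕ Fin m) ⊕ Unit))
        {ξ | ∀ i, ∃ j, -c < inner ℝ (primalCoeff (-1) (u i) (w j)) ξ}ᶜ := by
        refine measure_mono ?_
        rintro ξ ⟨hγ, hle⟩
        set ζ := EuclideanSpace.comap Sum.inl ξ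
        simp only [Set.mem_compl_iff, Set.mem_ofPred_eq, not_forall, not_exists, not_lt]
        obtain ⟨u₀, hu₀, hge⟩ := exists_forall_le_inner_residual hWc hWk hW ζ hc hle
        have hcont : Continuous (linearResidual ζ) :=
          continuous_linearResidual.comp (Continuous.prodMk_right ζ)
        obtain ⟨B, hB⟩ := (hWk.image hcont).isBounded.exists_norm_le
        have hB0 : 0 ≤ B := by
          obtain ⟨w₁, hw₁⟩ := hW
          exact (norm_nonneg _).trans (hB _ (Set.mem_image_of_mem _ hw₁))
        have hδ : 0 < (c' - c) / (B + 1) := div_pos (by linarith) (by linarith)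
        obtain ⟨_, ⟨i, rfl⟩, hi⟩ := Metric.mem_closure_iff.1
          (hud (mem_sphere_zero_iff_norm.2 hu₀)) _ hδ
        refine ⟨i, fun j => ?_⟩
        have h1 : |inner ℝ (u₀ - u i) (linearResidual ζ (w j))| ≤ (c' - c) / (B + 1) * B := by
          refine (abs_real_inner_le_norm _ _).trans ?_
          rw [dist_eq_norm] at hi
          gcongr
          exact hB _ (Set.mem_image_of_mem _ (hwW j))
        have h2 : (c' - c) / (B + 1) * B ≤ c' - c := by
          rw [div_mul_eq_mul_div, div_le_iff₀ (by linarith)]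
          nlinarith
        have h3 := hge (w j) (hwW j)
        rw [inner_sub_left] at h1
        have h4 := (abs_le.1 h1).2
        rw [inner_primalCoeff]
        have h5 : √(1 + ‖w j‖ ^ 2) * ξ (Sum.inr ()) ≤ 0 :=
          mul_nonpos_of_nonneg_of_nonpos (Real.sqrt_nonneg _) hγ
        change -1 * inner ℝ (u i) (linearResidual ζ (w j)) + _ ≤ _
        linarith
    _ ≤ stdGaussian (EuclideanSpace ℝ ((Fin m ⊕ Fin n) ⊕ Unit))
        {η | ∀ i, ∃ j, -c < inner ℝ (auxCoeff (-1) (u i) (w j)) η}ᶜ := by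
        rw [prob_compl_eq_one_sub (measurableSet_forall_exists_lt_inner _ _),
          prob_compl_eq_one_sub (measurableSet_forall_exists_lt_inner _ _)]
        exact tsub_le_tsub_left hG 1
    _ ≤ _ := by
        refine measure_mono fun η hη => ?_
        simp only [Set.mem_compl_iff, Set.mem_ofPred_eq, not_forall, not_exists, not_lt] at hη
        obtain ⟨i, hi⟩ := hη
        have hj (j : ℕ) : c ≤ auxObjective η (w j) := by
          have h1 := hi j
          rw [inner_auxCoeff] at h1
          have h2 := real_inner_le_norm (u i) (EuclideanSpace.comap (Sum.inl ∘ Sum.inl) η)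
          rw [hu1, one_mul] at h2
          have h3 := mul_le_mul_of_nonneg_left h2 (Real.sqrt_nonneg (1 + ‖w j‖ ^ 2))
          simp only [auxObjective]
          linarith
        have hcl : IsClosed {w | c ≤ auxObjective η w} :=
          isClosed_le continuous_const (by unfold auxObjective; fun_prop)
        intro w' hw'
        exact closure_minimal (by rintro _ ⟨j, rfl⟩; exact hj j) hcl (hwd hw')

end Residual

/-! ### Tails and second moments of Lipschitz functions -/

section Tails

variable {E : Type*} [NormedAddCommGroup E] [InnerProductSpace ℝ E] [FiniteDimensional ℝ E]
  [MeasurableSpace E] [BorelSpace E]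

lemma LipschitzWith.stdGaussian_le_abs_sub_integral {f : E → ℝ} {L : NNReal}
    (hf : LipschitzWith L f) {t : ℝ} (ht : 0 ≤ t) :
    stdGaussian E {x | t ≤ |f x - ∫ y, f y ∂(stdGaussian E)|} ≤
      ENNReal.ofReal (2 * Real.exp (-(2 * t ^ 2 / (Real.pi ^ 2 * L ^ 2)))) := by
  have h := hf.hasSubgaussianMGF_stdGaussian
  have h1 := h.measure_ge_le ht
  have h2 := h.neg.measure_ge_le ht
  have he : -t ^ 2 / (2 * ((NNReal.pi ^ 2 / 4 * L ^ 2 : NNReal) : ℝ)) =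
      -(2 * t ^ 2 / (Real.pi ^ 2 * L ^ 2)) := by
    push_cast
    simp only [NNReal.coe_real_pi]
    rw [show 2 * (Real.pi ^ 2 / 4 * (L : ℝ) ^ 2) = Real.pi ^ 2 * L ^ 2 / 2 by ring, div_div_eq_mul_div]
    ring
  rw [he] at h1 h2
  have hsub : {x | t ≤ |f x - ∫ y, f y ∂(stdGaussian E)|} ⊆
      {x | t ≤ f x - ∫ y, f y ∂(stdGaussian E)} ∪
        {x | t ≤ (-fun x => f x - ∫ y, f y ∂(stdGaussian E)) x} := by
    intro x hx
    exact le_abs.1 (show t ≤ |f x - ∫ y, f y ∂(stdGaussian E)| from hx)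
  refine (measure_mono hsub).trans ((measure_union_le _ _).trans ?_)
  rw [two_mul, ENNReal.ofReal_add (Real.exp_pos _).le (Real.exp_pos _).le]
  refine add_le_add ?_ ?_ <;> rw [ENNReal.le_ofReal_iff_toReal_le (measure_ne_top _ _)
    (Real.exp_pos _).le]
  exacts [h1, h2]

/-- The mean of a nonnegative `1`-Lipschitz function is close to its quadratic mean. -/
lemma LipschitzWith.sqrt_integral_sq_sub_integral {f : E → ℝ} (hf : LipschitzWith 1 f)
    (hf0 : ∀ x, 0 ≤ f x) :
    ∫ x, f x ∂(stdGaussian E) ≤ √(∫ x, f x ^ 2 ∂(stdGaussian E)) ∧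
    √(∫ x, f x ^ 2 ∂(stdGaussian E)) ≤ ∫ x, f x ∂(stdGaussian E) +
      √(4 * Real.exp (Real.pi ^ 2 / 8)) := by
  set μ := stdGaussian E
  set e := ∫ x, f x ∂μ with he
  have h := hf.hasSubgaussianMGF_stdGaussian
  have hi := hf.integrable_stdGaussian
  have hm (t : ℝ) (ht : t ^ 2 = 1) :
      ∫ x, Real.exp (t * (f x - e)) ∂μ ≤ Real.exp (Real.pi ^ 2 / 8) := by
    refine (h.mgf_le t).trans (Real.exp_le_exp.2 ?_)
    push_cast
    simp only [NNReal.coe_real_pi, ht]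
    apply le_of_eq; ring
  have hsq (x : E) :
      (f x - e) ^ 2 ≤ 2 * (Real.exp (1 * (f x - e)) + Real.exp (-1 * (f x - e))) := by
    rw [one_mul, neg_one_mul]
    set y := f x - e
    have h1 := Real.exp_pos y
    have h2 := Real.exp_pos (-y)
    rcases le_total 0 y with hy | hy
    · have := Real.quadratic_le_exp_of_nonneg hy
      linarith
    · have := Real.quadratic_le_exp_of_nonneg (neg_nonneg.2 hy)
      rw [neg_sq] at this
      linarith
  have hint : Integrable
      (fun x => 2 * (Real.exp (1 * (f x - e)) + Real.exp (-1 * (f x - e)))) μ :=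
    ((h.integrable_exp_mul 1).add (h.integrable_exp_mul (-1))).const_mul 2
  have hsqi : Integrable (fun x => (f x - e) ^ 2) μ :=
    hint.mono' ((hf.continuous.sub continuous_const).pow 2).aestronglyMeasurable
      (ae_of_all _ fun x => by rw [Real.norm_eq_abs, abs_of_nonneg (sq_nonneg _)]; exact hsq x)
  have hvar : ∫ x, (f x - e) ^ 2 ∂μ ≤ 4 * Real.exp (Real.pi ^ 2 / 8) := by
    refine (integral_mono hsqi hint hsq).trans ?_
    rw [integral_const_mul, integral_add (h.integrable_exp_mul 1) (h.integrable_exp_mul (-1))]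
    have := hm 1 (by norm_num)
    have := hm (-1) (by norm_num)
    linarith
  have hdec : ∫ x, f x ^ 2 ∂μ = ∫ x, (f x - e) ^ 2 ∂μ + e ^ 2 := by
    have e1 (x : E) : f x ^ 2 = (f x - e) ^ 2 + (2 * e * f x - e ^ 2) := by ring
    simp_rw [e1]
    refine (integral_add hsqi ((hi.const_mul _).sub (integrable_const _))).trans ?_
    congr 1
    refine (integral_sub (hi.const_mul _) (integrable_const _)).trans ?_
    rw [integral_const_mul, ← he, integral_const, probReal_univ, one_smul]
    ring
  have he0 : 0 ≤ e := integral_nonneg hf0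
  have hv0 : 0 ≤ ∫ x, (f x - e) ^ 2 ∂μ := integral_nonneg fun x => sq_nonneg _
  constructor
  · exact Real.le_sqrt_of_sq_le (by rw [hdec]; linarith)
  · rw [Real.sqrt_le_left (by positivity), hdec, add_sq, Real.sq_sqrt (by positivity)]
    have : 0 ≤ 2 * e * √(4 * Real.exp (Real.pi ^ 2 / 8)) := by positivity
    linarith

end Tails

lemma integral_norm_sq_stdGaussian (ι : Type*) [Fintype ι] :
    ∫ x, ‖x‖ ^ 2 ∂(stdGaussian (EuclideanSpace ℝ ι)) = Fintype.card ι := by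
  classical
  have h (i : ι) : ∫ x : EuclideanSpace ℝ ι, x i ^ 2 ∂(stdGaussian (EuclideanSpace ℝ ι)) = 1 := by
    have := integral_dual_mul_inner_stdGaussian (EuclideanSpace.proj (𝕜 := ℝ) i)
      (EuclideanSpace.single i (1 : ℝ))
    simpa [EuclideanSpace.inner_single_left, pow_two] using this
  have hi (i : ι) : Integrable (fun x : EuclideanSpace ℝ ι => x i ^ 2)
      (stdGaussian (EuclideanSpace ℝ ι)) := by
    by_contra hn
    have := h i
    rw [integral_undef hn] at this
    exact zero_ne_one this
  simp_rw [EuclideanSpace.real_norm_sq_eq]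
  rw [integral_finsetSum _ fun i _ => hi i]
  simp [h]

/-! ### Feasible directions and the subdifferential -/

section Convex

variable {n : ℕ} {f : EuclideanSpace ℝ (Fin n) → ℝ} {x₀ : EuclideanSpace ℝ (Fin n)}

/-- The distance to the cone generated by the subdifferential. -/
noncomputable def subdiffConeDist (f : EuclideanSpace ℝ (Fin n) → ℝ)
    (x₀ h : EuclideanSpace ℝ (Fin n)) : ℝ :=
  Metric.infDist h
    (PointedCone.hull ℝ (subdifferential f x₀) : Set (EuclideanSpace ℝ (Fin n)))

/-- The feasible increments at scale `σ`: the `w` for which `x₀ + σ • w` stays in the sublevel set of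
`f` at `x₀`. -/
def feasibleIncrements (f : EuclideanSpace ℝ (Fin n) → ℝ) (x₀ : EuclideanSpace ℝ (Fin n)) (σ : ℝ) :
    Set (EuclideanSpace ℝ (Fin n)) :=
  {w | f (x₀ + σ • w) ≤ f x₀}

lemma zero_mem_feasibleIncrements (σ : ℝ) : 0 ∈ feasibleIncrements f x₀ σ := by
  simp [feasibleIncrements]

lemma isClosed_feasibleIncrements (hf : Continuous f) (σ : ℝ) :
    IsClosed (feasibleIncrements f x₀ σ) :=
  isClosed_le (by fun_prop) continuous_const

lemma convex_feasibleIncrements (hf : ConvexOn ℝ Set.univ f) (σ : ℝ) :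
    Convex ℝ (feasibleIncrements f x₀ σ) := by
  intro v hv w hw a b ha hb hab
  have h := hf.2 (Set.mem_univ (x₀ + σ • v)) (Set.mem_univ (x₀ + σ • w)) ha hb hab
  have e : a • (x₀ + σ • v) + b • (x₀ + σ • w) = x₀ + σ • (a • v + b • w) := by
    have : x₀ = a • x₀ + b • x₀ := by rw [← add_smul, hab, one_smul]
    nth_rewrite 3 [this]
    module
  rw [e] at h
  refine h.trans ?_
  have h1 : f (x₀ + σ • v) ≤ f x₀ := hv
  have h2 : f (x₀ + σ • w) ≤ f x₀ := hw
  simp only [smul_eq_mul]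
  calc a * f (x₀ + σ • v) + b * f (x₀ + σ • w) ≤ a * f x₀ + b * f x₀ := by gcongr
    _ = f x₀ := by rw [← add_mul, hab, one_mul]

lemma feasibleIncrements_anti (hf : ConvexOn ℝ Set.univ f) {σ τ : ℝ} (hσ : 0 < σ) (h : σ ≤ τ) :
    feasibleIncrements f x₀ τ ⊆ feasibleIncrements f x₀ σ := by
  intro w hw
  have hτ : 0 < τ := hσ.trans_le h
  have h1 := convex_feasibleIncrements hf τ (zero_mem_feasibleIncrements τ) hw
    (sub_nonneg.2 ((div_le_one hτ).2 h)) (div_nonneg hσ.le hτ.le) (by ring)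
  rw [smul_zero, zero_add] at h1
  have : f (x₀ + τ • (σ / τ) • w) ≤ f x₀ := h1
  rwa [smul_smul, mul_div_cancel₀ _ hτ.ne'] at this

lemma inner_le_norm_mul_subdiffConeDist {w : EuclideanSpace ℝ (Fin n)}
    (hw : ∀ s ∈ subdifferential f x₀, inner ℝ s w ≤ 0) (h : EuclideanSpace ℝ (Fin n)) :
    inner ℝ h w ≤ ‖w‖ * subdiffConeDist f x₀ h := by
  have hcone : ∀ c ∈ PointedCone.hull ℝ (subdifferential f x₀), inner ℝ c w ≤ 0 := by
    intro c hc
    induction hc using Submodule.span_induction with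
    | mem x hx => exact hw x hx
    | zero => simp
    | add x y _ _ hx hy => rw [inner_add_left]; linarith
    | smul a x _ hx =>
      have : a • x = (a : ℝ) • x := rfl
      rw [this, real_inner_smul_left]
      exact mul_nonpos_of_nonneg_of_nonpos a.2 hx
  by_cases hw0 : w = 0
  · simp [hw0]
  have hpos : 0 < ‖w‖ := norm_pos_iff.2 hw0
  rw [mul_comm, ← div_le_iff₀ hpos, subdiffConeDist, Metric.le_infDist ⟨0, Submodule.zero_mem _⟩]
  intro c hc
  rw [div_le_iff₀ hpos, dist_eq_norm]
  have h1 := real_inner_le_norm (h - c) w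
  rw [inner_sub_left] at h1
  linarith [hcone c hc]

/-- Feasible increments lie in the polar of the subdifferential. -/
lemma inner_nonpos_of_mem_feasibleIncrements {σ : ℝ} (hσ : 0 < σ) {w : EuclideanSpace ℝ (Fin n)}
    (hw : w ∈ feasibleIncrements f x₀ σ) {s : EuclideanSpace ℝ (Fin n)}
    (hs : s ∈ subdifferential f x₀) : inner ℝ s w ≤ 0 := by
  have h1 : f x₀ + inner ℝ s (x₀ + σ • w - x₀) ≤ f (x₀ + σ • w) := hs _
  have h2 : f (x₀ + σ • w) ≤ f x₀ := hw
  rw [add_sub_cancel_left, inner_smul_right] at h1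
  by_contra hlt
  push Not at hlt
  have := mul_pos hσ hlt
  linarith

/-- A direction along which `f` does not return to the level `f x₀` is not a strict descent
direction for all subgradients: separate the open epigraph from the horizontal ray. -/
lemma exists_subgradient_inner_nonneg (hf : ConvexOn ℝ Set.univ f) (hfc : Continuous f)
    {w : EuclideanSpace ℝ (Fin n)} (hw : ∀ t : ℝ, 0 < t → f x₀ < f (x₀ + t • w)) :
    ∃ s ∈ subdifferential f x₀, 0 ≤ inner ℝ s w := by
  let X := EuclideanSpace ℝ (Fin n)
  let A : Set (X × ℝ) := {p | p.1 ∈ (Set.univ : Set X) ∧ f p.1 < p.2}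
  let B : Set (X × ℝ) := (fun t : ℝ => (x₀ + t • w, f x₀)) '' Set.Ici 0
  have hA : Convex ℝ A := hf.convex_strict_epigraph
  have hAo : IsOpen A := by
    have : A = {p : X × ℝ | f p.1 < p.2} := by ext; simp [A]
    rw [this]
    exact isOpen_lt (hfc.comp continuous_fst) continuous_snd
  have hB : Convex ℝ B := by
    rintro _ ⟨t, ht, rfl⟩ _ ⟨t', ht', rfl⟩ a b ha hb hab
    refine ⟨a * t + b * t', ?_, ?_⟩
    · exact add_nonneg (mul_nonneg ha ht) (mul_nonneg hb ht')
    · simp only [Prod.smul_mk, Prod.mk_add_mk, smul_eq_mul, Prod.mk.injEq]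
      constructor
      · have : x₀ = a • x₀ + b • x₀ := by rw [← add_smul, hab, one_smul]
        nth_rewrite 1 [this]
        module
      · rw [← add_mul, hab, one_mul]
  have hdisj : Disjoint A B := by
    rw [Set.disjoint_left]
    rintro _ ⟨-, hp⟩ ⟨t, ht, rfl⟩
    simp only at hp
    rcases (show (0 : ℝ) ≤ t from ht).eq_or_lt with rfl | ht
    · simp at hp
    · exact absurd (hw t ht) hp.not_gt
  obtain ⟨ℓ, u, hℓA, hℓB⟩ := geometric_hahn_banach_open hA hAo hB hdisj
  have hsplit (x : X) (r : ℝ) : ℓ (x, r) = ℓ (x, 0) + r * ℓ (0, 1) := by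
    have : (x, r) = (x, (0 : ℝ)) + r • ((0 : X), (1 : ℝ)) := by simp
    rw [this, map_add, map_smul, smul_eq_mul]
  have hray (t : ℝ) (ht : 0 ≤ t) : u ≤ ℓ (x₀, 0) + t * ℓ (w, 0) + f x₀ * ℓ (0, 1) := by
    have h := hℓB _ ⟨t, ht, rfl⟩
    rw [hsplit] at h
    have e : (x₀ + t • w, (0 : ℝ)) = (x₀, 0) + t • (w, (0 : ℝ)) := by simp
    rwa [e, map_add, map_smul, smul_eq_mul] at h
  have hepi (x : X) (r : ℝ) (hr : f x < r) : ℓ (x, 0) + r * ℓ (0, 1) < u := by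
    rw [← hsplit]; exact hℓA _ ⟨Set.mem_univ _, hr⟩
  set lam := ℓ ((0 : X), (1 : ℝ)) with hlam
  have hlamneg : lam < 0 := by
    have h1 := hepi x₀ (f x₀ + 1) (by linarith)
    have h2 := hray 0 le_rfl
    nlinarith
  have hgraph (x : X) : ℓ (x, 0) + f x * lam ≤ u := by
    refine le_of_forall_pos_le_add fun ε hε => ?_
    have hlam' : 0 < -lam := by linarith
    have := hepi x (f x + ε / (-lam)) (by have := div_pos hε hlam'; linarith)
    have e : ε / (-lam) * lam = -ε := by
      rw [div_mul_eq_mul_div, div_neg, mul_div_cancel_right₀ _ hlamneg.ne]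
    rw [add_mul, e] at this
    linarith
  let ℓ₁ : StrongDual ℝ X := ℓ.comp (ContinuousLinearMap.inl ℝ X ℝ)
  have hℓ₁ (x : X) : ℓ₁ x = ℓ (x, 0) := rfl
  refine ⟨(-lam)⁻¹ • (InnerProductSpace.toDual ℝ X).symm ℓ₁, ?_, ?_⟩
  · intro x
    rw [real_inner_smul_left, InnerProductSpace.toDual_symm_apply, map_sub, hℓ₁, hℓ₁]
    have h1 := hgraph x
    have h2 := hray 0 le_rfl
    rw [zero_mul, add_zero] at h2
    have hlam' : 0 < -lam := by linarith
    have : (-lam)⁻¹ * (ℓ (x, 0) - ℓ (x₀, 0)) ≤ f x - f x₀ := by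
      rw [inv_mul_le_iff₀ hlam']; nlinarith
    linarith
  · rw [real_inner_smul_left, InnerProductSpace.toDual_symm_apply, hℓ₁]
    refine mul_nonneg (inv_nonneg.2 (by linarith)) ?_
    by_contra hneg
    push Not at hneg
    have h1 := hgraph x₀
    have h2 := hray 1 zero_le_one
    linarith

/-- The distance to the cone of the subdifferential is approached by the support function of the
normalized feasible directions. -/
lemma exists_feasible_direction (hf : ConvexOn ℝ Set.univ f) (hfc : Continuous f)
    (h0 : 0 ∉ subdifferential f x₀) (h : EuclideanSpace ℝ (Fin n)) {δ : ℝ} (hδ : 0 < δ) :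
    ∃ w : EuclideanSpace ℝ (Fin n), ‖w‖ ≤ 1 ∧ subdiffConeDist f x₀ h - δ ≤ inner ℝ h w ∧
      ∃ t : ℝ, 0 < t ∧ w ∈ feasibleIncrements f x₀ t := by
  set C := PointedCone.hull ℝ (subdifferential f x₀) with hC
  set K : PointedCone ℝ (EuclideanSpace ℝ (Fin n)) := C.closure with hK
  have hKc : (K : Set (EuclideanSpace ℝ (Fin n))) = closure (C : Set (EuclideanSpace ℝ (Fin n))) :=
    PointedCone.coe_closure C
  have hKcl : IsClosed (K : Set (EuclideanSpace ℝ (Fin n))) := hKc ▸ isClosed_closure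
  have hKconv : Convex ℝ (K : Set (EuclideanSpace ℝ (Fin n))) := K.convex
  obtain ⟨p, hpK, hp⟩ := exists_norm_eq_iInf_of_complete_convex ⟨0, K.zero_mem⟩ hKcl.isComplete
    hKconv h
  rw [norm_eq_iInf_iff_real_inner_le_zero hKconv hpK] at hp
  set q := h - p with hq
  have hqp : inner ℝ q p = 0 := by
    have h1 := hp 0 K.zero_mem
    have h2 := hp (p + p) (K.add_mem hpK hpK)
    rw [zero_sub, inner_neg_right] at h1
    rw [add_sub_cancel_right] at h2
    linarith
  have hqs (s) (hs : s ∈ subdifferential f x₀) : inner ℝ q s ≤ 0 := by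
    have hsK : s ∈ K := by
      have : s ∈ (K : Set (EuclideanSpace ℝ (Fin n))) :=
        hKc ▸ subset_closure (Submodule.subset_span hs)
      exact this
    have := hp (p + s) (K.add_mem hpK hsK)
    rwa [add_sub_cancel_left] at this
  have hdist : subdiffConeDist f x₀ h ≤ ‖q‖ := by
    rw [subdiffConeDist, ← Metric.infDist_closure, ← hKc, hq, ← dist_eq_norm]
    exact Metric.infDist_le_dist_of_mem hpK
  rcases eq_or_ne q 0 with hq0 | hq0
  · refine ⟨0, by simp, ?_, 1, one_pos, zero_mem_feasibleIncrements 1⟩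
    rw [hq0, norm_zero] at hdist
    rw [inner_zero_right]
    linarith
  have hqpos : 0 < ‖q‖ := norm_pos_iff.2 hq0
  -- a point strictly below the level of `x₀` gives a direction of uniform strict descent
  obtain ⟨x₁, hx₁⟩ : ∃ x₁, f x₁ < f x₀ := by
    by_contra hno
    push Not at hno
    exact h0 fun x => by simpa using hno x
  set v := x₁ - x₀ with hv
  have hvs (s) (hs : s ∈ subdifferential f x₀) : inner ℝ s v < 0 := by
    have := hs x₁
    linarith
  set e := ‖q‖⁻¹ • q with he
  have hen : ‖e‖ = 1 := by rw [he, norm_smul, norm_inv, norm_norm, inv_mul_cancel₀ hqpos.ne']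
  have hhe : inner ℝ h e = ‖q‖ := by
    have : h = q + p := by rw [hq]; abel
    rw [he, inner_smul_right, this, inner_add_left, real_inner_self_eq_norm_sq, real_inner_comm,
      hqp]
    field_simp
    ring
  have hlim : Filter.Tendsto (fun τ : ℝ => inner ℝ h ((1 + τ * ‖v‖)⁻¹ • (e + τ • v)))
      (nhdsWithin 0 (Set.Ioi 0)) (nhds ‖q‖) := by
    have hc : ContinuousAt (fun τ : ℝ => inner ℝ h ((1 + τ * ‖v‖)⁻¹ • (e + τ • v))) 0 := by
      have h1 : ContinuousAt (fun τ : ℝ => (1 + τ * ‖v‖)⁻¹) 0 :=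
        ContinuousAt.inv₀ (by fun_prop) (by simp)
      have h2 : ContinuousAt (fun τ : ℝ => e + τ • v) 0 := by fun_prop
      exact continuousAt_const.inner (h1.smul h2)
    have := hc.tendsto
    simp only [zero_mul, add_zero, inv_one, zero_smul, one_smul, hhe] at this
    exact this.mono_left nhdsWithin_le_nhds
  obtain ⟨τ, hτ1, hτ0⟩ := ((hlim.eventually (lt_mem_nhds (show ‖q‖ - δ < ‖q‖ by linarith))).and
    self_mem_nhdsWithin).exists
  have hτ0 : 0 < τ := hτ0
  have hden : 0 < 1 + τ * ‖v‖ := by positivity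
  refine ⟨(1 + τ * ‖v‖)⁻¹ • (e + τ • v), ?_, by linarith, ?_⟩
  · rw [norm_smul, norm_inv, Real.norm_eq_abs, abs_of_pos hden, inv_mul_le_iff₀ hden, mul_one]
    refine (norm_add_le _ _).trans ?_
    rw [hen, norm_smul, Real.norm_eq_abs, abs_of_pos hτ0]
  · by_contra hno
    push Not at hno
    obtain ⟨s, hs, hs0⟩ := exists_subgradient_inner_nonneg hf hfc (x₀ := x₀)
      (w := (1 + τ * ‖v‖)⁻¹ • (e + τ • v)) fun t ht => not_le.1 (hno t ht)
    rw [inner_smul_right, inner_add_right, he, inner_smul_right, inner_smul_right] at hs0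
    have h1 : inner ℝ s q ≤ 0 := by rw [real_inner_comm]; exact hqs s hs
    have h2 := hvs s hs
    have h3 : ‖q‖⁻¹ * inner ℝ s q + τ * inner ℝ s v < 0 := by
      have := mul_nonpos_of_nonneg_of_nonpos (inv_nonneg.2 hqpos.le) h1
      have := mul_neg_of_pos_of_neg hτ0 h2
      linarith
    have := mul_neg_of_pos_of_neg (inv_pos.2 hden) h3
    linarith

end Convex

/-! ### The value of the auxiliary problem -/

section AuxValue

variable {n : ℕ}

/-- The infimum over `W` of the auxiliary objective with `‖g‖` replaced by `M` and without the
additive Gaussian variable. It is meaningful for nonempty bounded `W` only. -/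
noncomputable def auxValue (M : ℝ) (W : Set (EuclideanSpace ℝ (Fin n)))
    (h : EuclideanSpace ℝ (Fin n)) : ℝ :=
  sInf ((fun w => M * √(1 + ‖w‖ ^ 2) - inner ℝ h w) '' W)

variable {M : ℝ} {W : Set (EuclideanSpace ℝ (Fin n))} {B : NNReal}

lemma le_auxObjective_of_mem_closedBall (hM : 0 ≤ M) (hWB : W ⊆ Metric.closedBall 0 B)
    (h : EuclideanSpace ℝ (Fin n)) {w : EuclideanSpace ℝ (Fin n)} (hw : w ∈ W) :
    -(‖h‖ * B) ≤ M * √(1 + ‖w‖ ^ 2) - inner ℝ h w := by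
  have h1 := real_inner_le_norm h w
  have h2 : ‖w‖ ≤ B := mem_closedBall_zero_iff.1 (hWB hw)
  have h3 : ‖h‖ * ‖w‖ ≤ ‖h‖ * B := by gcongr
  have h4 : 0 ≤ M * √(1 + ‖w‖ ^ 2) := by positivity
  linarith

lemma bddBelow_auxValue (hM : 0 ≤ M) (hWB : W ⊆ Metric.closedBall 0 B)
    (h : EuclideanSpace ℝ (Fin n)) :
    BddBelow ((fun w => M * √(1 + ‖w‖ ^ 2) - inner ℝ h w) '' W) := by
  refine ⟨-(‖h‖ * B), ?_⟩
  rintro _ ⟨w, hw, rfl⟩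
  exact le_auxObjective_of_mem_closedBall hM hWB h hw

lemma auxValue_le (hM : 0 ≤ M) (hWB : W ⊆ Metric.closedBall 0 B) (h : EuclideanSpace ℝ (Fin n))
    {w : EuclideanSpace ℝ (Fin n)} (hw : w ∈ W) :
    auxValue M W h ≤ M * √(1 + ‖w‖ ^ 2) - inner ℝ h w :=
  csInf_le (bddBelow_auxValue hM hWB h) ⟨w, hw, rfl⟩

lemma le_auxValue (hW : W.Nonempty) {h : EuclideanSpace ℝ (Fin n)} {c : ℝ}
    (hc : ∀ w ∈ W, c ≤ M * √(1 + ‖w‖ ^ 2) - inner ℝ h w) : c ≤ auxValue M W h := by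
  refine le_csInf (hW.image _) ?_
  rintro _ ⟨w, hw, rfl⟩
  exact hc w hw

lemma exists_lt_of_auxValue_lt (hW : W.Nonempty) {h : EuclideanSpace ℝ (Fin n)} {c : ℝ}
    (hc : auxValue M W h < c) : ∃ w ∈ W, M * √(1 + ‖w‖ ^ 2) - inner ℝ h w < c := by
  obtain ⟨_, ⟨w, hw, rfl⟩, h1⟩ := exists_lt_of_csInf_lt (hW.image _) hc
  exact ⟨w, hw, h1⟩

lemma auxValue_anti (hM : 0 ≤ M) {W' : Set (EuclideanSpace ℝ (Fin n))} (hW : W.Nonempty)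
    (hWB : W' ⊆ Metric.closedBall 0 B) (hWW : W ⊆ W') (h : EuclideanSpace ℝ (Fin n)) :
    auxValue M W' h ≤ auxValue M W h :=
  le_auxValue hW fun _ hw => auxValue_le hM hWB h (hWW hw)

lemma lipschitzWith_auxValue (hM : 0 ≤ M) (hW : W.Nonempty) (hWB : W ⊆ Metric.closedBall 0 B) :
    LipschitzWith B (auxValue M W) := by
  refine LipschitzWith.of_le_add_mul B fun h h' => ?_
  rw [← sub_le_iff_le_add]
  refine le_auxValue hW fun w hw => ?_
  have h1 := auxValue_le hM hWB h hw
  have h2 := real_inner_le_norm (h' - h) w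
  rw [inner_sub_left] at h2
  have h3 : ‖h' - h‖ * ‖w‖ ≤ dist h h' * B := by
    rw [dist_comm, dist_eq_norm]
    gcongr
    exact mem_closedBall_zero_iff.1 (hWB hw)
  linarith

variable {f : EuclideanSpace ℝ (Fin n) → ℝ} {x₀ : EuclideanSpace ℝ (Fin n)}

lemma lipschitzWith_subdiffConeDist : LipschitzWith 1 (subdiffConeDist f x₀) :=
  Metric.lipschitz_infDist_pt _

lemma subdiffConeDist_nonneg (h : EuclideanSpace ℝ (Fin n)) : 0 ≤ subdiffConeDist f x₀ h :=
  Metric.infDist_nonneg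

lemma gaussianSqDist_eq :
    gaussianSqDist f x₀ = ∫ h, subdiffConeDist f x₀ h ^ 2 ∂(stdGaussian _) := rfl

open Filter Topology in
/-- As the noise level tends to `0`, the feasible increments fill the tangent cone, and the mean
auxiliary value drops at least to its value on that cone. -/
lemma exists_integral_auxValue_le (hf : ConvexOn ℝ Set.univ f) (hfc : Continuous f)
    (h0 : 0 ∉ subdifferential f x₀) (hM : 0 ≤ M) {R r : ℝ} (hR : 0 ≤ R) (hRr : R ≤ r)
    (hrB : r ≤ B) {δ : ℝ} (hδ : 0 < δ) :
    ∃ σ₀ : ℝ, 0 < σ₀ ∧ ∀ σ : ℝ, 0 < σ → σ ≤ σ₀ →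
      ∫ h, auxValue M (feasibleIncrements f x₀ σ ∩ Metric.closedBall 0 r) h ∂(stdGaussian _) ≤
        M * √(1 + R ^ 2) - R * ∫ h, subdiffConeDist f x₀ h ∂(stdGaussian _) + δ := by
  set μ := stdGaussian (EuclideanSpace ℝ (Fin n))
  let W : ℝ → Set (EuclideanSpace ℝ (Fin n)) := fun σ =>
    feasibleIncrements f x₀ σ ∩ Metric.closedBall 0 r
  have hr0 : 0 ≤ r := hR.trans hRr
  have hW0 (σ) : (0 : EuclideanSpace ℝ (Fin n)) ∈ W σ :=
    ⟨zero_mem_feasibleIncrements σ, Metric.mem_closedBall_self hr0⟩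
  have hWne (σ) : (W σ).Nonempty := ⟨0, hW0 σ⟩
  have hWB (σ) : W σ ⊆ Metric.closedBall 0 B :=
    Set.inter_subset_right.trans (Metric.closedBall_subset_closedBall hrB)
  have hlip (σ) : LipschitzWith B (auxValue M (W σ)) := lipschitzWith_auxValue hM (hWne σ) (hWB σ)
  set ℓ : EuclideanSpace ℝ (Fin n) → ℝ := fun h => M * √(1 + R ^ 2) - R * subdiffConeDist f x₀ h
    with hℓ
  have hdi : Integrable (subdiffConeDist f x₀) μ :=
    lipschitzWith_subdiffConeDist.integrable_stdGaussian
  have hℓi : Integrable ℓ μ := (integrable_const _).sub (hdi.const_mul R)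
  have hℓint : ∫ h, ℓ h ∂μ = M * √(1 + R ^ 2) - R * ∫ h, subdiffConeDist f x₀ h ∂μ := by
    rw [hℓ, integral_sub (integrable_const _) (hdi.const_mul R)]
    simp [integral_const_mul]
  have hni : Integrable (fun h : EuclideanSpace ℝ (Fin n) => ‖h‖) μ := IsGaussian.integrable_id.norm
  let τ : ℕ → ℝ := fun k => 1 / ((k : ℝ) + 1)
  have hτ0 (k) : 0 < τ k := Nat.one_div_pos_of_nat
  have hlim (h : EuclideanSpace ℝ (Fin n)) :
      Tendsto (fun k => max (auxValue M (W (τ k)) h) (ℓ h)) atTop (𝓝 (ℓ h)) := by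
    refine tendsto_order.2 ⟨fun a ha => Eventually.of_forall fun k => lt_max_of_lt_right ha,
      fun a ha => ?_⟩
    obtain ⟨w, hw1, hw2, t, ht, hwt⟩ := exists_feasible_direction hf hfc h0 h
      (δ := (a - ℓ h) / (2 * (R + 1))) (div_pos (by linarith) (by linarith))
    have htR : 0 < t / (R + 1) := div_pos ht (by linarith)
    filter_upwards [(tendsto_one_div_add_atTop_nhds_zero_nat (𝕜 := ℝ)).eventually
      (gt_mem_nhds htR)] with k hk
    have hk' : τ k * (R + 1) ≤ t := ((lt_div_iff₀ (by linarith)).1 hk).le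
    have hmem : R • w ∈ W (τ k) := by
      refine ⟨?_, ?_⟩
      · rcases hR.eq_or_lt with rfl | hRpos
        · rw [zero_smul]; exact zero_mem_feasibleIncrements _
        · have h1 := feasibleIncrements_anti hf (mul_pos (hτ0 k) hRpos)
            (by nlinarith [hτ0 k] : τ k * R ≤ t) hwt
          have h2 : f (x₀ + (τ k * R) • w) ≤ f x₀ := h1
          rwa [mul_smul] at h2
      · rw [mem_closedBall_zero_iff, norm_smul, Real.norm_eq_abs, abs_of_nonneg hR]
        exact (mul_le_of_le_one_right hR hw1).trans hRr
    have h1 := auxValue_le hM (hWB (τ k)) h hmem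
    have h2 : ‖R • w‖ ≤ R := by
      rw [norm_smul, Real.norm_eq_abs, abs_of_nonneg hR]
      exact mul_le_of_le_one_right hR hw1
    have h3 : M * √(1 + ‖R • w‖ ^ 2) ≤ M * √(1 + R ^ 2) := by gcongr
    rw [inner_smul_right] at h1
    have h4 : R * ((a - ℓ h) / (2 * (R + 1))) ≤ (a - ℓ h) / 2 := by
      rw [mul_div_assoc', div_le_div_iff₀ (by linarith) two_pos]
      nlinarith
    have h5 := mul_le_mul_of_nonneg_left hw2 hR
    have h6 : ℓ h = M * √(1 + R ^ 2) - R * subdiffConeDist f x₀ h := rfl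
    refine max_lt ?_ ha
    linarith
  have hbound (k) (h : EuclideanSpace ℝ (Fin n)) :
      ‖max (auxValue M (W (τ k)) h) (ℓ h)‖ ≤ (M + ‖h‖ * B) + |ℓ h| := by
    have h1 := auxValue_le hM (hWB (τ k)) h (hW0 (τ k))
    have h2 := le_auxValue (hWne (τ k)) fun w hw =>
      le_auxObjective_of_mem_closedBall hM (hWB (τ k)) h hw
    simp only [norm_zero, inner_zero_right, sub_zero] at h1
    have h3 : √(1 + (0 : ℝ) ^ 2) = 1 := by norm_num
    rw [h3, mul_one] at h1
    have h4 : 0 ≤ ‖h‖ * B := by positivity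
    have h5 : |auxValue M (W (τ k)) h| ≤ M + ‖h‖ * B := abs_le.2 ⟨by linarith, by linarith⟩
    exact abs_max_le_max_abs_abs.trans (max_le (h5.trans (le_add_of_nonneg_right (abs_nonneg _)))
      (le_add_of_nonneg_left (by positivity)))
  have hmeas (k) : AEStronglyMeasurable (fun h => max (auxValue M (W (τ k)) h) (ℓ h)) μ :=
    ((hlip _).continuous.max (continuous_const.sub
      (continuous_const.mul lipschitzWith_subdiffConeDist.continuous))).aestronglyMeasurable
  have hbi : Integrable (fun h : EuclideanSpace ℝ (Fin n) => (M + ‖h‖ * B) + |ℓ h|) μ :=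
    ((integrable_const _).add (hni.mul_const _)).add hℓi.abs
  have hconv := tendsto_integral_of_dominated_convergence _ hmeas hbi
    (fun k => ae_of_all _ (hbound k)) (ae_of_all _ hlim)
  rw [hℓint] at hconv
  obtain ⟨k, hk⟩ := (hconv.eventually (gt_mem_nhds (lt_add_of_pos_right _ hδ))).exists
  refine ⟨τ k, hτ0 k, fun σ hσ hσk => ?_⟩
  refine le_trans ?_ hk.le
  refine integral_mono (hlip σ).integrable_stdGaussian
    (hbi.mono' (hmeas k) (ae_of_all _ (hbound k))) fun h => ?_
  exact (auxValue_anti hM (hWne _) (hWB _)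
    (Set.inter_subset_inter_left _ (feasibleIncrements_anti hf hσ hσk)) h).trans (le_max_left _ _)

end AuxValue

/-! ### Typical realizations of the auxiliary problem -/

section Typical

variable {m n : ℕ}

lemma LipschitzWith.stdGaussian_le_abs_comap_sub_integral {ι κ : Type*} [Fintype ι] [Fintype κ]
    {φ : κ → ι} (hφ : φ.Injective) {f : EuclideanSpace ℝ κ → ℝ} {L : NNReal}
    (hf : LipschitzWith L f) {t : ℝ} (ht : 0 ≤ t) :
    stdGaussian (EuclideanSpace ℝ ι)
      {η | t ≤ |f (EuclideanSpace.comap φ η) - ∫ y, f y ∂(stdGaussian (EuclideanSpace ℝ κ))|} ≤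
      ENNReal.ofReal (2 * Real.exp (-(2 * t ^ 2 / (Real.pi ^ 2 * L ^ 2)))) := by
  refine le_trans ?_ (hf.stdGaussian_le_abs_sub_integral ht)
  rw [← map_comap_stdGaussian hφ]
  exact Measure.le_map_apply (EuclideanSpace.continuous_comap φ).aemeasurable _

/-- The realizations for which every random quantity in the auxiliary problem is within a small
multiple of `√m` of its typical value. Of the distance `d` to the cone of the subdifferential only an
upper bound is needed; `q` is an auxiliary value. -/
def IsTypical (δ : ℝ) (d q : EuclideanSpace ℝ (Fin n) → ℝ)
    (η : EuclideanSpace ℝ ((Fin m ⊕ Fin n) ⊕ Unit)) : Prop :=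
  |‖EuclideanSpace.comap (Sum.inl ∘ Sum.inl) η‖ - √m| ≤ δ * √m ∧
  |η (Sum.inr ())| ≤ δ * √m ∧
  d (EuclideanSpace.comap (Sum.inl ∘ Sum.inr) η) ≤ √(∫ h, d h ^ 2 ∂(stdGaussian _)) + δ * √m ∧
  |q (EuclideanSpace.comap (Sum.inl ∘ Sum.inr) η) - ∫ h, q h ∂(stdGaussian _)| ≤ δ * √m

theorem stdGaussian_not_isTypical_le {δ : ℝ} (hδ : 0 ≤ δ)
    (hbig : √(4 * Real.exp (Real.pi ^ 2 / 8)) ≤ δ / 2 * √m)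
    {d q : EuclideanSpace ℝ (Fin n) → ℝ} (hd : LipschitzWith 1 d) (hd0 : ∀ h, 0 ≤ d h) {B : NNReal}
    (hB : 1 ≤ B) (hq : LipschitzWith B q) :
    stdGaussian (EuclideanSpace ℝ ((Fin m ⊕ Fin n) ⊕ Unit)) {η | ¬ IsTypical δ d q η} ≤
      ENNReal.ofReal (8 * Real.exp (-(δ ^ 2 / (2 * Real.pi ^ 2 * B ^ 2) * m))) := by
  set t : ℝ := δ / 2 * √m with ht
  have ht0 : 0 ≤ t := by positivity
  have ht2 : t ≤ δ * √m := by
    have : 0 ≤ δ * √m := by positivity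
    rw [ht]; linarith
  have hB' : (1 : ℝ) ≤ B := by exact_mod_cast hB
  set b : ENNReal := ENNReal.ofReal (2 * Real.exp (-(δ ^ 2 / (2 * Real.pi ^ 2 * B ^ 2) * m)))
  have hexp {L : NNReal} (hL : 1 ≤ L) (hLB : L ≤ B) :
      ENNReal.ofReal (2 * Real.exp (-(2 * t ^ 2 / (Real.pi ^ 2 * L ^ 2)))) ≤ b := by
    have hL' : (1 : ℝ) ≤ L := by exact_mod_cast hL
    have hLB' : (L : ℝ) ≤ B := by exact_mod_cast hLB
    refine ENNReal.ofReal_le_ofReal ?_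
    gcongr 2 * Real.exp (-?_)
    have hπ := Real.pi_pos
    have e : δ ^ 2 / (2 * Real.pi ^ 2 * B ^ 2) * m = 2 * t ^ 2 / (Real.pi ^ 2 * B ^ 2) := by
      rw [ht, mul_pow, Real.sq_sqrt (Nat.cast_nonneg m)]
      field_simp
    rw [e]
    gcongr
  have hinj1 : (Sum.inl ∘ Sum.inl : Fin m → (Fin m ⊕ Fin n) ⊕ Unit).Injective :=
    Sum.inl_injective.comp Sum.inl_injective
  have hinj2 : (Sum.inl ∘ Sum.inr : Fin n → (Fin m ⊕ Fin n) ⊕ Unit).Injective :=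
    Sum.inl_injective.comp Sum.inr_injective
  have hinj3 : (Sum.inr : Unit → (Fin m ⊕ Fin n) ⊕ Unit).Injective := Sum.inr_injective
  have hnorm : LipschitzWith 1 (fun x : EuclideanSpace ℝ (Fin m) => ‖x‖) := lipschitzWith_one_norm
  have hcoord : LipschitzWith 1 (fun x : EuclideanSpace ℝ Unit => x ()) := by
    refine LipschitzWith.of_dist_le_mul fun x y => ?_
    rw [NNReal.coe_one, one_mul, dist_eq_norm, dist_eq_norm]
    exact PiLp.norm_apply_le (x - y) ()
  have h1 := (hnorm.stdGaussian_le_abs_comap_sub_integral hinj1 ht0).trans (hexp le_rfl hB)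
  have h2 := (hcoord.stdGaussian_le_abs_comap_sub_integral hinj3 ht0).trans (hexp le_rfl hB)
  have h3 := (hd.stdGaussian_le_abs_comap_sub_integral hinj2 ht0).trans (hexp le_rfl hB)
  have h4 := (hq.stdGaussian_le_abs_comap_sub_integral hinj2 ht0).trans (hexp hB le_rfl)
  have hmean : ∫ y : EuclideanSpace ℝ Unit, y () ∂(stdGaussian (EuclideanSpace ℝ Unit)) = 0 :=
    integral_strongDual_stdGaussian (EuclideanSpace.proj (𝕜 := ℝ) ())
  have hn := hnorm.sqrt_integral_sq_sub_integral fun x => norm_nonneg x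
  rw [integral_norm_sq_stdGaussian, Fintype.card_fin] at hn
  have hdm := hd.sqrt_integral_sq_sub_integral hd0
  have h8 : ENNReal.ofReal (8 * Real.exp (-(δ ^ 2 / (2 * Real.pi ^ 2 * B ^ 2) * m))) =
      b + b + (b + b) := by
    rw [← ENNReal.ofReal_add (by positivity) (by positivity),
      ← ENNReal.ofReal_add (by positivity) (by positivity)]
    congr 1; ring
  rw [h8]
  refine le_trans (measure_mono ?_) ((measure_union_le _ _).trans (add_le_add
    ((measure_union_le _ _).trans (add_le_add h1 h2))
    ((measure_union_le _ _).trans (add_le_add h3 h4))))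
  intro η hη
  by_contra hno
  simp only [Set.mem_union, Set.mem_ofPred_eq, not_or, not_le] at hno
  obtain ⟨⟨k1, k2⟩, k3, k4⟩ := hno
  rw [hmean, sub_zero] at k2
  refine hη ⟨?_, k2.le.trans ht2, ?_, k4.le.trans ht2⟩
  · rw [abs_lt] at k1
    rw [abs_le]
    constructor <;> linarith
  · have := (abs_lt.1 k3).2
    linarith

end Typical

/-! ### Localization of minimizers -/

section Localization

/-- If a convex function is smaller somewhere in a ball than on the part of the bounding sphere that
is feasible, then its minimizers over the feasible set exist and lie inside the ball. -/
lemma ConvexOn.exists_isMinOn_and_norm_lt {E : Type*} [NormedAddCommGroup E] [NormedSpace ℝ E]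
    [FiniteDimensional ℝ E] {K : Set E} {φ : E → ℝ} (hφ : ConvexOn ℝ K φ) (hφc : Continuous φ)
    (hK : IsClosed K) {r c : ℝ} {w₀ : E} (hw₀ : w₀ ∈ K) (hw₀r : ‖w₀‖ ≤ r) (hlt : φ w₀ < c)
    (hsph : ∀ w ∈ K, ‖w‖ = r → c ≤ φ w) :
    (∃ w ∈ K, IsMinOn φ K w) ∧ ∀ w ∈ K, IsMinOn φ K w → ‖w‖ < r ∧ φ w < c := by
  have hout : ∀ w ∈ K, r ≤ ‖w‖ → φ w₀ < φ w := by
    intro w hw hr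
    by_contra! hle
    have hcont : ContinuousOn (fun t : ℝ => ‖(1 - t) • w₀ + t • w‖) (Set.Icc 0 1) := by fun_prop
    obtain ⟨t, ⟨ht0, ht1⟩, ht⟩ := intermediate_value_Icc zero_le_one hcont
      (show r ∈ Set.Icc _ _ from ⟨by simpa using hw₀r, by simpa using hr⟩)
    have h1 := hsph _ (hφ.1 hw₀ hw (sub_nonneg.2 ht1) ht0 (by ring)) ht
    have h2 := hφ.2 hw₀ hw (sub_nonneg.2 ht1) ht0 (by ring)
    simp only [smul_eq_mul] at h2
    nlinarith
  constructor
  · have hcpt : IsCompact (K ∩ Metric.closedBall 0 r) :=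
      (isCompact_closedBall 0 r).inter_left hK
    obtain ⟨w, hw, hmin⟩ := hcpt.exists_isMinOn ⟨w₀, hw₀, mem_closedBall_zero_iff.2 hw₀r⟩
      hφc.continuousOn
    refine ⟨w, hw.1, fun v hv => ?_⟩
    by_cases hvr : ‖v‖ ≤ r
    · exact hmin ⟨hv, mem_closedBall_zero_iff.2 hvr⟩
    · exact (hmin ⟨hw₀, mem_closedBall_zero_iff.2 hw₀r⟩ : φ w ≤ φ w₀).trans
        (hout v hv (not_le.1 hvr).le).le
  · intro w hw hmin
    have h1 : φ w ≤ φ w₀ := hmin hw₀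
    refine ⟨?_, h1.trans_lt hlt⟩
    by_contra! hr
    exact absurd (hout w hw hr) (not_lt.2 h1)

variable {m n : ℕ}

lemma continuous_norm_linearResidual (ζ : EuclideanSpace ℝ ((Fin m × Fin n) ⊕ Fin m)) :
    Continuous fun w => ‖linearResidual ζ w‖ :=
  (continuous_linearResidual.comp (by fun_prop : Continuous fun w : EuclideanSpace ℝ (Fin n) =>
    (ζ, w))).norm

lemma convexOn_norm_linearResidual (ζ : EuclideanSpace ℝ ((Fin m × Fin n) ⊕ Fin m))
    {K : Set (EuclideanSpace ℝ (Fin n))} (hK : Convex ℝ K) :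
    ConvexOn ℝ K fun w => ‖linearResidual ζ w‖ := by
  refine ⟨hK, fun v _ w _ a b ha hb hab => ?_⟩
  have e : linearResidual ζ (a • v + b • w) = a • linearResidual ζ v + b • linearResidual ζ w := by
    ext i
    have hz : ζ (Sum.inr i) = a * ζ (Sum.inr i) + b * ζ (Sum.inr i) := by
      rw [← add_mul, hab, one_mul]
    simp only [linearResidual, PiLp.add_apply, PiLp.smul_apply, smul_eq_mul, mul_add,
      Finset.sum_add_distrib, mul_sub, Finset.mul_sum]
    nth_rewrite 1 [hz]
    have h1 (j : Fin n) : ζ (Sum.inl (i, j)) * (a * v j) = a * (ζ (Sum.inl (i, j)) * v j) := by ring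
    have h2 (j : Fin n) : ζ (Sum.inl (i, j)) * (b * w j) = b * (ζ (Sum.inl (i, j)) * w j) := by ring
    simp only [h1, h2]
    ring
  simp only [e]
  refine (norm_add_le _ _).trans_eq ?_
  rw [norm_smul, norm_smul, Real.norm_of_nonneg ha, Real.norm_of_nonneg hb, smul_eq_mul, smul_eq_mul]

/-- Suppose that outside an event of probability `p` the auxiliary objective falls below `c` in the
ball of radius `r`, but exceeds some `c' > c` on a set `J` that contains the feasible part of the
bounding sphere. Then, outside an event of probability `4 * p`, the minimizers of the residual exist,
lie in the ball and avoid `J`. -/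
theorem stdGaussian_not_minimizers_le (hm : 0 < m) {K J : Set (EuclideanSpace ℝ (Fin n))}
    (hKc : Convex ℝ K) (hK : IsClosed K) (h0 : 0 ∈ K) {r : ℝ} (hr : 0 ≤ r)
    (hJ : ∀ w ∈ K, ‖w‖ = r → w ∈ J) {c c' : ℝ} (hcc : c < c') (hc : 0 < c')
    {G : Set (EuclideanSpace ℝ ((Fin m ⊕ Fin n) ⊕ Unit))}
    (hlow : ∀ η ∈ G, ∃ w ∈ K ∩ Metric.closedBall 0 r, auxObjective η w < c)
    (hhigh : ∀ η ∈ G, ∀ w ∈ J, c' < auxObjective η w) :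
    stdGaussian (EuclideanSpace ℝ ((Fin m × Fin n) ⊕ Fin m))
      {ζ | ¬ ((∃ w ∈ K, IsMinOn (fun w => ‖linearResidual ζ w‖) K w) ∧
        ∀ w ∈ K, IsMinOn (fun w => ‖linearResidual ζ w‖) K w → ‖w‖ < r ∧ w ∉ J)} ≤
      4 * stdGaussian _ Gᶜ := by
  have hA := stdGaussian_exists_norm_residual_lt_le hm J c'
  have hB := stdGaussian_forall_le_norm_residual_le hm
    (hKc.inter (convex_closedBall (0 : EuclideanSpace ℝ (Fin n)) r))
    ((isCompact_closedBall 0 r).inter_left hK) ⟨0, h0, Metric.mem_closedBall_self hr⟩ hcc hc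
  have hA' : stdGaussian (EuclideanSpace ℝ ((Fin m ⊕ Fin n) ⊕ Unit))
      {η | ∃ w ∈ J, auxObjective η w ≤ c'} ≤ stdGaussian _ Gᶜ := by
    refine measure_mono ?_
    rintro η ⟨w, hw, hle⟩ hη
    exact absurd (hhigh η hη w hw) (not_lt.2 hle)
  have hB' : stdGaussian (EuclideanSpace ℝ ((Fin m ⊕ Fin n) ⊕ Unit))
      {η | ∀ w ∈ K ∩ Metric.closedBall 0 r, c ≤ auxObjective η w} ≤ stdGaussian _ Gᶜ := by
    refine measure_mono fun η hle hη => ?_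
    obtain ⟨w, hw, hlt⟩ := hlow η hη
    exact absurd (hle w hw) (not_le.2 hlt)
  have h4 : (4 : ENNReal) * stdGaussian _ Gᶜ = 2 * stdGaussian _ Gᶜ + 2 * stdGaussian _ Gᶜ := by
    rw [← add_mul]; norm_num
  rw [h4]
  refine le_trans (measure_mono ?_) ((measure_union_le _ _).trans
    (add_le_add (hA.trans (mul_le_mul_right hA' 2)) (hB.trans (mul_le_mul_right hB' 2))))
  intro ζ hζ
  by_contra hno
  simp only [Set.mem_union, Set.mem_ofPred_eq, not_or, not_exists, not_and, not_lt, not_forall,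
    not_le] at hno
  obtain ⟨hnoA, w₀, ⟨hw₀K, hw₀r⟩, hw₀⟩ := hno
  obtain ⟨hex, hall⟩ := (convexOn_norm_linearResidual ζ hKc).exists_isMinOn_and_norm_lt
    (continuous_norm_linearResidual ζ) hK hw₀K (mem_closedBall_zero_iff.1 hw₀r) hw₀
    fun w hw hwr => hnoA w (hJ w hw hwr)
  refine hζ ⟨hex, fun w hw hmin => ⟨(hall w hw hmin).1, fun hwJ => ?_⟩⟩
  exact absurd (hall w hw hmin).2 (not_lt.2 (hnoA w hwJ))

end Localization

/-! ### The LASSO in standardized coordinates -/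

section Model

variable {m n : ℕ}

/-- The entries of the design matrix together with the noise rescaled to unit variance. -/
noncomputable def standardizedData (σ : ℝ) (A : Matrix (Fin m) (Fin n) ℝ)
    (z : EuclideanSpace ℝ (Fin m)) : EuclideanSpace ℝ ((Fin m × Fin n) ⊕ Fin m) :=
  WithLp.toLp 2 (Sum.elim (fun p => A p.1 p.2) fun i => z i / σ)

lemma norm_sub_toEuclideanLin_eq {σ : ℝ} (hσ : 0 < σ) (A : Matrix (Fin m) (Fin n) ℝ)
    (z : EuclideanSpace ℝ (Fin m)) (x₀ w : EuclideanSpace ℝ (Fin n)) :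
    ‖(Matrix.toEuclideanLin A x₀ + z) - Matrix.toEuclideanLin A (x₀ + σ • w)‖ =
      σ * ‖linearResidual (standardizedData σ A z) w‖ := by
  have e : (Matrix.toEuclideanLin A x₀ + z) - Matrix.toEuclideanLin A (x₀ + σ • w) =
      -(σ • linearResidual (standardizedData σ A z) w) := by
    rw [map_add, map_smul]
    ext i
    simp only [linearResidual, standardizedData, PiLp.sub_apply, PiLp.add_apply, PiLp.neg_apply,
      PiLp.smul_apply, smul_eq_mul, Sum.elim_inl, Sum.elim_inr, Matrix.toLpLin_apply,
      Matrix.mulVec, dotProduct]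
    field_simp
    ring
  rw [e, norm_neg, norm_smul, Real.norm_of_nonneg hσ.le]

lemma mem_constrainedLasso_iff {σ : ℝ} (hσ : 0 < σ) (f : EuclideanSpace ℝ (Fin n) → ℝ)
    (A : Matrix (Fin m) (Fin n) ℝ) (z : EuclideanSpace ℝ (Fin m))
    (x₀ w : EuclideanSpace ℝ (Fin n)) :
    x₀ + σ • w ∈ constrainedLasso f x₀ A z ↔ w ∈ feasibleIncrements f x₀ σ ∧
      IsMinOn (fun w => ‖linearResidual (standardizedData σ A z) w‖)
        (feasibleIncrements f x₀ σ) w := by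
  have hx (x : EuclideanSpace ℝ (Fin n)) : x = x₀ + σ • (σ⁻¹ • (x - x₀)) := by
    rw [smul_inv_smul₀ hσ.ne']; abel
  refine and_congr_right fun _ => ⟨fun h v hv => ?_, fun h x hxf => ?_⟩
  · have h1 := h hv
    simp only [Set.mem_ofPred_eq, norm_sub_toEuclideanLin_eq hσ] at h1
    exact le_of_mul_le_mul_left h1 hσ
  · rw [hx x] at hxf ⊢
    have h1 := h hxf
    simp only [Set.mem_ofPred_eq, norm_sub_toEuclideanLin_eq hσ] at h1 ⊢
    exact mul_le_mul_of_nonneg_left h1 hσ.le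

/-- A property of all rescaled errors `(x - x₀) / σ` may be checked on the minimizers of the
standardized residual. -/
lemma constrainedLasso_nonempty_and_forall {σ : ℝ} (hσ : 0 < σ)
    {f : EuclideanSpace ℝ (Fin n) → ℝ} {A : Matrix (Fin m) (Fin n) ℝ}
    {z : EuclideanSpace ℝ (Fin m)} {x₀ : EuclideanSpace ℝ (Fin n)} {p : ℝ → Prop}
    (hex : ∃ w ∈ feasibleIncrements f x₀ σ,
      IsMinOn (fun w => ‖linearResidual (standardizedData σ A z) w‖)
        (feasibleIncrements f x₀ σ) w)
    (hall : ∀ w ∈ feasibleIncrements f x₀ σ,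
      IsMinOn (fun w => ‖linearResidual (standardizedData σ A z) w‖)
        (feasibleIncrements f x₀ σ) w → p (‖w‖ ^ 2)) :
    (constrainedLasso f x₀ A z).Nonempty ∧
      ∀ x ∈ constrainedLasso f x₀ A z, p (‖x - x₀‖ ^ 2 / σ ^ 2) := by
  obtain ⟨w, hw⟩ := hex
  refine ⟨⟨x₀ + σ • w, (mem_constrainedLasso_iff hσ f A z x₀ w).2 hw⟩, fun x hx => ?_⟩
  have hx' : x = x₀ + σ • (σ⁻¹ • (x - x₀)) := by
    rw [smul_inv_smul₀ hσ.ne']; abel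
  rw [hx', mem_constrainedLasso_iff hσ] at hx
  have h1 := hall _ hx.1 hx.2
  rw [norm_smul, norm_inv, Real.norm_of_nonneg hσ.le, mul_pow, inv_pow] at h1
  rwa [div_eq_inv_mul]

variable {Ω : Type*} [MeasurableSpace Ω] {P : Measure Ω} [IsProbabilityMeasure P] {σ : ℝ}
  {A : Ω → Matrix (Fin m) (Fin n) ℝ} {z : Ω → EuclideanSpace ℝ (Fin m)}

lemma IsGaussianModel.hasLaw_standardizedData (h : IsGaussianModel P σ A z) (hσ : 0 < σ) :
    HasLaw (fun ω => standardizedData σ (A ω) (z ω)) (stdGaussian _) P := by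
  let X : (Fin m × Fin n) ⊕ Fin m → Ω → ℝ := fun k ω =>
    Sum.elim (fun p : Fin m × Fin n => A ω p.1 p.2) (fun i : Fin m => z ω i / σ) k
  have hlaw (k) : HasLaw (X k) (gaussianReal 0 1) P := by
    rcases k with p | i
    · exact h.matrix_law p.1 p.2
    · have h1 := gaussianReal_div_const (h.noise_law i) σ
      have h2 : (σ ^ 2).toNNReal / NNReal.mk (σ ^ 2) (sq_nonneg _) = 1 := by
        rw [Real.toNNReal_of_nonneg (sq_nonneg _)]
        exact div_self fun h0 => (pow_pos hσ 2).ne' (congrArg NNReal.toReal h0)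
      rwa [zero_div, h2] at h1
  have hind : iIndepFun X P := by
    have := h.indep.comp (fun k (x : ℝ) => Sum.elim (fun _ => x) (fun _ => x / σ) k) (by
      rintro (p | i)
      · exact measurable_id
      · exact measurable_id.div_const σ)
    refine this.congr fun k => ?_
    rcases k with p | i <;> exact Filter.EventuallyEq.rfl
  have hpi := (iIndepFun_iff_map_fun_eq_pi_map fun k => (hlaw k).aemeasurable).1 hind
  simp_rw [fun k => (hlaw k).map_eq] at hpi
  have hm : AEMeasurable (fun ω k => X k ω) P :=
    aemeasurable_pi_lambda _ fun k => (hlaw k).aemeasurable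
  have hlp : Measurable (WithLp.toLp 2 : ((Fin m × Fin n) ⊕ Fin m → ℝ) → EuclideanSpace ℝ _) := by
    fun_prop
  have e : (fun ω => standardizedData σ (A ω) (z ω)) = WithLp.toLp 2 ∘ fun ω k => X k ω := by
    ext ω k
    rcases k with p | i <;> rfl
  refine ⟨e ▸ hlp.comp_aemeasurable hm, ?_⟩
  rw [e, ← AEMeasurable.map_map_of_aemeasurable hlp.aemeasurable hm, hpi, map_pi_eq_stdGaussian]

lemma IsGaussianModel.measure_preimage_le (h : IsGaussianModel P σ A z) (hσ : 0 < σ)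
    (S : Set (EuclideanSpace ℝ ((Fin m × Fin n) ⊕ Fin m))) :
    P {ω | standardizedData σ (A ω) (z ω) ∈ S} ≤ stdGaussian _ S := by
  have hl := h.hasLaw_standardizedData hσ
  rw [← hl.map_eq]
  exact Measure.le_map_apply hl.aemeasurable S

end Model

/-! ### The deterministic profile of the auxiliary problem -/

section Profile

variable {ρ s : ℝ}

/-- The profile `r ↦ √(1 + r²) - ρ * r` has minimum `s = √(1 - ρ²)`, attained at `r = ρ / s`, and
exceeds it quantitatively elsewhere. -/
lemma add_le_sqrt_one_add_sq_sub (hρ : 0 < ρ) (hs : 0 < s) (h1 : ρ ^ 2 + s ^ 2 = 1) {r B k : ℝ}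
    (hr : 0 ≤ r) (hrB : r ≤ B) (hB : 1 ≤ B) (hk0 : 0 ≤ k) (hk : k ≤ |s * r - ρ|) :
    s + k ^ 2 / (4 * B) ≤ √(1 + r ^ 2) - ρ * r := by
  -- The square of the left side of `ρ * r + s ≤ √(1 + r²)` falls short by `(s * r - ρ)²`.
  have hk2 : k ^ 2 ≤ (s * r - ρ) ^ 2 := by
    rw [← sq_abs (s * r - ρ)]; gcongr
  set a := ρ * r + s with ha
  set e := k ^ 2 / (4 * B) with he
  have heB : 4 * B * e = k ^ 2 := by rw [he]; field_simp
  have he0 : 0 ≤ e := by positivity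
  have ha0 : 0 ≤ a := by positivity
  have hid : a ^ 2 + (s * r - ρ) ^ 2 = 1 + r ^ 2 := by
    rw [ha]; linear_combination (1 + r ^ 2) * h1
  have haB : a ≤ 3 / 2 * B := by
    refine le_of_sq_le_sq ?_ (by linarith)
    nlinarith [sq_nonneg (s * r - ρ)]
  have he1 : e ≤ B := by nlinarith
  have hsq : a + e ≤ √(1 + r ^ 2) := by
    refine Real.le_sqrt_of_sq_le ?_
    have : e * (2 * a + e) ≤ e * (4 * B) := by gcongr; linarith
    nlinarith
  linarith

lemma le_sqrt_one_add_sq_sub (hρ : 0 < ρ) (hs : 0 < s) (h1 : ρ ^ 2 + s ^ 2 = 1) {r : ℝ}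
    (hr : 0 ≤ r) : s ≤ √(1 + r ^ 2) - ρ * r := by
  have := add_le_sqrt_one_add_sq_sub hρ hs h1 hr (le_max_right 1 r) (le_max_left 1 r) le_rfl
    (abs_nonneg _)
  simpa using this

lemma sqrt_one_add_div_sq_sub (hρ : 0 < ρ) (hs : 0 < s) (h1 : ρ ^ 2 + s ^ 2 = 1) :
    √(1 + (ρ / s) ^ 2) - ρ * (ρ / s) = s := by
  have : √(1 + (ρ / s) ^ 2) = 1 / s := by
    rw [Real.sqrt_eq_iff_mul_self_eq (by positivity) (by positivity)]
    field_simp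
    linarith
  rw [this]
  field_simp
  linarith

end Profile

/-! ### The auxiliary problem at a typical realization -/

section TypicalBounds

variable {m n : ℕ} {f : EuclideanSpace ℝ (Fin n) → ℝ} {x₀ : EuclideanSpace ℝ (Fin n)}
  {q : EuclideanSpace ℝ (Fin n) → ℝ} {η : EuclideanSpace ℝ ((Fin m ⊕ Fin n) ⊕ Unit)}
  {δ ρ s B : ℝ}

lemma sqrt_one_add_sq_le_two_mul {r : ℝ} (hr : 0 ≤ r) (hrB : r ≤ B) (hB : 1 ≤ B) :
    √(1 + r ^ 2) ≤ 2 * B := by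
  rw [Real.sqrt_le_left (by linarith)]
  nlinarith

/-- The conic distance turns the linear term of the auxiliary objective into a multiple of the norm. -/
lemma IsTypical.inner_le (h : IsTypical δ (subdiffConeDist f x₀) q η)
    (hρ : 0 ≤ ρ) (hD : gaussianSqDist f x₀ = ρ ^ 2 * m) {σ : ℝ} (hσ : 0 < σ)
    {w : EuclideanSpace ℝ (Fin n)} (hw : w ∈ feasibleIncrements f x₀ σ) :
    inner ℝ (EuclideanSpace.comap (Sum.inl ∘ Sum.inr) η) w ≤ ‖w‖ * ((ρ + δ) * √m) := by
  obtain ⟨-, -, h3, -⟩ := h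
  rw [← gaussianSqDist_eq, hD, Real.sqrt_mul (sq_nonneg _), Real.sqrt_sq hρ] at h3
  refine (inner_le_norm_mul_subdiffConeDist (f := f) (x₀ := x₀)
    (fun s hs => inner_nonpos_of_mem_feasibleIncrements hσ hw hs) _).trans ?_
  gcongr
  linarith

lemma IsTypical.le_auxObjective {d : EuclideanSpace ℝ (Fin n) → ℝ} (h : IsTypical δ d q η)
    (w : EuclideanSpace ℝ (Fin n)) :
    √(1 + ‖w‖ ^ 2) * (√m - δ * √m) -
      inner ℝ (EuclideanSpace.comap (Sum.inl ∘ Sum.inr) η) w - δ * √m ≤ auxObjective η w := by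
  obtain ⟨h1, h2, -, -⟩ := h
  have h1' := (abs_le.1 h1).1
  have h2' := (abs_le.1 h2).1
  have h3 : √(1 + ‖w‖ ^ 2) * (√m - δ * √m) ≤
      √(1 + ‖w‖ ^ 2) * ‖EuclideanSpace.comap (Sum.inl ∘ Sum.inl) η‖ := by
    gcongr
    linarith
  unfold auxObjective
  linarith

lemma IsTypical.profile_le_auxObjective (h : IsTypical δ (subdiffConeDist f x₀) q η)
    (hδ : 0 ≤ δ) (hρ : 0 ≤ ρ) (hD : gaussianSqDist f x₀ = ρ ^ 2 * m) (hB : 1 ≤ B)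
    {σ : ℝ} (hσ : 0 < σ) {w : EuclideanSpace ℝ (Fin n)} (hw : w ∈ feasibleIncrements f x₀ σ)
    (hwB : ‖w‖ ≤ B) :
    (√(1 + ‖w‖ ^ 2) - ρ * ‖w‖ - 4 * B * δ) * √m ≤ auxObjective η w := by
  have h1 := h.le_auxObjective w
  have h2 := h.inner_le hρ hD hσ hw
  have h3 := sqrt_one_add_sq_le_two_mul (norm_nonneg w) hwB hB
  have hM : 0 ≤ δ * √m := by positivity
  nlinarith [mul_le_mul_of_nonneg_right h3 hM, mul_le_mul_of_nonneg_right hwB hM,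
    mul_le_mul_of_nonneg_right hB hM]

/-- Some point of `W` has an auxiliary objective close to the mean auxiliary value. -/
lemma IsTypical.exists_auxObjective_lt {d : EuclideanSpace ℝ (Fin n) → ℝ}
    {W : Set (EuclideanSpace ℝ (Fin n))} (h : IsTypical δ d (auxValue √m W) η) (hW : W.Nonempty)
    (hWB : W ⊆ Metric.closedBall 0 B) (hB : 1 ≤ B) (hδ : 0 < δ) (hm : 0 < m) :
    ∃ w ∈ W, auxObjective η w < (∫ h, auxValue √m W h ∂(stdGaussian _)) + 5 * B * δ * √m := by
  obtain ⟨h1, h2, -, h4⟩ := h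
  have hM : 0 < δ * √m := by positivity
  have h1' := (abs_le.1 h1).2
  have h2' := (abs_le.1 h2).2
  have h4' := (abs_le.1 h4).2
  obtain ⟨w, hw, hlt⟩ := exists_lt_of_auxValue_lt hW (lt_add_of_pos_right (auxValue √m W
    (EuclideanSpace.comap (Sum.inl ∘ Sum.inr) η)) hM)
  refine ⟨w, hw, ?_⟩
  have h3 := sqrt_one_add_sq_le_two_mul (norm_nonneg w) (mem_closedBall_zero_iff.1 (hWB hw)) hB
  have h5 : √(1 + ‖w‖ ^ 2) * ‖EuclideanSpace.comap (Sum.inl ∘ Sum.inl) η‖ ≤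
      √(1 + ‖w‖ ^ 2) * (√m + δ * √m) := by gcongr; linarith
  unfold auxObjective
  nlinarith [mul_le_mul_of_nonneg_right h3 hM.le, mul_le_mul_of_nonneg_right hB hM.le]

variable (f x₀) in
/-- The feasible increments in a ball. -/
def feasibleBall (σ r : ℝ) : Set (EuclideanSpace ℝ (Fin n)) :=
  feasibleIncrements f x₀ σ ∩ Metric.closedBall 0 r

/-- On the sphere of radius `r > ρ / s` the auxiliary objective exceeds the mean auxiliary value,
because shrinking such a point to the radius `ρ / s` keeps it feasible and lowers the objective by
the gap of the profile. -/
lemma IsTypical.lt_auxObjective_of_norm_eq (hf : ConvexOn ℝ Set.univ f) {σ r : ℝ} (hσ : 0 < σ)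
    (h : IsTypical δ (subdiffConeDist f x₀) (auxValue √m (feasibleBall f x₀ σ r)) η)
    (hδ : 0 < δ) (hm : 0 < m) (hρ : 0 < ρ) (hs : 0 < s) (h1 : ρ ^ 2 + s ^ 2 = 1)
    (hD : gaussianSqDist f x₀ = ρ ^ 2 * m) (hB : 1 ≤ B) (hRr : ρ / s ≤ r) (hrB : r ≤ B)
    (hgap : s + 12 * B * δ ≤ √(1 + r ^ 2) - ρ * r)
    {w : EuclideanSpace ℝ (Fin n)} (hw : w ∈ feasibleIncrements f x₀ σ) (hwr : ‖w‖ = r) :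
    (∫ h, auxValue √m (feasibleBall f x₀ σ r) h ∂(stdGaussian _)) + 6 * B * δ * √m <
      auxObjective η w := by
  have hR : 0 < ρ / s := by positivity
  have hr : 0 < r := hR.trans_le hRr
  set R := ρ / s with hRdef
  have hprof := sqrt_one_add_div_sq_sub hρ hs h1
  rw [← hRdef] at hprof
  have hin := h.inner_le hρ.le hD hσ hw
  have hlow := h.le_auxObjective w
  obtain ⟨-, -, -, h4⟩ := h
  have h4' := (abs_le.1 h4).1
  set g := EuclideanSpace.comap (Sum.inl ∘ Sum.inr) η
  set t := R / r with ht
  have ht0 : 0 ≤ t := by positivity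
  have ht1 : t ≤ 1 := (div_le_one hr).2 hRr
  have htr : t * r = R := div_mul_cancel₀ _ hr.ne'
  have hmem : t • w ∈ feasibleIncrements f x₀ σ := by
    have := convex_feasibleIncrements hf σ (zero_mem_feasibleIncrements σ) hw
      (sub_nonneg.2 ht1) ht0 (by ring)
    simpa using this
  have hnorm : ‖t • w‖ = R := by rw [norm_smul, Real.norm_of_nonneg ht0, hwr, htr]
  have hq := auxValue_le (M := √m) (B := ⟨r, hr.le⟩) (W := feasibleBall f x₀ σ r) (by positivity)
    Set.inter_subset_right g ⟨hmem, mem_closedBall_zero_iff.2 (hnorm.le.trans hRr)⟩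
  rw [hnorm, inner_smul_right] at hq
  rw [hwr] at hin hlow
  have hin' := mul_le_mul_of_nonneg_left hin (sub_nonneg.2 ht1)
  have hM : 0 < √(m : ℝ) := by positivity
  have hdM : 0 < δ * √m := by positivity
  have h3 := sqrt_one_add_sq_le_two_mul hr.le hrB hB
  have e1 : (1 - t) * (r * ((ρ + δ) * √m)) = (r - R) * (ρ * √m) + (r - R) * (δ * √m) := by
    rw [← htr]; ring
  rw [e1] at hin'
  have e2 : √m * √(1 + R ^ 2) = √m * s + ρ * R * √m := by
    rw [← hprof]; ring
  rw [e2] at hq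
  have k1 := mul_le_mul_of_nonneg_right hgap hM.le
  have k2 := mul_le_mul_of_nonneg_right h3 hdM.le
  have k3 := mul_le_mul_of_nonneg_right hB hdM.le
  have k4 : (r - R) * (δ * √m) ≤ B * (δ * √m) := by gcongr; linarith
  nlinarith

/-- The mean auxiliary value is at least the minimum of the profile, up to a small error. -/
lemma IsTypical.le_integral_auxValue {σ r : ℝ} (hσ : 0 < σ) (hr : 0 ≤ r)
    (h : IsTypical δ (subdiffConeDist f x₀) (auxValue √m (feasibleBall f x₀ σ r)) η)
    (hδ : 0 ≤ δ) (hρ : 0 < ρ) (hs : 0 < s) (h1 : ρ ^ 2 + s ^ 2 = 1)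
    (hD : gaussianSqDist f x₀ = ρ ^ 2 * m) (hB : 1 ≤ B) (hrB : r ≤ B) :
    (s - 2 * B * δ) * √m ≤ ∫ h, auxValue √m (feasibleBall f x₀ σ r) h ∂(stdGaussian _) := by
  have hM : 0 ≤ √(m : ℝ) := by positivity
  have hdM : 0 ≤ δ * √m := by positivity
  have k3 := mul_le_mul_of_nonneg_right hB hdM
  have hq : (s - B * δ) * √m ≤
      auxValue √m (feasibleBall f x₀ σ r) (EuclideanSpace.comap (Sum.inl ∘ Sum.inr) η) := by
    refine le_auxValue (W := feasibleBall f x₀ σ r)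
      ⟨0, zero_mem_feasibleIncrements σ, Metric.mem_closedBall_self hr⟩ fun w hw => ?_
    have hin := h.inner_le hρ.le hD hσ hw.1
    have hwr : ‖w‖ ≤ B := (mem_closedBall_zero_iff.1 hw.2).trans hrB
    have k1 := mul_le_mul_of_nonneg_right
      (le_sqrt_one_add_sq_sub hρ hs h1 (norm_nonneg w)) hM
    have k2 := mul_le_mul_of_nonneg_right hwr hdM
    nlinarith
  have h4' := (abs_le.1 h.2.2.2).2
  nlinarith

end TypicalBounds

/-! ### Probability bounds for the normalized squared error -/

section Probability

variable {m n : ℕ} {f : EuclideanSpace ℝ (Fin n) → ℝ} {x₀ : EuclideanSpace ℝ (Fin n)}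
  {δ ρ s r σ : ℝ} {B : NNReal}

/-- With overwhelming probability the minimizers of the standardized residual lie in any ball whose
radius `r > ρ / s` leaves a gap in the profile, and avoid any set on which the auxiliary objective
typically exceeds its mean value. -/
theorem stdGaussian_not_localized_le (hf : ConvexOn ℝ Set.univ f) (hfc : Continuous f)
    (hσ : 0 < σ) (hm : 0 < m) (hδ : 0 < δ)
    (hbig : √(4 * Real.exp (Real.pi ^ 2 / 8)) ≤ δ / 2 * √m)
    (hρ : 0 < ρ) (hs : 0 < s) (h1 : ρ ^ 2 + s ^ 2 = 1)
    (hD : gaussianSqDist f x₀ = ρ ^ 2 * m) (hB : 1 ≤ B) (hRr : ρ / s ≤ r) (hrB : r ≤ B)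
    (hgap : s + 12 * B * δ ≤ √(1 + r ^ 2) - ρ * r)
    {J : Set (EuclideanSpace ℝ (Fin n))}
    (hJ : ∀ η : EuclideanSpace ℝ ((Fin m ⊕ Fin n) ⊕ Unit),
      IsTypical δ (subdiffConeDist f x₀) (auxValue √m (feasibleBall f x₀ σ r)) η → ∀ w ∈ J,
        (∫ h, auxValue √m (feasibleBall f x₀ σ r) h ∂(stdGaussian _)) + 6 * B * δ * √m <
          auxObjective η w) :
    stdGaussian (EuclideanSpace ℝ ((Fin m × Fin n) ⊕ Fin m))
      {ζ | ¬ ((∃ w ∈ feasibleIncrements f x₀ σ,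
          IsMinOn (fun w => ‖linearResidual ζ w‖) (feasibleIncrements f x₀ σ) w) ∧
        ∀ w ∈ feasibleIncrements f x₀ σ,
          IsMinOn (fun w => ‖linearResidual ζ w‖) (feasibleIncrements f x₀ σ) w →
            ‖w‖ < r ∧ w ∉ J)} ≤
      ENNReal.ofReal (32 * Real.exp (-(δ ^ 2 / (2 * Real.pi ^ 2 * B ^ 2) * m))) := by
  set q := auxValue √m (feasibleBall f x₀ σ r) with hq
  have hB' : (1 : ℝ) ≤ B := by exact_mod_cast hB
  have hr : 0 ≤ r := (by positivity : 0 ≤ ρ / s).trans hRr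
  have hWne : (feasibleBall f x₀ σ r).Nonempty :=
    ⟨0, zero_mem_feasibleIncrements σ, Metric.mem_closedBall_self hr⟩
  have hWB : feasibleBall f x₀ σ r ⊆ Metric.closedBall 0 B :=
    Set.inter_subset_right.trans (Metric.closedBall_subset_closedBall hrB)
  have htyp : stdGaussian _
      {η : EuclideanSpace ℝ ((Fin m ⊕ Fin n) ⊕ Unit) | ¬ IsTypical δ (subdiffConeDist f x₀) q η} ≤
        ENNReal.ofReal (8 * Real.exp (-(δ ^ 2 / (2 * Real.pi ^ 2 * B ^ 2) * m))) :=
    stdGaussian_not_isTypical_le hδ.le hbig lipschitzWith_subdiffConeDist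
      subdiffConeDist_nonneg hB (lipschitzWith_auxValue (Real.sqrt_nonneg _) hWne hWB)
  have h32 : ENNReal.ofReal (32 * Real.exp (-(δ ^ 2 / (2 * Real.pi ^ 2 * B ^ 2) * m))) =
      4 * ENNReal.ofReal (8 * Real.exp (-(δ ^ 2 / (2 * Real.pi ^ 2 * B ^ 2) * m))) := by
    rw [show (4 : ENNReal) = ENNReal.ofReal 4 by simp, ← ENNReal.ofReal_mul (by norm_num)]
    congr 1; ring
  rw [h32]
  by_cases hne : ∃ η : EuclideanSpace ℝ ((Fin m ⊕ Fin n) ⊕ Unit),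
      IsTypical δ (subdiffConeDist f x₀) q η
  · obtain ⟨η₀, hη₀⟩ := hne
    have hM : 0 < √(m : ℝ) := by positivity
    have hEq := hη₀.le_integral_auxValue hσ hr hδ.le hρ hs h1 hD hB' hrB
    have hdB : 0 < B * δ * √m := by positivity
    have hsM : 0 < s * √m := by positivity
    have key := stdGaussian_not_minimizers_le hm (K := feasibleIncrements f x₀ σ)
      (J := {w | w ∈ feasibleIncrements f x₀ σ ∧ ‖w‖ = r} ∪ J)
      (convex_feasibleIncrements hf σ) (isClosed_feasibleIncrements hfc σ)
      (zero_mem_feasibleIncrements σ) hr (fun w hw hwr => Or.inl ⟨hw, hwr⟩)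
      (c := (∫ h, q h ∂(stdGaussian _)) + 5 * B * δ * √m)
      (c' := (∫ h, q h ∂(stdGaussian _)) + 6 * B * δ * √m) (by linarith) (by linarith)
      (G := {η | IsTypical δ (subdiffConeDist f x₀) q η})
      (fun η hη => IsTypical.exists_auxObjective_lt hη hWne hWB hB' hδ hm)
      (fun η hη w hw => by
        rcases hw with ⟨hw, hwr⟩ | hw
        · exact IsTypical.lt_auxObjective_of_norm_eq hf hσ hη hδ hm hρ hs h1 hD hB' hRr hrB hgap
            hw hwr
        · exact hJ η hη w hw)
    refine (measure_mono ?_).trans (key.trans (mul_le_mul_right htyp 4))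
    intro ζ hζ hgood
    refine hζ ⟨hgood.1, fun w hw hmin => ?_⟩
    obtain ⟨h2, h3⟩ := hgood.2 w hw hmin
    exact ⟨h2, fun hwJ => h3 (Or.inr hwJ)⟩
  · -- Without typical realizations the asserted bound exceeds `1`.
    push Not at hne
    have h8 : (1 : ENNReal) ≤
        ENNReal.ofReal (8 * Real.exp (-(δ ^ 2 / (2 * Real.pi ^ 2 * B ^ 2) * m))) := by
      refine le_trans ?_ htyp
      rw [show {η : EuclideanSpace ℝ ((Fin m ⊕ Fin n) ⊕ Unit) |
        ¬ IsTypical δ (subdiffConeDist f x₀) q η} = Set.univ from Set.eq_univ_of_forall hne,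
        measure_univ]
    exact prob_le_one.trans (h8.trans (le_mul_of_one_le_left' (by norm_num)))

/-- For small `σ` the auxiliary objective on the feasible points of norm at most `r₀` typically
exceeds the mean auxiliary value over a ball whose radius is at least `ρ / s`, provided the profile
has a gap on `[0, r₀]`. -/
theorem exists_forall_isTypical_lt_auxObjective (hf : ConvexOn ℝ Set.univ f) (hfc : Continuous f)
    (h0 : 0 ∉ subdifferential f x₀) (hm : 0 < m) (hδ : 0 < δ)
    (hbig : √(4 * Real.exp (Real.pi ^ 2 / 8)) ≤ δ / 2 * √m)
    (hρ : 0 < ρ) (hs : 0 < s) (h1 : ρ ^ 2 + s ^ 2 = 1)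
    (hD : gaussianSqDist f x₀ = ρ ^ 2 * m) (hB : 1 ≤ B) (hRr : ρ / s ≤ r) (hrB : r ≤ B)
    {r₀ : ℝ} (hr₀ : r₀ ≤ B)
    (hgap : ∀ t, 0 ≤ t → t ≤ r₀ → s + 12 * B * δ ≤ √(1 + t ^ 2) - ρ * t) :
    ∃ σ₀ : ℝ, 0 < σ₀ ∧ ∀ σ : ℝ, 0 < σ → σ ≤ σ₀ →
      ∀ η : EuclideanSpace ℝ ((Fin m ⊕ Fin n) ⊕ Unit),
        IsTypical δ (subdiffConeDist f x₀) (auxValue √m (feasibleBall f x₀ σ r)) η →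
        ∀ w ∈ feasibleBall f x₀ σ r₀,
          (∫ h, auxValue √m (feasibleBall f x₀ σ r) h ∂(stdGaussian _)) + 6 * B * δ * √m <
            auxObjective η w := by
  have hB' : (1 : ℝ) ≤ B := by exact_mod_cast hB
  have hM : 0 < √(m : ℝ) := by positivity
  have hdM : 0 < δ * √m := by positivity
  obtain ⟨σ₀, hσ₀, hσ⟩ := exists_integral_auxValue_le hf hfc h0 hM.le
    (by positivity : 0 ≤ ρ / s) hRr hrB hdM
  refine ⟨σ₀, hσ₀, fun σ hσp hσle η hη w hw => ?_⟩
  have hE := hσ σ hσp hσle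
  have hwr : ‖w‖ ≤ r₀ := mem_closedBall_zero_iff.1 hw.2
  have hlow := hη.profile_le_auxObjective hδ.le hρ.le hD hB' hσp hw.1 (hwr.trans hr₀)
  have hg := mul_le_mul_of_nonneg_right (hgap _ (norm_nonneg w) hwr) hM.le
  have hd := ((lipschitzWith_subdiffConeDist (f := f) (x₀ := x₀)).sqrt_integral_sq_sub_integral
    subdiffConeDist_nonneg).2
  rw [← gaussianSqDist_eq, hD, Real.sqrt_mul (sq_nonneg _), Real.sqrt_sq hρ.le] at hd
  set e := ∫ h, subdiffConeDist f x₀ h ∂(stdGaussian _)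
  have hprof := sqrt_one_add_div_sq_sub hρ hs h1
  set R := ρ / s
  have e2 : √m * √(1 + R ^ 2) = √m * s + R * (ρ * √m) := by
    rw [← hprof]; ring
  rw [e2] at hE
  have hR : 0 ≤ R := by positivity
  have k1 : R * (ρ * √m - e) ≤ R * (δ / 2 * √m) := by gcongr; linarith
  have k2 : R * (δ / 2 * √m) ≤ B * (δ / 2 * √m) := by gcongr; linarith
  have k3 := mul_le_mul_of_nonneg_right hB' hdM.le
  have hE' : ∫ h, auxValue √m (feasibleBall f x₀ σ r) h ∂(stdGaussian _) ≤
    √m * s + R * (ρ * √m) - R * e + δ * √m := hE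
  nlinarith

end Probability

section Constants

/-- The radii `(ρ / s) * √(1 ± ε)` leave a gap in the profile that depends only on `ε` and on a lower
bound for `ρ²`. -/
lemma profile_gap {ρ s εL ε B δ t : ℝ} (hρ : 0 < ρ) (hs : 0 < s) (h1 : ρ ^ 2 + s ^ 2 = 1)
    (hεL : 0 < εL) (hρL : εL ≤ ρ ^ 2) (hε : 0 < ε) (hε1 : ε ≤ 1) (hB : 1 ≤ B) (ht : 0 ≤ t)
    (htB : t ≤ B) (hδ : δ = εL * ε ^ 2 / (432 * B ^ 2))
    (htR : t ≤ ρ / s * √(1 - ε) ∨ t = ρ / s * √(1 + ε)) :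
    s + 12 * B * δ ≤ √(1 + t ^ 2) - ρ * t := by
  have hk : √εL * (ε / 3) ≤ |s * t - ρ| := by
    have hL : √εL ≤ ρ := Real.sqrt_le_iff.2 ⟨hρ.le, hρL⟩
    refine (by gcongr : √εL * (ε / 3) ≤ ρ * (ε / 3)).trans ?_
    rcases htR with h | rfl
    · have h2 : s * t ≤ ρ * √(1 - ε) := by
        calc s * t ≤ s * (ρ / s * √(1 - ε)) := by gcongr
          _ = ρ * √(1 - ε) := by field_simp
      have h3 : √(1 - ε) ≤ 1 - ε / 3 := Real.sqrt_le_iff.2 ⟨by linarith, by nlinarith⟩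
      have h4 := mul_le_mul_of_nonneg_left h3 hρ.le
      rw [abs_sub_comm]
      exact le_trans (by linarith) (le_abs_self _)
    · have h2 : s * (ρ / s * √(1 + ε)) = ρ * √(1 + ε) := by field_simp
      have h3 : 1 + ε / 3 ≤ √(1 + ε) := Real.le_sqrt_of_sq_le (by nlinarith)
      have h4 := mul_le_mul_of_nonneg_left h3 hρ.le
      rw [h2]
      exact le_trans (by linarith) (le_abs_self _)
  have h := add_le_sqrt_one_add_sq_sub hρ hs h1 ht htB hB (by positivity) hk
  have e : (√εL * (ε / 3)) ^ 2 / (4 * B) = 12 * B * δ := by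
    rw [mul_pow, Real.sq_sqrt hεL.le, hδ]
    field_simp
    norm_num
  rwa [e] at h

/-- The constant `32` is absorbed by halving the exponent. -/
lemma ofReal_mul_exp_le_of_le {c x : ℝ} (hc : 0 < c) (hx : 64 / c ≤ x) :
    ENNReal.ofReal (32 * Real.exp (-(c * x))) ≤ ENNReal.ofReal (Real.exp (-(c / 2 * x))) := by
  refine ENNReal.ofReal_le_ofReal ?_
  have h1 : 64 ≤ x * c := (div_le_iff₀ hc).1 hx
  have h2 : (32 : ℝ) ≤ Real.exp (c / 2 * x) := by
    have := Real.add_one_le_exp (c / 2 * x)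
    linarith
  calc 32 * Real.exp (-(c * x)) ≤ Real.exp (c / 2 * x) * Real.exp (-(c * x)) := by gcongr
    _ = Real.exp (-(c / 2 * x)) := by rw [← Real.exp_add]; congr 1; ring

end Constants

/-! ### The squared error of the constrained LASSO -/

theorem mainTheorem1 (εL : ℝ) (hεL : 0 < εL) (ε : ℝ) (hε : 0 < ε) :
    ∃ C : ℝ, 0 < C ∧ ∃ m₀ : ℕ, ∀ m : ℕ, m₀ ≤ m →
      ∀ (n : ℕ) (f : EuclideanSpace ℝ (Fin n) → ℝ) (x₀ : EuclideanSpace ℝ (Fin n)),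
        ConvexOn ℝ Set.univ f → Continuous f → 0 ∉ subdifferential f x₀ →
        gaussianSqDist f x₀ ≤ (1 - εL) * m → εL * m ≤ gaussianSqDist f x₀ →
        -- the bound for every noise level
        (∀ σ : ℝ, 0 < σ →
          ∀ (Ω : Type*) [MeasurableSpace Ω] (P : Measure Ω) [IsProbabilityMeasure P]
            (A : Ω → Matrix (Fin m) (Fin n) ℝ) (z : Ω → EuclideanSpace ℝ (Fin m)),
            IsGaussianModel P σ A z →
            P {ω | ¬ ((constrainedLasso f x₀ (A ω) (z ω)).Nonempty ∧
                ∀ x ∈ constrainedLasso f x₀ (A ω) (z ω),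
                  ‖x - x₀‖ ^ 2 / σ ^ 2 ≤
                    (1 + ε) * (gaussianSqDist f x₀ / (m - gaussianSqDist f x₀)))} ≤
              ENNReal.ofReal (Real.exp (-(C * m)))) ∧
        -- the two-sided estimate for small noise levels
        (∃ σ₀ : ℝ, 0 < σ₀ ∧ ∀ σ : ℝ, 0 < σ → σ ≤ σ₀ →
          ∀ (Ω : Type*) [MeasurableSpace Ω] (P : Measure Ω) [IsProbabilityMeasure P]
            (A : Ω → Matrix (Fin m) (Fin n) ℝ) (z : Ω → EuclideanSpace ℝ (Fin m)),
            IsGaussianModel P σ A z →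
            P {ω | ¬ ((constrainedLasso f x₀ (A ω) (z ω)).Nonempty ∧
                ∀ x ∈ constrainedLasso f x₀ (A ω) (z ω),
                  |‖x - x₀‖ ^ 2 / σ ^ 2 *
                    ((m - gaussianSqDist f x₀) / gaussianSqDist f x₀) - 1| < ε)} ≤
              ENNReal.ofReal (Real.exp (-(C * m)))) := by
  set ε' := min ε 1 with hε'
  have hε'0 : 0 < ε' := lt_min hε one_pos
  have hε'1 : ε' ≤ 1 := min_le_right _ _
  have hε'ε : ε' ≤ ε := min_le_left _ _
  -- `B` bounds every radius that occurs, since `ρ² / s² ≤ 1 / εL`.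
  set B : NNReal := (1 + 2 / εL).toNNReal
  have hBval : (B : ℝ) = 1 + 2 / εL := Real.coe_toNNReal _ (by positivity)
  have hB' : (1 : ℝ) ≤ B := by
    rw [hBval]; exact le_add_of_nonneg_right (by positivity)
  have hB2 : 2 / εL ≤ (B : ℝ) ^ 2 := by
    have : 0 < 2 / εL := by positivity
    rw [hBval]
    nlinarith
  clear_value B
  have hB : 1 ≤ B := by exact_mod_cast hB'
  set δ : ℝ := εL * ε' ^ 2 / (432 * B ^ 2) with hδdef
  have hδ : 0 < δ := by positivity
  set c : ℝ := δ ^ 2 / (2 * Real.pi ^ 2 * B ^ 2) with hcdef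
  have hc : 0 < c := by have := Real.pi_pos; positivity
  set T : ℝ := √(4 * Real.exp (Real.pi ^ 2 / 8)) with hT
  have hT0 : 0 ≤ T := Real.sqrt_nonneg _
  refine ⟨c / 2, by positivity, max 1 (max ⌈64 / c⌉₊ ⌈(2 * T / δ) ^ 2⌉₊), ?_⟩
  intro m hm n f x₀ hf hfc h0 hDu hDl
  simp only [max_le_iff, Nat.ceil_le] at hm
  obtain ⟨hm1, hmc, hmT⟩ := hm
  have hm0 : 0 < m := hm1
  have hmR : (0 : ℝ) < m := by exact_mod_cast hm0
  have hbig : T ≤ δ / 2 * √m := by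
    have h1 : 2 * T / δ ≤ √m := Real.le_sqrt_of_sq_le hmT
    rw [div_le_iff₀ hδ] at h1
    linarith
  set D := gaussianSqDist f x₀ with hD
  have hDpos : 0 < D := (by positivity : 0 < εL * m).trans_le hDl
  have hDm : εL * m ≤ m - D := by linarith
  have hmD : 0 < m - D := (by positivity : 0 < εL * m).trans_le hDm
  set ρ := √(D / m)
  set s := √((m - D) / m)
  have hρ : 0 < ρ := Real.sqrt_pos.2 (by positivity)
  have hs : 0 < s := Real.sqrt_pos.2 (by positivity)
  have hρ2 : ρ ^ 2 = D / m := Real.sq_sqrt (by positivity)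
  have hs2 : s ^ 2 = (m - D) / m := Real.sq_sqrt (by positivity)
  have h1 : ρ ^ 2 + s ^ 2 = 1 := by rw [hρ2, hs2]; field_simp; ring
  have hρL : εL ≤ ρ ^ 2 := by rw [hρ2, le_div_iff₀ hmR]; exact hDl
  have hsL : εL ≤ s ^ 2 := by rw [hs2, le_div_iff₀ hmR]; exact hDm
  have hDρ : D = ρ ^ 2 * m := by rw [hρ2]; field_simp
  have hR2 : (ρ / s) ^ 2 = D / (m - D) := by rw [div_pow, hρ2, hs2]; field_simp
  have hR : 0 < ρ / s := by positivity
  set r := ρ / s * √(1 + ε') with hr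
  set r₀ := ρ / s * √(1 - ε') with hr₀
  have hr2 : r ^ 2 = D / (m - D) * (1 + ε') := by
    rw [hr, mul_pow, hR2, Real.sq_sqrt (by linarith)]
  have hr₀2 : r₀ ^ 2 = D / (m - D) * (1 - ε') := by
    rw [hr₀, mul_pow, hR2, Real.sq_sqrt (by linarith)]
  have hr00 : 0 ≤ r₀ := by positivity
  have hRr : ρ / s ≤ r := le_mul_of_one_le_right hR.le (Real.one_le_sqrt.2 (by linarith))
  have hr0 : 0 < r := hR.trans_le hRr
  have hr₀R : r₀ ≤ ρ / s := mul_le_of_le_one_right hR.le (Real.sqrt_le_one.2 (by linarith))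
  have hrB : r ≤ B := by
    have h2 : D / (m - D) ≤ 1 / εL := by
      rw [div_le_div_iff₀ hmD hεL]
      linarith [mul_le_mul_of_nonneg_left (by linarith : D ≤ m) hεL.le]
    refine le_of_sq_le_sq ?_ (by positivity)
    calc r ^ 2 = D / (m - D) * (1 + ε') := hr2
      _ ≤ 1 / εL * 2 := by gcongr; linarith
      _ = 2 / εL := by ring
      _ ≤ (B : ℝ) ^ 2 := hB2
  have hr₀B : r₀ ≤ B := (hr₀R.trans hRr).trans hrB
  have hgap : s + 12 * B * δ ≤ √(1 + r ^ 2) - ρ * r :=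
    profile_gap hρ hs h1 hεL hρL hε'0 hε'1 hB' hr0.le hrB hδdef (Or.inr rfl)
  have hgap₀ (t : ℝ) (ht : 0 ≤ t) (htr : t ≤ r₀) : s + 12 * B * δ ≤ √(1 + t ^ 2) - ρ * t :=
    profile_gap hρ hs h1 hεL hρL hε'0 hε'1 hB' ht (htr.trans hr₀B) hδdef (Or.inl htr)
  constructor
  · intro σ hσ Ω _ P _ A z hmodel
    have hmain := (stdGaussian_not_localized_le hf hfc hσ hm0 hδ hbig hρ hs h1 hDρ hB hRr hrB hgap
      (J := ∅) fun _ _ _ hw => hw.elim).trans (ofReal_mul_exp_le_of_le hc hmc)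
    refine le_trans (measure_mono ?_) ((hmodel.measure_preimage_le hσ _).trans hmain)
    intro ω hω hgood
    refine hω (constrainedLasso_nonempty_and_forall hσ
      (p := fun t => t ≤ (1 + ε) * (D / (m - D))) hgood.1 fun w hw hmin => ?_)
    have h2 := (hgood.2 w hw hmin).1
    calc ‖w‖ ^ 2 ≤ r ^ 2 := by gcongr
      _ = (1 + ε') * (D / (m - D)) := by rw [hr2, mul_comm]
      _ ≤ (1 + ε) * (D / (m - D)) := by gcongr
  · obtain ⟨σ₀, hσ₀, hsmall⟩ := exists_forall_isTypical_lt_auxObjective hf hfc h0 hm0 hδ hbig hρ hs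
      h1 hDρ hB hRr hrB hr₀B hgap₀
    refine ⟨σ₀, hσ₀, ?_⟩
    intro σ hσ hσle Ω _ P _ A z hmodel
    have hmain := (stdGaussian_not_localized_le hf hfc hσ hm0 hδ hbig hρ hs h1 hDρ hB hRr hrB hgap
      (hsmall σ hσ hσle)).trans (ofReal_mul_exp_le_of_le hc hmc)
    refine le_trans (measure_mono ?_) ((hmodel.measure_preimage_le hσ _).trans hmain)
    intro ω hω hgood
    refine hω (constrainedLasso_nonempty_and_forall hσ
      (p := fun t => |t * ((m - D) / D) - 1| < ε) hgood.1 fun w hw hmin => ?_)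
    obtain ⟨h2, h3⟩ := hgood.2 w hw hmin
    have h4 : r₀ < ‖w‖ := by
      by_contra! hle
      exact h3 ⟨hw, mem_closedBall_zero_iff.2 hle⟩
    have hpos : 0 < (m - D) / D := by positivity
    have e (a : ℝ) : D / (m - D) * a * ((m - D) / D) = a := by field_simp
    have hu : ‖w‖ ^ 2 * ((m - D) / D) < 1 + ε' := by
      rw [← e (1 + ε'), ← hr2]; gcongr
    have hl : 1 - ε' < ‖w‖ ^ 2 * ((m - D) / D) := by
      rw [← e (1 - ε'), ← hr₀2]; gcongr
    exact abs_lt.2 ⟨by linarith, by linarith⟩
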